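/- **Notation.** Let $\mathbb F=\mathbb F_q$ be a finite field ($q$ any prime power), $\mathbb E=\mathbb F_{q^2}$ its quadratic extension with norm $N:\mathbb E^\times\to\mathbb F^\times$, $G=GL(2,\mathbb F)$, $PGL(2,\mathbb F)=G/Z(G)$. Characters of $\mathbb F^\times$, $\mathbb E^\times$ are homomorphisms to $\mathbb C^\times$. For $\nu\in\widehat{\mathbb E^\times}$ put $\underline\nu=\nu|_{\mathbb F^\times}$ and $\overline\nu(a)=\nu(a^q)$; $\nu$ is *primitive* if it is not of the form $\mu\circ N$ with $\mu\in\widehat{\mathbb F^\times}$. Write $\delta_\chi=1$ if the character $\chi$ of $\mathbb F^\times$ is trivial and $\delta_\chi=0$ otherwise, and $\delta^{\mathbb E^\times}_\chi$ likewise for characters of $\mathbb E^\times$. Consider the complex representations of $G$: * $\chi_\mu=\mu\circ\det$; * $I(\mu_1,\mu_2)$, induced from the character $\begin{pmatrix}a&*\\0&d\end{pmatrix}\mapsto\mu_1(a)\mu_2(d)$ of the upper triangular group; * $St_\mu=I(\mu,\mu)/\chi_\mu$, where $\chi_\mu\subset I(\mu,\mu)$ is the line spanned by the function $\mu\circ\det$;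 * for $\nu$ primitive, $\mathcal C_\nu$: fix a nontrivial additive character $\psi$ of $\mathbb F$ and an $\mathbb F$-basis of $\mathbb E$, which embeds $\mathbb E^\times$ in $G$ by its multiplication action on $\mathbb E$. With $\nu_\psi\left(a\begin{pmatrix}1&x\\0&1\end{pmatrix}\right)=\nu(a)\psi(x)$ on $ZN$ ($Z$ the centre of $G$, $N$ here the group of upper unipotent matrices), $\mathcal C_\nu$ is the common kernel of all $G$-maps $\mathrm{Ind}_{ZN}^G\nu_\psi\to\mathrm{Ind}_{\mathbb E^\times}^G\nu$. For finite-dimensional complex representations of $H=G$ or $H=PGL(2,\mathbb F)$ put $\langle\pi\pi'\rangle=\frac1{|H|}\sum_{h\in H}\chi_\pi(h)\chi_{\pi'}(h)$ and $N_{\pi,\pi',\pi''}=\langle\pi\pi'\pi''\rangle=\frac1{|H|}\sum_{h\in H}\chi_\pi(h)\chi_{\pi'}(h)\chi_{\pi''}(h)$, and let $\check\pi$ be the contragredient of $\pi$. **Proposition.** (1) For all characters of $\mathbb F^\times$, and all primitive characters of $\mathbb E^\times$ where an index of $\mathcal C$ is concerned, $$\begin{aligned} \langle I(\mu_1,\mu_2)I(\nu_1,\nu_2)I(\rho_1,\rho_2)\rangle&=\delta_{\mu_1\nu_1\rho_1\mu_2\nu_2\rho_2}+\delta_{\mu_1\nu_1\rho_1}\delta_{\mu_2\nu_2\rho_2}+\delta_{\mu_2\nu_1\rho_1}\delta_{\mu_1\nu_2\rho_2}\\&\quad+\delta_{\mu_1\nu_2\rho_1}\delta_{\mu_2\nu_1\rho_2}+\delta_{\mu_1\nu_1\rho_2}\delta_{\mu_2\nu_2\rho_1},\\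 \langle I(\mu_1,\mu_2)I(\nu_1,\nu_2)St_\rho\rangle&=\delta_{\mu_1\mu_2\nu_1\nu_2\rho^2}+\delta_{\mu_1\nu_1\rho}\delta_{\mu_2\nu_2\rho}+\delta_{\mu_1\nu_2\rho}\delta_{\mu_2\nu_1\rho},\\ \langle I(\mu_1,\mu_2)I(\nu_1,\nu_2)\mathcal C_\rho\rangle&=\delta_{\mu_1\mu_2\nu_1\nu_2\underline\rho},\\ \langle I(\mu_1,\mu_2)St_\nu St_\rho\rangle&=\delta_{\mu_1\mu_2\nu^2\rho^2}+\delta_{\mu_1\nu\rho}\delta_{\mu_2\nu\rho},\\ \langle St_\mu St_\nu St_\rho\rangle&=\delta_{\mu^2\nu^2\rho^2},\\ \langle I(\mu_1,\mu_2)St_\nu\mathcal C_\rho\rangle&=\delta_{\mu_1\mu_2\nu^2\underline\rho},\\ \langle I(\mu_1,\mu_2)\mathcal C_\nu\mathcal C_\rho\rangle&=\delta_{\mu_1\mu_2\underline\nu\,\underline\rho},\\ \langle St_\mu St_\nu\mathcal C_\rho\rangle&=\delta_{\mu^2\nu^2\underline\rho},\\ \langle St_\mu\mathcal C_\nu\mathcal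 C_\rho\rangle&=\delta_{\mu^2\underline\nu\,\underline\rho}-\delta^{\mathbb E^\times}_{(\mu\circ N)\nu\rho}-\delta^{\mathbb E^\times}_{(\mu\circ N)\nu\overline\rho},\\ \langle\mathcal C_\mu\mathcal C_\nu\mathcal C_\rho\rangle&=\delta_{\underline\mu\,\underline\nu\,\underline\rho}-\bigl(\delta^{\mathbb E^\times}_{\mu\nu\rho}+\delta^{\mathbb E^\times}_{\overline\mu\nu\rho}+\delta^{\mathbb E^\times}_{\mu\overline\nu\rho}+\delta^{\mathbb E^\times}_{\mu\nu\overline\rho}\bigr), \end{aligned}$$ and the last two numbers lie in $\{0,1\}$. (2) $\chi_\mu\otimes\chi_\nu\simeq\chi_{\mu\nu}$, $\chi_\mu\otimes I(\nu,\rho)\simeq I(\mu\nu,\mu\rho)$, $\chi_\mu\otimes St_\nu\simeq St_{\mu\nu}$ and, for $\nu$ primitive, $(\mu\circ N)\nu$ is primitive and $\chi_\mu\otimes\mathcal C_\nu\simeq\mathcal C_{(\mu\circ N)\nu}$. For all finite-dimensional $\pi,\pi'$, $\langle\pi\pi'\chi_\mu\rangle=\langle\pi\,(\chi_\mu\otimes\pi')\rangle$.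 Moreover $\langle\chi_\mu\chi_\nu\rangle=\delta_{\mu\nu}$, $\langle I(\mu_1,\mu_2)I(\nu_1,\nu_2)\rangle=\delta_{\mu_1\nu_1}\delta_{\mu_2\nu_2}+\delta_{\mu_1\nu_2}\delta_{\mu_2\nu_1}$, $\langle St_\mu St_\nu\rangle=\delta_{\mu\nu}$, $\langle\mathcal C_\nu\mathcal C_\rho\rangle=\delta^{\mathbb E^\times}_{\nu\rho}+\delta^{\mathbb E^\times}_{\nu\overline\rho}$ for $\nu,\rho$ primitive, and $\langle\pi\pi'\rangle=0$ for $\pi,\pi'$ in two different ones of the four families $\chi_\mu$; $I(\mu_1,\mu_2)$ with $\mu_1\ne\mu_2$; $St_\mu$; $\mathcal C_\nu$ with $\nu$ primitive. (3) This determines the fusion ring of $G$. Indeed $\check\chi_\mu\simeq\chi_{\mu^{-1}}$, $\check I(\mu_1,\mu_2)\simeq I(\mu_1^{-1},\mu_2^{-1})$, $\check{St}_\mu\simeq St_{\mu^{-1}}$ and, for $\nu$ primitive, $\nu^{-1}$ is primitive and $\check{\mathcal C}_\nu\simeq\mathcal C_{\nu^{-1}}$. For all finite-dimensional $\pi,\pi',\pi''$,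 $\langle\pi\pi'\pi''\rangle=\dim\mathrm{Hom}_G(\check\pi'',\pi\otimes\pi')$ and $\langle\pi\pi'\check\pi''\rangle=\dim\mathrm{Hom}_G(\pi'',\pi\otimes\pi')$. For $\nu$ primitive, $\mathrm{Ind}_{ZN}^G\nu_\psi\simeq\mathcal C_\nu\oplus\mathrm{Ind}_{\mathbb E^\times}^G\nu$. The representations $\chi_\mu$, $St_\mu$, and $\mathcal C_\nu$ ($\nu$ primitive) are irreducible, $I(\mu_1,\mu_2)$ is irreducible if and only if $\mu_1\neq\mu_2$, and every finite-dimensional irreducible complex representation of $G$ is isomorphic to one in these four families. (4) It also determines the fusion ring of $PGL(2,\mathbb F)$: a finite-dimensional complex representation of $PGL(2,\mathbb F)$ is irreducible if and only if its pull-back to $G$ is; $\langle\pi\pi'\pi''\rangle$ computed over $PGL(2,\mathbb F)$ equals that of the pull-backs computed over $G$, and $\langle\pi\pi'\check\pi''\rangle=\dim\mathrm{Hom}_{PGL(2,\mathbb F)}(\pi'',\pi\otimes\pi')$; and $\chi_\mu$, $I(\mu_1,\mu_2)$, $St_\mu$, $\mathcal C_\nu$ ($\nu$ primitive) are pulled back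 from $PGL(2,\mathbb F)$ if and only if $\mu^2=1$, $\mu_1\mu_2=1$, $\mu^2=1$, $\underline\nu=1$ respectively. -/

import Mathlib

open scoped MatrixGroups

noncomputable section

namespace GLTwo

section General

variable {G : Type*} [Group G]

/-- The one-dimensional representation on `ℂ` attached to a multiplicative character. -/
def ofChar {K : Type*} [Monoid K] (χ : K →* ℂ) : Representation ℂ K ℂ where
  toFun k := χ k • LinearMap.id
  map_one' := by ext; simp
  map_mul' a b := by ext; simp [mul_comm]

/-- The space of functions `f : G → ℂ` with `f (φ k * g) = χ k * f g` for all `k` and `g`. -/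
def Induced {K : Type*} [Group K] (φ : K →* G) (χ : K →* ℂ) : Type _ :=
  Representation.coindV φ (ofChar χ)

instance {K : Type*} [Group K] (φ : K →* G) (χ : K →* ℂ) : AddCommGroup (Induced φ χ) :=
  inferInstanceAs (AddCommGroup (Representation.coindV φ (ofChar χ)))

instance {K : Type*} [Group K] (φ : K →* G) (χ : K →* ℂ) : Module ℂ (Induced φ χ) :=
  inferInstanceAs (Module ℂ (Representation.coindV φ (ofChar χ)))

instance [Finite G] {K : Type*} [Group K] (φ : K →* G) (χ : K →* ℂ) :
    FiniteDimensional ℂ (Induced φ χ) :=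
  inferInstanceAs (FiniteDimensional ℂ (Representation.coindV φ (ofChar χ)))

/-- The representation of `G` induced from the character `χ` of `K` along an injective
homomorphism `φ : K → G` (with `G` finite): `G` acts by right translation on the functions
`f : G → ℂ` with `f (φ k * g) = χ k * f g`. -/
def induced {K : Type*} [Group K] (φ : K →* G) (χ : K →* ℂ) :
    Representation ℂ G (Induced φ χ) :=
  Representation.coind φ (ofChar χ)

/-- `⟨π π'⟩ = |G|⁻¹ ∑ χ_π(g) χ_π'(g)`. -/
def pairing [Fintype G] {V W : Type*} [AddCommGroup V] [Module ℂ V] [AddCommGroup W] [Module ℂ W]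
    (π : Representation ℂ G V) (π' : Representation ℂ G W) : ℂ :=
  (Fintype.card G : ℂ)⁻¹ * ∑ g : G, π.character g * π'.character g

/-- `⟨π π' π''⟩ = |G|⁻¹ ∑ χ_π(g) χ_π'(g) χ_π''(g)`. -/
def triple [Fintype G] {V W X : Type*} [AddCommGroup V] [Module ℂ V] [AddCommGroup W] [Module ℂ W]
    [AddCommGroup X] [Module ℂ X]
    (π : Representation ℂ G V) (π' : Representation ℂ G W) (π'' : Representation ℂ G X) : ℂ :=
  (Fintype.card G : ℂ)⁻¹ * ∑ g : G, π.character g * π'.character g * π''.character g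

/-- The delta function at the trivial character of an abelian group. -/
def delta {A : Type*} [CommGroup A] (χ : A →* ℂˣ) : ℂ :=
  open Classical in if χ = 1 then 1 else 0

end General

variable {F : Type*} [Field F]

/-- The one-dimensional representation `χ_μ(g) = μ (det g)` of `GL(2, F)`. -/
def oneDim (μ : Fˣ →* ℂˣ) : Representation ℂ (GL (Fin 2) F) ℂ :=
  ofChar ((Units.coeHom ℂ).comp (μ.comp Matrix.GeneralLinearGroup.det))

variable (F) in
/-- The Borel subgroup of upper triangular matrices. -/
def borel : Subgroup (GL (Fin 2) F) where
  carrier := {g | g 1 0 = 0}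
  one_mem' := by simp
  mul_mem' {a b} ha hb := by
    simp only [Set.mem_ofPred_eq] at ha hb ⊢
    simp [Matrix.mul_apply, Fin.sum_univ_two, ha, hb]
  inv_mem' {a} ha := by
    simp only [Set.mem_ofPred_eq] at ha ⊢
    simp [Matrix.coe_units_inv, Matrix.inv_def, Matrix.adjugate_fin_two, ha]

theorem borel_diag_ne_zero (g : borel F) :
    (g : GL (Fin 2) F) 0 0 ≠ 0 ∧ (g : GL (Fin 2) F) 1 1 ≠ 0 := by
  have h0 : (g : GL (Fin 2) F) 1 0 = 0 := g.2
  have h := (Matrix.GeneralLinearGroup.det (g : GL (Fin 2) F)).ne_zero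
  rw [Matrix.GeneralLinearGroup.val_det_apply, Matrix.det_fin_two, h0] at h
  constructor <;> intro hz <;> simp [hz] at h

/-- The first diagonal entry of an upper triangular matrix. -/
def borelFst : borel F →* Fˣ where
  toFun g := Units.mk0 ((g : GL (Fin 2) F) 0 0) (borel_diag_ne_zero g).1
  map_one' := by ext; simp
  map_mul' a b := by
    have hb : (b : GL (Fin 2) F) 1 0 = 0 := b.2
    ext; simp [Matrix.mul_apply, Fin.sum_univ_two, hb]

/-- The second diagonal entry of an upper triangular matrix. -/
def borelSnd : borel F →* Fˣ where
  toFun g := Units.mk0 ((g : GL (Fin 2) F) 1 1) (borel_diag_ne_zero g).2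
  map_one' := by ext; simp
  map_mul' a b := by
    have ha : (a : GL (Fin 2) F) 1 0 = 0 := a.2
    ext; simp [Matrix.mul_apply, Fin.sum_univ_two, ha]

/-- The character `μ₁ ⊗ μ₂` of the diagonal torus, extended trivially to the Borel subgroup. -/
def borelChar (μ₁ μ₂ : Fˣ →* ℂˣ) : borel F →* ℂ :=
  (Units.coeHom ℂ).comp (μ₁.comp borelFst * μ₂.comp borelSnd)

/-- `I(μ₁, μ₂)`, induced from the character `μ₁ ⊗ μ₂` of the Borel subgroup. -/
abbrev principal (μ₁ μ₂ : Fˣ →* ℂˣ) :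
    Representation ℂ (GL (Fin 2) F)
      (Induced (borel F).subtype (borelChar μ₁ μ₂)) :=
  induced (borel F).subtype (borelChar μ₁ μ₂)

/-- The embedding of `χ_μ` in `I(μ, μ)`, as the line spanned by the function `μ ∘ det`. -/
def oneDimToPrincipal (μ : Fˣ →* ℂˣ) :
    (oneDim μ).IntertwiningMap (principal μ μ) where
  toFun c := ⟨fun g => (μ (Matrix.GeneralLinearGroup.det g) : ℂ) * c, by
    intro k h
    have h0 : (k : GL (Fin 2) F) 1 0 = 0 := k.2
    have hk : Matrix.GeneralLinearGroup.det (k : GL (Fin 2) F) = borelFst k * borelSnd k := by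
      ext
      simp [borelFst, borelSnd, Matrix.det_fin_two, h0]
    simp [ofChar, borelChar, hk, mul_assoc]⟩
  map_add' a b := Subtype.ext (funext fun _ => mul_add _ a b)
  map_smul' a b := Subtype.ext (funext fun _ => mul_left_comm _ a b)
  isIntertwining' g := by
    refine LinearMap.ext_ring (Subtype.ext (funext fun h => ?_))
    change (μ (Matrix.GeneralLinearGroup.det h) : ℂ) *
        ((μ (Matrix.GeneralLinearGroup.det g) : ℂ) * 1) =
      (μ (Matrix.GeneralLinearGroup.det (h * g)) : ℂ) * 1
    simp

/-- `St_μ = I(μ, μ) / χ_μ`. -/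
abbrev steinberg (μ : Fˣ →* ℂˣ) :
    Representation ℂ (GL (Fin 2) F)
      (Induced (borel F).subtype (borelChar μ μ) ⧸
        (oneDimToPrincipal μ).range.toSubmodule) :=
  (principal μ μ).quotient (oneDimToPrincipal μ).range.toSubmodule
    (oneDimToPrincipal μ).range.apply_mem_toSubmodule

variable {E : Type*} [Field E] [Algebra F E]

/-- `μ ∘ N`, where `N : Eˣ → Fˣ` is the norm. -/
def compNorm (E : Type*) [Field E] [Algebra F E] (μ : Fˣ →* ℂˣ) : Eˣ →* ℂˣ :=
  μ.comp (Units.map (Algebra.norm F : E →* F))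

variable (F) in
/-- The restriction of a character of `Eˣ` to `Fˣ`. -/
def res (ν : Eˣ →* ℂˣ) : Fˣ →* ℂˣ :=
  ν.comp (Units.map (algebraMap F E : F →* E))

variable (F) in
/-- The conjugate character `ν ∘ σ`, where `σ(a) = a ^ q` is the Frobenius of `E` over `F`. -/
def conj (ν : Eˣ →* ℂˣ) : Eˣ →* ℂˣ :=
  ν.comp (powMonoidHom (Nat.card F))

variable (F) in
/-- A character of `Eˣ` is primitive if it does not factor through the norm to `Fˣ`. -/
def Primitive (ν : Eˣ →* ℂˣ) : Prop :=
  ∀ μ : Fˣ →* ℂˣ, ν ≠ compNorm E μ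

/-- `Eˣ` as a subgroup of `GL(2, F)`, by its multiplication action on `E` in the basis `b`. -/
def torus (b : Module.Basis (Fin 2) F E) : Eˣ →* GL (Fin 2) F :=
  Units.map (Algebra.leftMulMatrix b : E →* Matrix (Fin 2) (Fin 2) F)

/-- The representation of `GL(2, F)` induced from the character `ν` of `Eˣ`. -/
abbrev torusInd (b : Module.Basis (Fin 2) F E) (ν : Eˣ →* ℂˣ) :
    Representation ℂ (GL (Fin 2) F)
      (Induced (torus b) ((Units.coeHom ℂ).comp ν)) :=
  induced (torus b) ((Units.coeHom ℂ).comp ν)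

variable (F) in
/-- The subgroup `ZN`, parametrized by `(a, x) ↦ a • !![1, x; 0, 1]`. -/
def centerUnipotent : Fˣ × Multiplicative F →* GL (Fin 2) F :=
  MonoidHom.noncommCoprod (Matrix.GeneralLinearGroup.scalar (Fin 2))
    (Matrix.GeneralLinearGroup.upperRightHom (R := F)).toMonoidHom (fun a x => by
      ext i j
      fin_cases i <;> fin_cases j <;>
        simp [Matrix.GeneralLinearGroup.scalar, Matrix.mul_apply, Fin.sum_univ_two, mul_comm])

/-- The character `ν_ψ` of `ZN`, with value `ν(a) ψ(x)` at `a • !![1, x; 0, 1]`. -/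
def centerUnipotentChar (ψ : AddChar F ℂ) (ν : Eˣ →* ℂˣ) : Fˣ × Multiplicative F →* ℂ :=
  MonoidHom.coprod ((Units.coeHom ℂ).comp (res F ν)) ψ.toMonoidHom

/-- The representation of `GL(2, F)` induced from the character `ν_ψ` of `ZN`. -/
abbrev centerUnipotentInd (ψ : AddChar F ℂ) (ν : Eˣ →* ℂˣ) :
    Representation ℂ (GL (Fin 2) F)
      (Induced (centerUnipotent F) (centerUnipotentChar ψ ν)) :=
  induced (centerUnipotent F) (centerUnipotentChar ψ ν)

/-- The subspace of `Ind_{ZN} ν_ψ` killed by all intertwining maps to `Ind_{Eˣ} ν`. When `ν` is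
primitive this is the complement of the summand `Ind_{Eˣ} ν` of `Ind_{ZN} ν_ψ`. -/
def cuspidalSub (b : Module.Basis (Fin 2) F E) (ψ : AddChar F ℂ) (ν : Eˣ →* ℂˣ) :
    Subrepresentation (centerUnipotentInd ψ ν) where
  toSubmodule := ⨅ T : (centerUnipotentInd ψ ν).IntertwiningMap (torusInd b ν), T.ker.toSubmodule
  apply_mem_toSubmodule g v hv := by
    rw [Submodule.mem_iInf] at hv ⊢
    exact fun T => T.ker.apply_mem_toSubmodule g (hv T)

/-- The cuspidal representation `C_ν`. -/
abbrev cuspidal (b : Module.Basis (Fin 2) F E) (ψ : AddChar F ℂ) (ν : Eˣ →* ℂˣ) :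
    Representation ℂ (GL (Fin 2) F) (cuspidalSub b ψ ν).toSubmodule :=
  (cuspidalSub b ψ ν).toRepresentation

/-- The representation of `GL(2, F)` obtained from a representation of `PGL(2, F)`. -/
abbrev inflate {V : Type*} [AddCommGroup V] [Module ℂ V]
    (ρ : Representation ℂ PGL(2, F) V) : Representation ℂ (GL (Fin 2) F) V :=
  ρ.comp Matrix.ProjGenLinGroup.mk

end GLTwo

end

/-! Everything is read off characters, by an integration formula that needs no sizes of conjugacy
classes. The virtual character `I(1,1) + Ind_{Eˣ} 1 - Ind_{ZN} 1_ψ` takes the value 2 on each of the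
four types of classes (scalar, nonsemisimple, split, elliptic). Hence the average of a class
function `f` is half the signed sum of its averages against three induced characters, and Frobenius
reciprocity (`sum_character_induced_mul`) turns these into sums over the Borel subgroup, `Eˣ` and
`ZN`. If `f` has a central character `ω`, and its values at split and elliptic elements extend to
functions `D`, `T` on the whole tori (`HasTable`), the outcome is `HasTable.avg_eq`: half of the
average of `D`, plus the average of `T`, plus an explicit constant times `δ_ω`. Tables multiply, and
here `D` and `T` are signed sums of characters of the tori, so each triple product reduces to
orthogonality of characters of `Fˣ` and `Eˣ` and an identity in `q`.

For `ν` primitive, `ν` differs from its conjugate (Hilbert 90), and the formula shows that `Ind_{ZN}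
ν_ψ - Ind_{Eˣ} ν` has norm 1, degree `q - 1 > 0`, and is orthogonal to `Ind_{Eˣ} ν`. An intertwining
map of maximal rank between the two is therefore onto, with irreducible kernel, and every other
intertwining map kills that kernel; so `C_ν` is this kernel (`exists_cuspidal_kernel`).

Isomorphisms come from equality of characters (`nonempty_equiv_of_character_eq`), irreducibility
from norm 1. The list is complete because an irreducible character missing from it would be
orthogonal to every principal series and every `Ind_{ZN} ν_ψ - Ind_{Eˣ} ν`; Fourier inversion on the
two tori then forces its degree to vanish (`apply_one_eq_zero_of_avg`). Passage to `PGL(2, F)` only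
uses that averages are unchanged under a surjection and that scalars act through the central
character. -/

noncomputable section

namespace GLTwo

/-! ### Complements of subrepresentations and intertwining maps of maximal rank. -/

section FiniteGroup

open Representation Module

variable {G : Type*} [Group G] {V W : Type*} [AddCommGroup V] [Module ℂ V]
  [AddCommGroup W] [Module ℂ W]

theorem toRepresentation_apply {ρ : Representation ℂ G V} (A : Subrepresentation ρ) (g : G)
    (x : A.toSubmodule) : (A.toRepresentation g x : V) = ρ g x := rfl

theorem isCompl_toSubmodule {ρ : Representation ℂ G V} {A B : Subrepresentation ρ}
    (h : IsCompl A B) : IsCompl A.toSubmodule B.toSubmodule := by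
  refine ⟨disjoint_iff.2 ?_, codisjoint_iff.2 ?_⟩
  · rw [← Subrepresentation.toSubmodule_inf, h.inf_eq_bot]; rfl
  · rw [← Subrepresentation.toSubmodule_sup, h.sup_eq_top]; rfl

/-- A decomposition into complementary subrepresentations is a product decomposition. -/
def prodEquivOfIsCompl {ρ : Representation ℂ G V} {A B : Subrepresentation ρ} (h : IsCompl A B) :
    (A.toRepresentation.prod B.toRepresentation).Equiv ρ :=
  .mk (Submodule.prodEquivOfIsCompl _ _ (isCompl_toSubmodule h)) fun g => by
    refine LinearMap.ext fun x => ?_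
    simp [toRepresentation_apply]

/-- The quotient by a subrepresentation is isomorphic to any complement. -/
def quotientEquivOfIsCompl {ρ : Representation ℂ G V} {A B : Subrepresentation ρ}
    (h : IsCompl A B) :
    B.toRepresentation.Equiv (ρ.quotient A.toSubmodule A.apply_mem_toSubmodule) :=
  .mk (Submodule.quotientEquivOfIsCompl _ _ (isCompl_toSubmodule h)).symm fun g => by
    refine LinearMap.ext fun x => ?_
    simp [toRepresentation_apply]

theorem character_prod [FiniteDimensional ℂ V] [FiniteDimensional ℂ W]
    (ρ : Representation ℂ G V) (σ : Representation ℂ G W) (g : G) :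
    (ρ.prod σ).character g = ρ.character g + σ.character g :=
  LinearMap.trace_prodMap' (ρ g) (σ g)

theorem character_add_of_isCompl [FiniteDimensional ℂ V] {ρ : Representation ℂ G V}
    {A B : Subrepresentation ρ} (h : IsCompl A B) (g : G) :
    A.toRepresentation.character g + B.toRepresentation.character g = ρ.character g := by
  rw [← character_prod, char_iso (prodEquivOfIsCompl h)]

theorem character_quotient [Finite G] [FiniteDimensional ℂ V] {ρ : Representation ℂ G V}
    (A : Subrepresentation ρ) (g : G) :
    (ρ.quotient A.toSubmodule A.apply_mem_toSubmodule).character g =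
      ρ.character g - A.toRepresentation.character g := by
  obtain ⟨B, h⟩ := exists_isCompl A
  rw [← char_iso (quotientEquivOfIsCompl h), ← character_add_of_isCompl h]
  ring

/-- An intertwining map is an isomorphism from any complement of its kernel to its range. -/
theorem nonempty_equiv_range {ρ : Representation ℂ G V} {σ : Representation ℂ G W}
    (T : ρ.IntertwiningMap σ) {A : Subrepresentation ρ} (h : IsCompl T.ker A) :
    Nonempty (A.toRepresentation.Equiv T.range.toRepresentation) := by
  have hc := isCompl_toSubmodule h
  let f : A.toRepresentation.IntertwiningMap T.range.toRepresentation :=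
    { toLinearMap := (T.toLinearMap.domRestrict A.toSubmodule).codRestrict _
        fun x => (T.mem_range _ _ _).2 ⟨_, rfl⟩
      isIntertwining' := fun g => LinearMap.ext fun x => Subtype.ext (T.isIntertwining _ _ g x) }
  refine ⟨f.ofBijective ⟨?_, ?_⟩⟩
  · refine (injective_iff_map_eq_zero f.toLinearMap).2 fun x hx => ?_
    have hx' : (x : V) ∈ T.ker.toSubmodule := (T.mem_ker _ _ _).2 (congrArg Subtype.val hx)
    have := (Submodule.disjoint_def.1 hc.disjoint) _ hx' x.2
    exact Subtype.ext this
  · rintro ⟨_, hw⟩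
    obtain ⟨v, rfl⟩ := (T.mem_range _ _ _).1 hw
    obtain ⟨k, hk, a, ha, rfl⟩ := Submodule.mem_sup.1 (hc.sup_eq_top ▸ Submodule.mem_top (x := v))
    refine ⟨⟨a, ha⟩, Subtype.ext ?_⟩
    have : T k = 0 := (T.mem_ker _ _ _).1 hk
    change T a = T (k + a)
    rw [map_add, this, zero_add]

/-- A map of maximal rank uses up all that `ρ` and `σ` have in common: a nonzero map from its kernel
to a complement of its range could be added to it and would enlarge the range. -/
theorem exists_isCompl_of_maximal_rank [Finite G] [FiniteDimensional ℂ V] [FiniteDimensional ℂ W]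
    (ρ : Representation ℂ G V) (σ : Representation ℂ G W) :
    ∃ (T : ρ.IntertwiningMap σ) (B : Subrepresentation σ), IsCompl T.range B ∧
      (∀ S : T.ker.toRepresentation.IntertwiningMap B.toRepresentation, S = 0) ∧
      ∀ g, ρ.character g + B.toRepresentation.character g =
        σ.character g + T.ker.toRepresentation.character g := by
  obtain ⟨T, hT⟩ : ∃ T : ρ.IntertwiningMap σ, ∀ T' : ρ.IntertwiningMap σ,
      finrank ℂ T'.range.toSubmodule ≤ finrank ℂ T.range.toSubmodule := by
    have hfin : (Set.range fun T : ρ.IntertwiningMap σ => finrank ℂ T.range.toSubmodule).Finite :=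
      (Set.finite_Iic (finrank ℂ W)).subset (by
        rintro _ ⟨T, rfl⟩
        exact Submodule.finrank_le _)
    obtain ⟨_, ⟨T, rfl⟩, h⟩ := hfin.exists_maximal (Set.range_nonempty _)
    exact ⟨T, fun T' => (le_total _ _).elim id fun h' => h ⟨T', rfl⟩ h'⟩
  obtain ⟨A, hA⟩ := exists_isCompl T.ker
  obtain ⟨B, hB⟩ := exists_isCompl T.range
  refine ⟨T, B, hB, fun S => ?_, fun g => ?_⟩
  · have hcA := isCompl_toSubmodule hA
    have hcB := isCompl_toSubmodule hB
    let p : ρ.IntertwiningMap T.ker.toRepresentation :=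
      (IntertwiningMap.fst ℂ _ _).comp (prodEquivOfIsCompl hA).symm.toIntertwiningMap
    let i : B.toRepresentation.IntertwiningMap σ :=
      ⟨B.toSubmodule.subtype, fun g => rfl⟩
    have hpk : ∀ k : T.ker.toSubmodule, p k = k := fun k =>
      Submodule.projectionOnto_apply_left hcA k
    have hpa : ∀ a : A.toSubmodule, p a = 0 := fun a =>
      (Submodule.projectionOnto_apply_eq_zero_iff hcA).2 a.2
    -- `T'` agrees with `T` on the complement `A` of the kernel, so its range contains that of `T`;
    -- by maximality the ranges coincide. Then `S k = T' k` lies both in the range of `T` and in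
    -- `B`, hence is zero.
    let T' := T + i.comp (S.comp p)
    have hT' : ∀ v, T' v = T v + (S (p v) : W) := fun v => rfl
    have h1 : T.range.toSubmodule ≤ T'.range.toSubmodule := by
      intro w hw
      obtain ⟨v, rfl⟩ := (T.mem_range _ _ _).1 hw
      obtain ⟨k, hk, a, ha, rfl⟩ :=
        Submodule.mem_sup.1 (hcA.sup_eq_top ▸ Submodule.mem_top (x := v))
      refine (T'.mem_range _ _ _).2 ⟨a, ?_⟩
      have h0 : T k = 0 := (T.mem_ker _ _ _).1 hk
      rw [hT', hpa ⟨a, ha⟩, map_add, h0]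
      simp
    have h2 := Submodule.eq_of_le_of_finrank_le h1 (hT T')
    refine IntertwiningMap.ext (LinearMap.ext fun k => Subtype.ext ?_)
    have h3 : (S k : W) ∈ T.range.toSubmodule := by
      rw [h2]
      refine (T'.mem_range _ _ _).2 ⟨k, ?_⟩
      have h0 : T k = 0 := (T.mem_ker _ _ _).1 k.2
      rw [hT', hpk, h0, zero_add]
    exact Submodule.disjoint_def.1 hcB.disjoint _ h3 (S k).2
  · obtain ⟨e⟩ := nonempty_equiv_range T hA
    rw [← character_add_of_isCompl hA, ← character_add_of_isCompl hB, char_iso e]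
    ring

end FiniteGroup

/-! ### Orthogonality of characters, isomorphism and irreducibility criteria. -/

section Inner

open Representation Module

variable {G : Type*} [Group G] [Fintype G]

/-- The bilinear form `|G|⁻¹ ∑ f(g) h(g⁻¹)` on functions on a finite group. -/
def charInner (f h : G → ℂ) : ℂ := (Fintype.card G : ℂ)⁻¹ * ∑ g : G, f g * h g⁻¹

theorem charInner_comm (f h : G → ℂ) : charInner f h = charInner h f := by
  unfold charInner
  congr 1
  exact Fintype.sum_equiv (Equiv.inv G) _ _ fun g => by simp [mul_comm]

theorem charInner_sub_left (f f' h : G → ℂ) :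
    charInner (f - f') h = charInner f h - charInner f' h := by
  simp [charInner, sub_mul, mul_sub]

theorem charInner_sub_right (f h h' : G → ℂ) :
    charInner f (h - h') = charInner f h - charInner f h' := by
  simp [charInner, mul_sub]

theorem charInner_add_left (f f' h : G → ℂ) :
    charInner (f + f') h = charInner f h + charInner f' h := by
  simp [charInner, add_mul, mul_add, Finset.sum_add_distrib]

theorem charInner_add_right (f h h' : G → ℂ) :
    charInner f (h + h') = charInner f h + charInner f h' := by
  simp [charInner, mul_add, Finset.sum_add_distrib]

variable {V W X : Type*} [AddCommGroup V] [Module ℂ V] [FiniteDimensional ℂ V]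
  [AddCommGroup W] [Module ℂ W] [FiniteDimensional ℂ W]
  [AddCommGroup X] [Module ℂ X] [FiniteDimensional ℂ X]

theorem charInner_character (σ : Representation ℂ G W) (ρ : Representation ℂ G V) :
    charInner σ.character ρ.character = (finrank ℂ (ρ.IntertwiningMap σ) : ℂ) := by
  have : Invertible (Nat.card G : ℂ) := invertibleOfNonzero (by simp)
  rw [← card_inv_mul_sum_char_mul_char_eq_finrank, charInner, Fintype.card_eq_nat_card]

omit [FiniteDimensional ℂ V] in
theorem pairing_dual (π : Representation ℂ G V) (π' : Representation ℂ G W) :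
    pairing π π'.dual = charInner π.character π'.character := by
  simp [pairing, charInner]

/-- The dual has character `χ_{π''}(g⁻¹)`, so the triple average is the `charInner` of `π.tprod π'`
with `π''.dual`. -/
theorem triple_eq_finrank (π : Representation ℂ G V) (π' : Representation ℂ G W)
    (π'' : Representation ℂ G X) :
    triple π π' π'' = (finrank ℂ (π''.dual.IntertwiningMap (π.tprod π')) : ℂ) := by
  rw [← charInner_character]
  simp [triple, charInner]

theorem triple_dual_eq_finrank (π : Representation ℂ G V) (π' : Representation ℂ G W)
    (π'' : Representation ℂ G X) :
    triple π π' π''.dual = (finrank ℂ (π''.IntertwiningMap (π.tprod π')) : ℂ) := by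
  rw [← charInner_character]
  simp [triple, charInner]

omit [Fintype G] in
theorem finrank_intertwiningMap_self_pos [Nontrivial V] (ρ : Representation ℂ G V) :
    0 < finrank ℂ (ρ.IntertwiningMap ρ) := by
  have : Nontrivial (ρ.IntertwiningMap ρ) := by
    obtain ⟨v, hv⟩ := exists_ne (0 : V)
    refine ⟨⟨IntertwiningMap.id ρ, 0, fun h => hv ?_⟩⟩
    exact congrArg (fun T : ρ.IntertwiningMap ρ => T v) h
  exact finrank_pos

theorem subsingleton_of_charInner_self {ρ : Representation ℂ G V}
    (h : charInner ρ.character ρ.character = 0) : Subsingleton V := by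
  by_contra hn
  rw [not_subsingleton_iff_nontrivial] at hn
  rw [charInner_character] at h
  exact (finrank_intertwiningMap_self_pos ρ).ne' (by exact_mod_cast h)

omit [Fintype G] [FiniteDimensional ℂ V] [FiniteDimensional ℂ W] in
theorem finrank_eq_zero_of_forall {ρ : Representation ℂ G V} {σ : Representation ℂ G W}
    (h : ∀ T : ρ.IntertwiningMap σ, T = 0) : finrank ℂ (ρ.IntertwiningMap σ) = 0 := by
  have : Subsingleton (ρ.IntertwiningMap σ) := ⟨fun a b => (h a).trans (h b).symm⟩
  exact finrank_zero_of_subsingleton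

/-- The difference of two characters is a difference of two orthogonal characters. -/
theorem exists_orthogonal_decomposition (ρ : Representation ℂ G V) (σ : Representation ℂ G W) :
    ∃ (T : ρ.IntertwiningMap σ) (B : Subrepresentation σ), IsCompl T.range B ∧
      ρ.character - σ.character =
        T.ker.toRepresentation.character - B.toRepresentation.character ∧
      charInner (ρ.character - σ.character) (ρ.character - σ.character) =
        ((finrank ℂ (T.ker.toRepresentation.IntertwiningMap T.ker.toRepresentation) +
          finrank ℂ (B.toRepresentation.IntertwiningMap B.toRepresentation) : ℕ) : ℂ) := by
  obtain ⟨T, B, hB, hz, hc⟩ := exists_isCompl_of_maximal_rank ρ σ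
  have hd : ρ.character - σ.character =
      T.ker.toRepresentation.character - B.toRepresentation.character :=
    funext fun g => by simp only [Pi.sub_apply]; linear_combination hc g
  refine ⟨T, B, hB, hd, ?_⟩
  -- There is no nonzero map from the kernel to `B`, so the cross terms in the norm drop out.
  have h0 : charInner B.toRepresentation.character T.ker.toRepresentation.character = 0 := by
    rw [charInner_character, finrank_eq_zero_of_forall hz, Nat.cast_zero]
  rw [hd, charInner_sub_left, charInner_sub_right, charInner_sub_right, h0, charInner_comm _
    B.toRepresentation.character, h0, charInner_character, charInner_character]
  push_cast
  ring

theorem subsingleton_of_finrank_intertwiningMap_self {ρ : Representation ℂ G V}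
    (h : finrank ℂ (ρ.IntertwiningMap ρ) = 0) : Subsingleton V :=
  subsingleton_of_charInner_self (ρ := ρ) (by rw [charInner_character, h, Nat.cast_zero])

/-- Two representations with the same character are isomorphic. -/
theorem nonempty_equiv_of_character_eq {ρ : Representation ℂ G V} {σ : Representation ℂ G W}
    (h : ρ.character = σ.character) : Nonempty (ρ.Equiv σ) := by
  obtain ⟨T, B, hB, -, hn⟩ := exists_orthogonal_decomposition ρ σ
  rw [h, sub_self] at hn
  have h0 : charInner (0 : G → ℂ) 0 = 0 := by simp [charInner]
  rw [h0] at hn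
  -- The norm of the zero difference is a sum of two dimensions of endomorphism algebras; both
  -- vanish, so `T` has zero kernel and its range has zero complement.
  have hn' := (Nat.cast_eq_zero.1 hn.symm)
  have hk := subsingleton_of_finrank_intertwiningMap_self (Nat.eq_zero_of_add_eq_zero_right hn')
  have hb := subsingleton_of_finrank_intertwiningMap_self (Nat.eq_zero_of_add_eq_zero_left hn')
  refine ⟨T.ofBijective ⟨?_, ?_⟩⟩
  · refine (injective_iff_map_eq_zero T.toLinearMap).2 fun x hx => ?_
    have := Subsingleton.elim (⟨x, (T.mem_ker _ _ _).2 hx⟩ : T.ker.toSubmodule) 0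
    exact congrArg Subtype.val this
  · intro w
    have hs := (isCompl_toSubmodule hB).sup_eq_top
    rw [(Submodule.subsingleton_iff_eq_bot.1 hb), sup_bot_eq] at hs
    exact (T.mem_range _ _ _).1 (show w ∈ T.range.toSubmodule from hs ▸ Submodule.mem_top)

/-- The norm is the dimension of the endomorphism algebra, and two nonzero complementary summands
would each contribute at least 1 to it. -/
theorem isIrreducible_of_charInner_self {ρ : Representation ℂ G V}
    (h : charInner ρ.character ρ.character = 1) : ρ.IsIrreducible := by
  have hV : Nontrivial V := by
    by_contra hn
    rw [not_nontrivial_iff_subsingleton] at hn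
    have : Subsingleton (ρ.IntertwiningMap ρ) :=
      ⟨fun a b => IntertwiningMap.ext (LinearMap.ext fun x => Subsingleton.elim _ _)⟩
    rw [charInner_character, finrank_zero_of_subsingleton] at h
    simp at h
  have : Nontrivial (Subrepresentation ρ) := by
    refine ⟨⊥, ⊤, fun hbt => ?_⟩
    have : (⊥ : Submodule ℂ V) = ⊤ := congrArg Subrepresentation.toSubmodule hbt
    exact bot_ne_top this
  refine ⟨fun A => ?_⟩
  obtain ⟨B, hB⟩ := exists_isCompl A
  have hc : ρ.character = A.toRepresentation.character + B.toRepresentation.character := by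
    ext g
    rw [← character_add_of_isCompl hB, Pi.add_apply]
  by_contra! hA
  have key : ∀ C : Subrepresentation ρ, C ≠ ⊥ → Nontrivial C.toSubmodule := fun C hC =>
    Submodule.nontrivial_iff_ne_bot.2 fun h => hC (Subrepresentation.toSubmodule_injective h)
  have hBb : B ≠ ⊥ := fun h => hA.2 (by simpa [h] using hB.sup_eq_top)
  have := key A hA.1
  have := key B hBb
  have h1 := finrank_intertwiningMap_self_pos A.toRepresentation
  have h2 := finrank_intertwiningMap_self_pos B.toRepresentation
  rw [hc] at h
  simp only [charInner_add_left, charInner_add_right, charInner_character] at h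
  norm_cast at h
  omega

theorem isIrreducible_iff_charInner_self {ρ : Representation ℂ G V} :
    ρ.IsIrreducible ↔ charInner ρ.character ρ.character = 1 :=
  ⟨fun h => by rw [charInner_character, IsIrreducible.finrank_intertwiningMap_self]; simp,
    isIrreducible_of_charInner_self⟩

theorem charInner_eq_zero_of_isEmpty {ρ : Representation ℂ G V} {σ : Representation ℂ G W}
    (hρ : ρ.IsIrreducible) (hσ : σ.IsIrreducible) (h : ¬ Nonempty (ρ.Equiv σ)) :
    charInner ρ.character σ.character = 0 := by
  rw [not_nonempty_iff] at h
  rw [charInner_comm, charInner_character, finrank_zero_of_subsingleton, Nat.cast_zero]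

/-- A virtual character `χ_ρ - χ_σ` of norm one and positive degree is the character of the
kernel of an intertwining map `ρ → σ`. -/
theorem exists_irreducible_kernel {ρ : Representation ℂ G V} {σ : Representation ℂ G W}
    (h : charInner (ρ.character - σ.character) (ρ.character - σ.character) = 1)
    (hd : finrank ℂ W < finrank ℂ V) :
    ∃ T : ρ.IntertwiningMap σ, T.ker.toRepresentation.IsIrreducible ∧
      T.ker.toRepresentation.character = ρ.character - σ.character := by
  obtain ⟨T, B, hB, hc, hn⟩ := exists_orthogonal_decomposition ρ σ
  rw [h] at hn
  have hn' := (Nat.cast_eq_one.1 hn.symm)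
  have h1 := congrFun hc 1
  simp only [Pi.sub_apply, char_one] at h1
  have h1' : finrank ℂ V + finrank ℂ B.toSubmodule = finrank ℂ T.ker.toSubmodule + finrank ℂ W := by
    have : (finrank ℂ V + finrank ℂ B.toSubmodule : ℂ) =
      finrank ℂ T.ker.toSubmodule + finrank ℂ W := by linear_combination h1
    exact_mod_cast this
  have hk : 0 < finrank ℂ T.ker.toSubmodule := by omega
  have := finrank_pos_iff.1 hk
  have hk' := finrank_intertwiningMap_self_pos T.ker.toRepresentation
  -- The norm 1 is a sum of two natural numbers, and positivity of the degree gives the kernel its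
  -- share; nothing is left for `B`.
  have hb := subsingleton_of_finrank_intertwiningMap_self (ρ := B.toRepresentation) (by omega)
  have hb' : B.toRepresentation.character = 0 := by
    ext g
    rw [character, Subsingleton.elim (B.toRepresentation g) 0, map_zero]; rfl
  rw [hb', sub_zero] at hc
  exact ⟨T, isIrreducible_of_charInner_self (hc ▸ h), hc.symm⟩

/-- If moreover `χ_ρ - χ_σ` is orthogonal to `χ_σ`, that kernel is the common kernel of all
intertwining maps `ρ → σ`. -/
theorem iInf_ker_eq {ρ : Representation ℂ G V} {σ : Representation ℂ G W}
    (T : ρ.IntertwiningMap σ) (hT : charInner T.ker.toRepresentation.character σ.character = 0) :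
    ⨅ S : ρ.IntertwiningMap σ, S.ker.toSubmodule = T.ker.toSubmodule := by
  refine le_antisymm (iInf_le _ T) (le_iInf fun S v hv => ?_)
  rw [charInner_comm, charInner_character, Nat.cast_eq_zero] at hT
  have := finrank_zero_iff.1 hT
  -- Orthogonality says that there is no nonzero map from the kernel of `T` to `σ`, so the
  -- restriction of `S` to it vanishes.
  have h0 := Subsingleton.elim (α := T.ker.toRepresentation.IntertwiningMap σ)
    ⟨S.toLinearMap.domRestrict T.ker.toSubmodule,
      fun g => LinearMap.ext fun x => S.isIntertwining _ _ g x⟩ 0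
  exact (S.mem_ker _ _ _).2 (congrArg (fun R => R ⟨v, hv⟩) h0)

end Inner

/-! ### The character of an induced representation and Frobenius reciprocity. -/

section InducedCharacter

open Representation Module

variable {G : Type*} [Group G] [Fintype G] {K : Type*} [Group K] [Fintype K]

open Classical in
/-- The character of an induced representation. -/
theorem character_induced (φ : K →* G) (χ : K →* ℂ) (g : G) :
    (induced φ χ).character g =
      (Fintype.card K : ℂ)⁻¹ * ∑ x : G, ∑ k : K, if x * g * x⁻¹ = φ k then χ k else 0 := by
  have hK : (Fintype.card K : ℂ) ≠ 0 := by simp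
  -- Averaging over `K` against `χ⁻¹` projects all functions on `G` onto the induced space.
  let P : (G → ℂ) →ₗ[ℂ] (G → ℂ) :=
    { toFun := fun f x => (Fintype.card K : ℂ)⁻¹ * ∑ k : K, χ k⁻¹ * f (φ k * x)
      map_add' := fun f h => by ext x; simp [mul_add, Finset.sum_add_distrib]
      map_smul' := fun c f => by
        ext x
        simp only [Pi.smul_apply, smul_eq_mul, RingHom.id_apply, Finset.mul_sum]
        exact Finset.sum_congr rfl fun k _ => by ring }
  have hχ : ∀ k, χ k⁻¹ * χ k = 1 := fun k => by rw [← map_mul]; simp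
  have hPmem : ∀ f, P f ∈ Representation.coindV φ (ofChar χ) := by
    intro f k x
    change (Fintype.card K : ℂ)⁻¹ * ∑ k' : K, χ k'⁻¹ * f (φ k' * (φ k * x)) =
      χ k * ((Fintype.card K : ℂ)⁻¹ * ∑ k' : K, χ k'⁻¹ * f (φ k' * x))
    rw [mul_left_comm, Finset.mul_sum _ _ (χ k)]
    congr 1
    refine Fintype.sum_equiv (Equiv.mulRight k) _ _ fun k' => ?_
    simp only [Equiv.coe_mulRight, mul_inv_rev, map_mul, mul_assoc]
    rw [← mul_assoc (χ k), mul_comm (χ k), hχ, one_mul]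
  have hPid : ∀ f ∈ Representation.coindV φ (ofChar χ), P f = f := by
    intro f hf
    ext x
    change (Fintype.card K : ℂ)⁻¹ * ∑ k' : K, χ k'⁻¹ * f (φ k' * x) = f x
    have : ∀ k', χ k'⁻¹ * f (φ k' * x) = f x := fun k' => by
      rw [hf k' x]
      change χ k'⁻¹ * (χ k' * f x) = f x
      rw [← mul_assoc, hχ, one_mul]
    simp only [this, Finset.sum_const, Finset.card_univ, nsmul_eq_mul]
    rw [inv_mul_cancel_left₀ hK]
  let i := (Representation.coindV φ (ofChar χ)).subtype
  let p : (G → ℂ) →ₗ[ℂ] Representation.coindV φ (ofChar χ) := P.codRestrict _ hPmem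
  -- With this factorisation, cyclicity of the trace moves the computation to the full space `G →
  -- ℂ`, where the delta functions form a basis.
  have h1 : (induced φ χ g : Representation.coindV φ (ofChar χ) →ₗ[ℂ] _) =
      p ∘ₗ (LinearMap.funLeft ℂ ℂ (· * g) ∘ₗ i) := by
    refine LinearMap.ext fun f => Subtype.ext ?_
    exact (hPid _ (induced φ χ g f).2).symm
  change LinearMap.trace ℂ (Representation.coindV φ (ofChar χ)) (induced φ χ g) = _
  rw [h1, LinearMap.trace_comp_comm', LinearMap.trace_eq_matrix_trace ℂ (Pi.basisFun ℂ G),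
    Matrix.trace, Finset.mul_sum]
  refine Finset.sum_congr rfl fun x _ => ?_
  rw [Matrix.diag_apply, LinearMap.toMatrix_apply]
  change (Fintype.card K : ℂ)⁻¹ * ∑ k : K, χ k⁻¹ * (Pi.basisFun ℂ G x) (φ k * (x * g)) = _
  congr 1
  refine Fintype.sum_equiv (Equiv.inv K) _ _ fun k => ?_
  simp only [Pi.basisFun_apply, Pi.single_apply, Equiv.inv_apply, map_inv]
  have : φ k * (x * g) = x ↔ x * g * x⁻¹ = (φ k)⁻¹ := by
    rw [mul_inv_eq_iff_eq_mul, eq_inv_mul_iff_mul_eq]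
  simp [this]

/-- Frobenius reciprocity for class functions. -/
theorem sum_character_induced_mul (φ : K →* G) (χ : K →* ℂ) (f : G → ℂ)
    (hf : ∀ x g, f (x * g * x⁻¹) = f g) :
    (Fintype.card G : ℂ)⁻¹ * ∑ g, (induced φ χ).character g * f g =
      (Fintype.card K : ℂ)⁻¹ * ∑ k, χ k * f (φ k) := by
  classical
  have hG : (Fintype.card G : ℂ) ≠ 0 := by simp
  simp only [character_induced, mul_assoc, Finset.sum_mul, ← Finset.mul_sum]
  rw [mul_left_comm]
  congr 1
  rw [inv_mul_eq_iff_eq_mul₀ hG, Finset.sum_comm]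
  rw [← nsmul_eq_mul, ← Finset.card_univ, ← Finset.sum_const]
  refine Finset.sum_congr rfl fun x _ => ?_
  rw [Finset.sum_comm]
  refine Finset.sum_congr rfl fun k _ => ?_
  -- For given `x` and `k` only this `g` contributes, and there the class function `f` takes its
  -- value at `φ k`. The result does not depend on `x`, which produces the factor `|G|`.
  rw [Finset.sum_eq_single (x⁻¹ * φ k * x)]
  · rw [if_pos (by group)]
    congr 1
    simpa using hf x⁻¹ (φ k)
  · intro g _ hg
    rw [if_neg, zero_mul]
    intro h
    apply hg
    rw [← h]; group
  · simp

end InducedCharacter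

/-! ### Conjugacy in `GL(2, F)`: triangular forms, trace and determinant. -/

section Conjugacy

variable {F : Type*} [Field F]

/-- The upper triangular matrix with diagonal `(a, d)` and upper right entry `x`. -/
def upper (a d : Fˣ) (x : F) : GL (Fin 2) F :=
  Matrix.GeneralLinearGroup.mkOfDetNeZero !![(a : F), x; 0, (d : F)] (by simp)

theorem coe_upper (a d : Fˣ) (x : F) :
    (upper a d x : Matrix (Fin 2) (Fin 2) F) = !![(a : F), x; 0, (d : F)] := rfl

theorem ext_entries {g h : GL (Fin 2) F} (h00 : g 0 0 = h 0 0) (h01 : g 0 1 = h 0 1)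
    (h10 : g 1 0 = h 1 0) (h11 : g 1 1 = h 1 1) : g = h := by
  ext i j
  fin_cases i <;> fin_cases j <;> assumption

theorem eq_upper {g : GL (Fin 2) F} (hg : g 1 0 = 0) : ∃ a d x, g = upper a d x := by
  have h := borel_diag_ne_zero (⟨g, hg⟩ : borel F)
  exact ⟨Units.mk0 _ h.1, Units.mk0 _ h.2, g 0 1, ext_entries rfl rfl hg rfl⟩

theorem mul_entries (g h : GL (Fin 2) F) (i j : Fin 2) :
    (g * h) i j = g i 0 * h 0 j + g i 1 * h 1 j := by
  rw [Matrix.GeneralLinearGroup.coe_mul, Matrix.mul_apply, Fin.sum_univ_two]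

theorem upper_mul (a d a' d' : Fˣ) (x x' : F) :
    upper a d x * upper a' d' x' = upper (a * a') (d * d') (a * x' + x * d') := by
  refine ext_entries ?_ ?_ ?_ ?_ <;> simp [mul_entries, coe_upper]

theorem scalar_eq_upper (a : Fˣ) :
    Matrix.GeneralLinearGroup.scalar (Fin 2) a = upper a a 0 := by
  refine ext_entries ?_ ?_ ?_ ?_ <;> simp [coe_upper, Matrix.GeneralLinearGroup.scalar]

theorem upper_self_zero_comm (a : Fˣ) (g : GL (Fin 2) F) : upper a a 0 * g = g * upper a a 0 := by
  rw [← scalar_eq_upper, Matrix.GeneralLinearGroup.scalar_commute]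

theorem upper_one_one_zero : upper (1 : Fˣ) 1 0 = 1 := by
  rw [← scalar_eq_upper, map_one]

theorem upper_inv (a d : Fˣ) (x : F) :
    (upper a d x)⁻¹ = upper a⁻¹ d⁻¹ (-(a⁻¹ * x * d⁻¹ : F)) := by
  rw [inv_eq_iff_mul_eq_one, upper_mul, ← upper_one_one_zero]
  congr 1 <;> simp
  field_simp
  simp

theorem isConj_of_mul_eq {g h x : GL (Fin 2) F} (e : x * g = h * x) : IsConj g h :=
  isConj_iff.2 ⟨x, by rw [e, mul_inv_cancel_right]⟩

theorem isConj_upper_of_ne {a d : Fˣ} (h : a ≠ d) (x : F) :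
    IsConj (upper a d x) (upper a d 0) := by
  have h' : (a : F) - d ≠ 0 := sub_ne_zero.2 fun e => h (Units.ext e)
  refine isConj_of_mul_eq (x := upper 1 1 (x / (a - d))) ?_
  rw [upper_mul, upper_mul]
  congr 1 <;> simp
  field_simp
  ring

theorem isConj_upper_self (a : Fˣ) {x y : F} (hx : x ≠ 0) (hy : y ≠ 0) :
    IsConj (upper a a x) (upper a a y) := by
  refine isConj_of_mul_eq (x := upper (Units.mk0 y hy) (Units.mk0 x hx) 0) ?_
  rw [upper_mul, upper_mul]
  congr 1
  · exact mul_comm _ _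
  · exact mul_comm _ _
  · simp [mul_comm]

/-- A matrix with an eigenvalue is conjugate to an upper triangular one. -/
theorem exists_isConj_upper {g : GL (Fin 2) F} {c : F}
    (hc : c ^ 2 - (g 0 0 + g 1 1) * c + (g 0 0 * g 1 1 - g 0 1 * g 1 0) = 0) :
    ∃ a d x, IsConj g (upper a d x) := by
  by_cases h : g 1 0 = 0
  · obtain ⟨a, d, x, rfl⟩ := eq_upper h
    exact ⟨a, d, x, IsConj.refl _⟩
  -- The first column is an eigenvector of `g` for the eigenvalue `c`; the second completes it to a
  -- basis.
  · let y := Matrix.GeneralLinearGroup.mkOfDetNeZero !![c - g 1 1, 1; g 1 0, 0] (by simpa using h)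
    have hy : y⁻¹ * g * y⁻¹⁻¹ = y⁻¹ * (g * y) := by group
    obtain ⟨a, d, x, e⟩ : ∃ a d x, y⁻¹ * (g * y) = upper a d x := by
      apply eq_upper
      rw [mul_entries, mul_entries, mul_entries, Matrix.coe_units_inv, Matrix.inv_def,
        Matrix.adjugate_fin_two]
      simp only [y, Matrix.GeneralLinearGroup.mkOfDetNeZero, Matrix.GeneralLinearGroup.mk',
        Matrix.unitOfDetInvertible]
      simp
      linear_combination (-((g 1 0)⁻¹ * g 1 0)) * hc
    exact ⟨a, d, x, isConj_iff.2 ⟨y⁻¹, by rw [hy, e]⟩⟩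

/-- Matrices with nonzero lower left entry are classified by their trace and determinant. -/
theorem isConj_of_trace_det {g h : GL (Fin 2) F} (hg : g 1 0 ≠ 0) (hh : h 1 0 ≠ 0)
    (ht : g 0 0 + g 1 1 = h 0 0 + h 1 1)
    (hd : g 0 0 * g 1 1 - g 0 1 * g 1 0 = h 0 0 * h 1 1 - h 0 1 * h 1 0) : IsConj g h := by
  -- As `k 1 0 ≠ 0`, the first basis vector `e` is cyclic, and in the basis `(e, k e)` the matrix
  -- becomes the companion matrix of its characteristic polynomial.
  have key : ∀ k : GL (Fin 2) F, k 1 0 ≠ 0 → ∃ x y : GL (Fin 2) F, k * x = x * y ∧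
      (y : Matrix (Fin 2) (Fin 2) F) =
        !![0, -(k 0 0 * k 1 1 - k 0 1 * k 1 0); 1, k 0 0 + k 1 1] := by
    intro k hk
    have hk' : k 0 0 * k 1 1 - k 0 1 * k 1 0 ≠ 0 := by
      have := Matrix.GeneralLinearGroup.det_ne_zero k
      rwa [Matrix.det_fin_two] at this
    refine ⟨.mkOfDetNeZero !![1, k 0 0; 0, k 1 0] (by simpa using hk),
      .mkOfDetNeZero !![0, -(k 0 0 * k 1 1 - k 0 1 * k 1 0); 1, k 0 0 + k 1 1]
        (by simpa using hk'), ?_, rfl⟩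
    refine ext_entries ?_ ?_ ?_ ?_ <;>
      simp [mul_entries, Matrix.GeneralLinearGroup.mkOfDetNeZero] <;> ring
  obtain ⟨x, y, h1, h2⟩ := key g hg
  obtain ⟨x', y', h1', h2'⟩ := key h hh
  have hy : y = y' := Units.ext (by rw [h2, h2', ht, hd])
  refine isConj_of_mul_eq (x := x' * x⁻¹) ?_
  have h3 : x⁻¹ * g = y * x⁻¹ := by
    rw [inv_mul_eq_iff_eq_mul, ← mul_assoc, ← h1, mul_inv_cancel_right]
  rw [mul_assoc, ← mul_assoc h, h1', ← hy, mul_assoc, h3]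

theorem trace_det_of_isConj {g h : GL (Fin 2) F} (hc : IsConj g h) :
    g 0 0 + g 1 1 = h 0 0 + h 1 1 ∧
      g 0 0 * g 1 1 - g 0 1 * g 1 0 = h 0 0 * h 1 1 - h 0 1 * h 1 0 := by
  obtain ⟨x, rfl⟩ := isConj_iff.1 hc
  rw [← Matrix.trace_fin_two, ← Matrix.det_fin_two, ← Matrix.trace_fin_two, ← Matrix.det_fin_two]
  simp only [Units.val_mul]
  rw [Matrix.trace_units_conj, Matrix.det_units_conj]
  exact ⟨rfl, rfl⟩

end Conjugacy

/-! ### The nonsplit torus `Eˣ` inside `GL(2, F)`. -/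

section Torus

variable {F E : Type*} [Field F] [Field E] [Algebra F E] (b : Module.Basis (Fin 2) F E)

theorem coe_torus (z : Eˣ) :
    (torus b z : Matrix (Fin 2) (Fin 2) F) = Algebra.leftMulMatrix b (z : E) := rfl

theorem torus_injective : Function.Injective (torus b) :=
  Units.map_injective (Algebra.leftMulMatrix_injective b)

theorem torus_algebraMap (a : Fˣ) :
    torus b (Units.map (algebraMap F E : F →* E) a) = upper a a 0 := by
  rw [← scalar_eq_upper]
  refine Units.ext ?_
  rw [coe_torus, Matrix.GeneralLinearGroup.coe_scalar]
  change Algebra.leftMulMatrix b (algebraMap F E a) = _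
  rw [AlgHom.commutes]; rfl

/-- Otherwise `b 0` would be an eigenvector of multiplication by `z`, and `z` would equal its
eigenvalue in `F`. -/
theorem torus_lower_ne_zero {z : Eˣ} (hz : (z : E) ∉ (algebraMap F E).range) :
    torus b z 1 0 ≠ 0 := by
  intro h
  apply hz
  have h1 := Algebra.leftMulMatrix_mulVec_repr b (z : E) (b 0)
  have h2 : (z : E) * b 0 = (torus b z 0 0) • b 0 := by
    apply b.repr.injective
    ext i
    rw [← h1, Matrix.mulVec, dotProduct, Fin.sum_univ_two]
    fin_cases i
    · simp [coe_torus]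
    · simp [← coe_torus, h]
  refine ⟨torus b z 0 0, ?_⟩
  rw [Algebra.smul_def] at h2
  exact (mul_right_cancel₀ (b.ne_zero 0) h2).symm

/-- The characteristic equation of a torus element. -/
theorem torus_quadratic (z : Eˣ) :
    (z : E) ^ 2 - algebraMap F E (torus b z 0 0 + torus b z 1 1) * z +
      algebraMap F E (torus b z 0 0 * torus b z 1 1 - torus b z 0 1 * torus b z 1 0) = 0 := by
  apply Algebra.leftMulMatrix_injective b
  simp only [map_add, map_sub, map_mul, map_pow, AlgHom.commutes, ← coe_torus, map_zero]
  ext i j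
  fin_cases i <;> fin_cases j <;>
    simp [pow_two, Matrix.mul_apply, Fin.sum_univ_two, Matrix.algebraMap_matrix_apply] <;> ring

/-- `1` and `z` are linearly independent over `F`. -/
theorem eq_of_quadratic {z : E} (hz : z ∉ (algebraMap F E).range) {t d t' d' : F}
    (h : z ^ 2 - algebraMap F E t * z + algebraMap F E d = 0)
    (h' : z ^ 2 - algebraMap F E t' * z + algebraMap F E d' = 0) : t = t' ∧ d = d' := by
  have h1 : algebraMap F E (t - t') * z = algebraMap F E (d - d') := by
    simp only [map_sub]; linear_combination h' - h
  have ht : t = t' := by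
    by_contra hne
    apply hz
    refine ⟨(d - d') / (t - t'), ?_⟩
    have : algebraMap F E (t - t') ≠ 0 := by simpa [sub_eq_zero] using hne
    rw [map_div₀, ← h1, mul_div_cancel_left₀ _ this]
  refine ⟨ht, ?_⟩
  rw [ht, sub_self, map_zero, zero_mul, eq_comm, map_eq_zero, sub_eq_zero] at h1
  exact h1

theorem isConj_torus_of_quadratic {z w : Eˣ} (hz : (z : E) ∉ (algebraMap F E).range)
    (hw : (w : E) ∉ (algebraMap F E).range)
    (h : (w : E) ^ 2 - algebraMap F E (torus b z 0 0 + torus b z 1 1) * w +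
      algebraMap F E (torus b z 0 0 * torus b z 1 1 - torus b z 0 1 * torus b z 1 0) = 0) :
    IsConj (torus b z) (torus b w) := by
  have := eq_of_quadratic hw h (torus_quadratic b w)
  exact isConj_of_trace_det (torus_lower_ne_zero b hz) (torus_lower_ne_zero b hw) this.1 this.2

/-- The commutant of a nonscalar torus element is the torus. -/
theorem mem_range_torus_of_commute {z : Eˣ} (hz : (z : E) ∉ (algebraMap F E).range)
    {x : GL (Fin 2) F} (hx : x * torus b z = torus b z * x) : x ∈ (torus b).range := by
  have hm := torus_lower_ne_zero b hz
  have e : ∀ i j, (x * torus b z) i j = (torus b z * x) i j := fun i j => by rw [hx]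
  have e00 := e 0 0
  have e10 := e 1 0
  rw [mul_entries, mul_entries] at e00 e10
  -- The commutant of `z` is `F + F z`. The coefficients of `x = α + β z` are read off its first
  -- column, and commutation determines the second.
  let β := x 1 0 / torus b z 1 0
  let α := x 0 0 - β * torus b z 0 0
  have h01 : x 0 1 = β * torus b z 0 1 := by
    simp only [β]; field_simp; linear_combination e00
  have h11 : x 1 1 = α + β * torus b z 1 1 := by
    simp only [α, β]; field_simp; linear_combination e10
  have h10 : x 1 0 = β * torus b z 1 0 := by simp only [β]; field_simp
  have hX : (x : Matrix (Fin 2) (Fin 2) F) =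
      Algebra.leftMulMatrix b (algebraMap F E α + algebraMap F E β * z) := by
    simp only [map_add, map_mul, AlgHom.commutes, ← coe_torus]
    ext i j
    fin_cases i <;> fin_cases j <;>
      simp [Matrix.mul_apply, Matrix.algebraMap_matrix_apply, h01, h10, h11, α]
  have hne : algebraMap F E α + algebraMap F E β * z ≠ 0 := by
    intro h0
    rw [h0, map_zero] at hX
    exact x.ne_zero hX
  exact ⟨Units.mk0 _ hne, Units.ext hX.symm⟩

/-- An upper triangular matrix conjugate to a torus element is scalar. -/
theorem algebraMap_of_isConj_upper {z : Eˣ} {a d : Fˣ} {x : F}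
    (h : IsConj (torus b z) (upper a d x)) : (z : E) ∈ (algebraMap F E).range := by
  obtain ⟨h1, h2⟩ := trace_det_of_isConj h
  have hq := torus_quadratic b z
  rw [h1, h2] at hq
  simp only [coe_upper] at hq
  simp at hq
  -- Conjugate matrices share their characteristic polynomial, which splits over `F` for a
  -- triangular matrix and has the root `z`.
  have : ((z : E) - algebraMap F E a) * (z - algebraMap F E d) = 0 := by linear_combination hq
  rcases mul_eq_zero.1 this with h | h
  · exact ⟨a, (sub_eq_zero.1 h).symm⟩
  · exact ⟨d, (sub_eq_zero.1 h).symm⟩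

/-- By `algebraMap_of_isConj_upper`, `z` comes from `F`; then `torus b z` is central and is its own
only conjugate. -/
theorem eq_scalar_of_isConj_torus {z : Eˣ} {a d : Fˣ} {x : F}
    (h : IsConj (torus b z) (upper a d x)) : a = d ∧ x = 0 := by
  obtain ⟨c, hc⟩ := algebraMap_of_isConj_upper b h
  have hc0 : c ≠ 0 := by
    rintro rfl
    rw [map_zero] at hc
    exact z.ne_zero hc.symm
  have hz : z = Units.map (algebraMap F E : F →* E) (Units.mk0 c hc0) := Units.ext hc.symm
  rw [hz, torus_algebraMap] at h
  obtain ⟨y, hy⟩ := isConj_iff.1 h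
  rw [← upper_self_zero_comm, mul_inv_cancel_right] at hy
  have e : ∀ i j, upper (Units.mk0 c hc0) (Units.mk0 c hc0) 0 i j = upper a d x i j :=
    fun i j => by rw [hy]
  have e00 := e 0 0
  have e01 := e 0 1
  have e11 := e 1 1
  simp [coe_upper] at e00 e01 e11
  exact ⟨Units.ext (e00.symm.trans e11), e01.symm⟩

end Torus

/-! ### Values of induced characters, by the number of contributing cosets. -/

section InducedValues

variable {G : Type*} [Group G] [Fintype G] {K : Type*} [Group K] [Fintype K]
  {φ : K →* G} (hφ : Function.Injective φ) (χ : K →* ℂ)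

include hφ

theorem character_induced_extend (g : G) :
    (induced φ χ).character g =
      (Fintype.card K : ℂ)⁻¹ * ∑ x : G, Function.extend φ χ 0 (x * g * x⁻¹) := by
  classical
  rw [character_induced]
  congr 1
  refine Finset.sum_congr rfl fun x _ => ?_
  by_cases h : ∃ k, φ k = x * g * x⁻¹
  · obtain ⟨k, hk⟩ := h
    rw [← hk, hφ.extend_apply]
    simp [hφ.eq_iff]
  · rw [Function.extend_apply' _ _ _ h]
    exact Finset.sum_eq_zero fun k _ => if_neg fun e => h ⟨k, e.symm⟩

theorem character_induced_central {g : G} (hg : ∀ x, x * g = g * x) {k : K} (hk : φ k = g) :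
    (induced φ χ).character g = (Fintype.card K : ℂ)⁻¹ * Fintype.card G * χ k := by
  have h : ∀ x, Function.extend φ χ 0 (x * g * x⁻¹) = χ k := fun x => by
    rw [hg, mul_inv_cancel_right, ← hk, hφ.extend_apply]
  rw [character_induced_extend hφ]
  simp only [h]
  simp [mul_assoc]

theorem character_induced_eq_zero {g : G} (hg : ∀ k, ¬ IsConj (φ k) g) :
    (induced φ χ).character g = 0 := by
  rw [character_induced_extend hφ, Finset.sum_eq_zero, mul_zero]
  intro x _
  rw [Function.extend_apply']
  · rfl
  · rintro ⟨k, hk⟩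
    exact hg k (IsConj.symm (isConj_iff.2 ⟨x, hk.symm⟩))

theorem sum_eq_sum_range_of_forall (f : G → ℂ) (h : ∀ x, x ∉ φ.range → f x = 0) :
    ∑ x, f x = ∑ k, f (φ k) := by
  classical
  rw [← Finset.sum_image (s := Finset.univ) (g := φ) (fun _ _ _ _ e => hφ e)]
  refine (Finset.sum_subset (Finset.subset_univ _) fun x _ hx => h x ?_).symm
  rintro ⟨k, rfl⟩
  exact hx (Finset.mem_image_of_mem _ (Finset.mem_univ _))

omit [Fintype G] [Fintype K] in
theorem extend_conj (k k' : K) :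
    Function.extend φ χ 0 (φ k * φ k' * (φ k)⁻¹) = χ k' := by
  rw [← map_inv, ← map_mul, ← map_mul, hφ.extend_apply, map_mul, map_mul, mul_right_comm,
    ← map_mul χ k, mul_inv_cancel, map_one, one_mul]

/-- The value of an induced character at an element with only one conjugate over the subgroup. -/
theorem character_induced_one_coset {g : G} {k : K} (hk : φ k = g)
    (h : ∀ x, x * g * x⁻¹ ∈ φ.range → x ∈ φ.range) :
    (induced φ χ).character g = χ k := by
  rw [character_induced_extend hφ, sum_eq_sum_range_of_forall hφ]
  · simp [← hk, extend_conj hφ]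
  · intro x hx
    rw [Function.extend_apply']
    · rfl
    · exact fun hx' => hx (h x hx')

/-- The value of an induced character at an element with two conjugates over the subgroup. -/
theorem character_induced_two_cosets {g w : G} {k k' : K} (hk : φ k = g)
    (hk' : φ k' = w * g * w⁻¹) (hw : w ∉ φ.range)
    (h : ∀ x, x * g * x⁻¹ ∈ φ.range → x ∈ φ.range ∨ x * w⁻¹ ∈ φ.range) :
    (induced φ χ).character g = χ k + χ k' := by
  classical
  rw [character_induced_extend hφ]
  -- `f` collects the contribution of the coset `K`, and `f'` that of `K w`, translated back to `K`.
  -- The two cosets are disjoint because `w` is not in `K`.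
  let f : G → ℂ := fun x => if x ∈ φ.range then Function.extend φ χ 0 (x * g * x⁻¹) else 0
  let f' : G → ℂ := fun x => if x ∈ φ.range then
    Function.extend φ χ 0 ((x * w) * g * (x * w)⁻¹) else 0
  have h1 : ∑ x, Function.extend φ χ 0 (x * g * x⁻¹) = ∑ x, f x + ∑ x, f' x := by
    rw [← Fintype.sum_equiv (Equiv.mulRight w⁻¹) (fun x => f' (x * w⁻¹)) f' fun x => rfl,
      ← Finset.sum_add_distrib]
    refine Finset.sum_congr rfl fun x _ => ?_
    simp only [f, f', inv_mul_cancel_right]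
    by_cases hx : x ∈ φ.range
    · have hx' : x * w⁻¹ ∉ φ.range := fun hx' => hw (by
        have := mul_mem (inv_mem hx') hx
        simpa using this)
      rw [if_pos hx, if_neg hx', add_zero]
    · rw [if_neg hx, zero_add]
      split_ifs with hx'
      · rfl
      · rw [Function.extend_apply']
        · rfl
        · exact fun h0 => (h x h0).elim hx hx'
  rw [h1, sum_eq_sum_range_of_forall hφ f fun x hx => if_neg hx,
    sum_eq_sum_range_of_forall hφ f' fun x hx => if_neg hx]
  have h2 : ∀ i, f (φ i) = χ k := fun i => by
    simp only [f]
    rw [if_pos ⟨i, rfl⟩, ← hk, extend_conj hφ]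
  have h3 : ∀ i, f' (φ i) = χ k' := fun i => by
    simp only [f']
    rw [if_pos ⟨i, rfl⟩, mul_inv_rev, ← extend_conj hφ χ i k', hk']
    congr 1
    group
  simp [h2, h3]
  rw [← mul_add, inv_mul_cancel_left₀ (by simp)]

end InducedValues

/-! ### The four types of conjugacy classes over a finite field. -/

section Classification

variable {F E : Type*} [Field F] [Fintype F] [Field E] [Fintype E] [Algebra F E]
  (b : Module.Basis (Fin 2) F E)

include b in
theorem card_extension : Fintype.card E = Fintype.card F ^ 2 := by
  rw [Module.card_fintype b, Fintype.card_fin]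

-- The polynomial `X ^ q - X` has at most `q` roots in `E`, and the `q` elements of `F` are roots.
omit [Fintype E] in
theorem mem_range_of_pow_card {z : E} (hz : z ^ Fintype.card F = z) :
    z ∈ (algebraMap F E).range := by
  classical
  let p : Polynomial E := Polynomial.X ^ Fintype.card F - Polynomial.X
  have hp : p ≠ 0 := FiniteField.X_pow_card_sub_X_ne_zero E Fintype.one_lt_card
  have hs : Finset.univ.image (algebraMap F E) ⊆ p.roots.toFinset := by
    intro y hy
    obtain ⟨a, -, rfl⟩ := Finset.mem_image.1 hy
    rw [Multiset.mem_toFinset, Polynomial.mem_roots hp]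
    simp [p, ← map_pow, FiniteField.pow_card]
  have hc : p.roots.toFinset.card ≤ (Finset.univ.image (algebraMap F E)).card := by
    rw [Finset.card_image_of_injective _ (algebraMap F E).injective, Finset.card_univ]
    refine (Multiset.toFinset_card_le _).trans ((Polynomial.card_roots' _).trans ?_)
    rw [FiniteField.X_pow_card_sub_X_natDegree_eq E Fintype.one_lt_card]
  have hz' : z ∈ p.roots.toFinset := by
    rw [Multiset.mem_toFinset, Polynomial.mem_roots hp]
    simp [p, hz]
  rw [← Finset.eq_of_subset_of_card_le hs hc] at hz'
  obtain ⟨a, -, ha⟩ := Finset.mem_image.1 hz'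
  exact ⟨a, ha⟩

-- Since `z ^ (q ^ 2) = z`, if `z ^ q` is some `c` in `F`, then `z = c ^ q = c`.
include b in
theorem pow_card_notMem_range {z : E} (hz : z ∉ (algebraMap F E).range) :
    z ^ Fintype.card F ∉ (algebraMap F E).range := by
  rintro ⟨c, hc⟩
  apply hz
  refine ⟨c, ?_⟩
  have h := FiniteField.pow_card z
  rw [card_extension b, pow_two, pow_mul, ← hc, ← map_pow, FiniteField.pow_card] at h
  exact h

include b in
/-- A quadratic polynomial over a finite field has a root in the quadratic extension. -/
theorem exists_root_quadratic (t d : F) :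
    ∃ z : E, z ^ 2 - algebraMap F E t * z + algebraMap F E d = 0 := by
  by_cases h : ∃ c : F, c ^ 2 - t * c + d = 0
  · obtain ⟨c, hc⟩ := h
    refine ⟨algebraMap F E c, ?_⟩
    rw [← map_pow, ← map_mul, ← map_sub, ← map_add, hc, map_zero]
  · push Not at h
    -- Without a root in `F` the quadratic is irreducible, and adjoining a root gives an extension
    -- of the same degree as `E`, hence one that embeds in `E`.
    let p : Polynomial F := Polynomial.X ^ 2 + (Polynomial.C (-t) * Polynomial.X + Polynomial.C d)
    have hdeg : p.natDegree = 2 := by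
      simp only [p, ← add_assoc]
      compute_degree!
    have hp : Irreducible p := by
      refine Polynomial.irreducible_of_degree_le_three_of_not_isRoot
        (Finset.mem_Icc.2 ⟨by omega, by omega⟩) fun x hx => h x ?_
      rw [Polynomial.IsRoot.def] at hx
      simp [p] at hx
      linear_combination hx
    have := Fact.mk hp
    have hfin : Module.finrank F (AdjoinRoot p) = Module.finrank F E := by
      rw [Module.finrank_eq_card_basis b, (AdjoinRoot.powerBasis hp.ne_zero).finrank,
        AdjoinRoot.powerBasis_dim, hdeg, Fintype.card_fin]
    obtain ⟨f⟩ := FiniteField.nonempty_algHom_of_finrank_dvd (F := F) (K := AdjoinRoot p)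
      (L := E) (by rw [hfin])
    refine ⟨f (AdjoinRoot.root p), ?_⟩
    have h0 : Polynomial.aeval (f (AdjoinRoot.root p)) p = 0 := by
      rw [Polynomial.aeval_algHom_apply, AdjoinRoot.aeval_eq, AdjoinRoot.mk_self, map_zero]
    simp [p] at h0
    linear_combination h0

/-- The conjugacy classes of `GL(2, F)`. -/
theorem isConj_classification (g : GL (Fin 2) F) :
    (∃ a, IsConj g (upper a a 0)) ∨ (∃ a, IsConj g (upper a a 1)) ∨
      (∃ a d, a ≠ d ∧ IsConj g (upper a d 0)) ∨
      ∃ z : Eˣ, (z : E) ∉ (algebraMap F E).range ∧ IsConj g (torus b z) := by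
  by_cases h : ∃ c, c ^ 2 - (g 0 0 + g 1 1) * c + (g 0 0 * g 1 1 - g 0 1 * g 1 0) = 0
  · obtain ⟨c, hc⟩ := h
    obtain ⟨a, d, x, e⟩ := exists_isConj_upper hc
    by_cases had : a = d
    · subst had
      by_cases hx : x = 0
      · subst hx
        exact Or.inl ⟨a, e⟩
      · exact Or.inr (Or.inl ⟨a, e.trans (isConj_upper_self a hx one_ne_zero)⟩)
    · exact Or.inr (Or.inr (Or.inl ⟨a, d, had, e.trans (isConj_upper_of_ne had x)⟩))
  · refine Or.inr (Or.inr (Or.inr ?_))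
    obtain ⟨z, hz⟩ := exists_root_quadratic b (g 0 0 + g 1 1) (g 0 0 * g 1 1 - g 0 1 * g 1 0)
    have hzr : z ∉ (algebraMap F E).range := by
      rintro ⟨c, rfl⟩
      apply h
      refine ⟨c, (algebraMap F E).injective ?_⟩
      rw [map_zero, ← hz]
      simp
    have hz0 : z ≠ 0 := by
      rintro rfl
      exact hzr ⟨0, map_zero _⟩
    have hg : g 1 0 ≠ 0 := by
      intro h0
      apply h
      refine ⟨g 0 0, ?_⟩
      rw [h0]; ring
    refine ⟨Units.mk0 z hz0, hzr, ?_⟩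
    have := eq_of_quadratic hzr hz (torus_quadratic b (Units.mk0 z hz0))
    exact isConj_of_trace_det hg (torus_lower_ne_zero b hzr) this.1 this.2

/-- Frobenius fixes the coefficients of the characteristic equation of `z`, so `z ^ q` satisfies it
too, and off `F` that equation determines the class. -/
theorem isConj_torus_conj {z : Eˣ} (hz : (z : E) ∉ (algebraMap F E).range) :
    IsConj (torus b z) (torus b (z ^ Nat.card F)) := by
  refine isConj_torus_of_quadratic b hz ?_ ?_
  · rw [Nat.card_eq_fintype_card, Units.val_pow_eq_pow_val]
    exact pow_card_notMem_range b hz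
  · have h := congrArg (FiniteField.frobeniusAlgHom F E) (torus_quadratic b z)
    rw [map_zero, map_add, map_sub, map_mul, map_pow, AlgHom.commutes, AlgHom.commutes] at h
    rw [Nat.card_eq_fintype_card, Units.val_pow_eq_pow_val]
    exact h

/-- `w` is a root of the characteristic polynomial of `z`, whose roots are the distinct elements `z`
and `z ^ q`. -/
theorem eq_or_eq_of_isConj_torus {z w : Eˣ} (hz : (z : E) ∉ (algebraMap F E).range)
    (h : IsConj (torus b z) (torus b w)) : w = z ∨ w = z ^ Nat.card F := by
  have hq := torus_quadratic b z
  have hw := torus_quadratic b w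
  have hc := isConj_torus_conj b hz
  have hz' := torus_quadratic b (z ^ Nat.card F)
  have hne : ((z ^ Nat.card F : Eˣ) : E) - z ≠ 0 := by
    rw [Nat.card_eq_fintype_card, Units.val_pow_eq_pow_val]
    exact fun e => hz (mem_range_of_pow_card (sub_eq_zero.1 e))
  rw [← (trace_det_of_isConj h).1, ← (trace_det_of_isConj h).2] at hw
  rw [← (trace_det_of_isConj hc).1, ← (trace_det_of_isConj hc).2] at hz'
  have ht : ((z ^ Nat.card F : Eˣ) : E) + z -
      algebraMap F E (torus b z 0 0 + torus b z 1 1) = 0 := by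
    refine (mul_eq_zero.1 ?_).resolve_left hne
    linear_combination hz' - hq
  have : ((w : E) - z) * ((w : E) - ((z ^ Nat.card F : Eˣ) : E)) = 0 := by
    linear_combination hw - hq - ((w : E) - z) * ht
  rcases mul_eq_zero.1 this with h | h
  · exact Or.inl (Units.ext (sub_eq_zero.1 h))
  · exact Or.inr (Units.ext (sub_eq_zero.1 h))

end Classification

/-! ### Characters of finite abelian groups. -/

section Delta

variable {A : Type*} [CommGroup A]

theorem delta_one : delta (1 : A →* ℂˣ) = 1 := if_pos rfl

theorem delta_of_ne {χ : A →* ℂˣ} (h : χ ≠ 1) : delta χ = 0 := if_neg h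

/-- These laws are stated for characters only, so that products inside `delta` can be normalised
without rearranging the complex products around them. -/
theorem char_mul_comm (χ χ' : A →* ℂˣ) : χ * χ' = χ' * χ := mul_comm χ χ'

theorem char_mul_assoc (χ χ' χ'' : A →* ℂˣ) : χ * χ' * χ'' = χ * (χ' * χ'') :=
  mul_assoc χ χ' χ''

theorem char_mul_left_comm (χ χ' χ'' : A →* ℂˣ) : χ * (χ' * χ'') = χ' * (χ * χ'') :=
  mul_left_comm χ χ' χ''

theorem char_sq (χ : A →* ℂˣ) : χ ^ 2 = χ * χ := pow_two χ

theorem char_mul_inv_cancel (χ : A →* ℂˣ) : χ * χ⁻¹ = 1 := mul_inv_cancel χ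

theorem char_inv_mul_cancel (χ : A →* ℂˣ) : χ⁻¹ * χ = 1 := inv_mul_cancel χ

theorem char_mul_inv_eq_one {χ χ' : A →* ℂˣ} : χ * χ'⁻¹ = 1 ↔ χ = χ' :=
  mul_inv_eq_one (G := A →* ℂˣ) (a := χ) (b := χ')

theorem char_mul_inv (χ χ' : A →* ℂˣ) : (χ * χ')⁻¹ = χ⁻¹ * χ'⁻¹ := mul_inv χ χ'

theorem char_mul_one (χ : A →* ℂˣ) : χ * 1 = χ := mul_one χ

theorem sum_char [Fintype A] (χ : A →* ℂˣ) :
    ∑ a, (χ a : ℂ) = Fintype.card A * delta χ := by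
  classical
  by_cases h : χ = 1
  · subst h; simp [delta_one]
  · rw [delta_of_ne h, mul_zero]
    refine sum_hom_units_eq_zero ((Units.coeHom ℂ).comp χ) fun h' => h ?_
    ext a
    exact DFunLike.congr_fun h' a

/-- A function on a finite abelian group is determined by its Fourier coefficients. -/
theorem eq_zero_of_fourier [Fintype A] (f : A → ℂ)
    (h : ∀ χ : A →* ℂˣ, ∑ a, (χ a : ℂ) * f a = 0) (a₀ : A) : f a₀ = 0 := by
  classical
  have : Fintype (A →* ℂˣ) := Fintype.ofFinite _
  have key : ∀ a : A, a ≠ 1 → ∑ χ : A →* ℂˣ, (χ a : ℂ) = 0 := by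
    intro a ha
    obtain ⟨χ₀, h₀⟩ := CommGroup.exists_apply_ne_one_of_hasEnoughRootsOfUnity A ℂ ha
    have h1 : (χ₀ a : ℂ) * ∑ χ : A →* ℂˣ, (χ a : ℂ) = ∑ χ : A →* ℂˣ, (χ a : ℂ) := by
      rw [Finset.mul_sum]
      exact Fintype.sum_equiv (Equiv.mulLeft χ₀) _ _ fun χ => by simp
    have h2 : ((χ₀ a : ℂ) - 1) * ∑ χ : A →* ℂˣ, (χ a : ℂ) = 0 := by
      rw [sub_mul, h1, one_mul, sub_self]
    refine (mul_eq_zero.1 h2).resolve_left fun h3 => h₀ (Units.ext ?_)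
    exact sub_eq_zero.1 h3
  -- Fourier inversion: exchanging the sums, the dual orthogonality relation `key` leaves only the
  -- term of `a₀`.
  have h1 : ∑ χ : A →* ℂˣ, (χ a₀⁻¹ : ℂ) * ∑ a, (χ a : ℂ) * f a = 0 := by simp [h]
  have h2 : ∑ χ : A →* ℂˣ, (χ a₀⁻¹ : ℂ) * ∑ a, (χ a : ℂ) * f a =
      ∑ a, (∑ χ : A →* ℂˣ, (χ (a₀⁻¹ * a) : ℂ)) * f a := by
    simp only [Finset.mul_sum, Finset.sum_mul]
    rw [Finset.sum_comm]
    refine Finset.sum_congr rfl fun a _ => Finset.sum_congr rfl fun χ _ => ?_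
    rw [map_mul, Units.val_mul, mul_assoc]
  rw [h2, Finset.sum_eq_single a₀] at h1
  · simpa using h1
  · intro a _ ha
    rw [key _ (fun e => ha (inv_mul_eq_one.1 e).symm), zero_mul]
  · simp

end Delta

/-! ### Class functions given by their values on the four types of classes. -/

section Table

variable {F E : Type*} [Field F] [Field E] [Algebra F E]

/-- The embedding of `Fˣ` in `Eˣ`. -/
abbrev unitsIncl (F E : Type*) [Field F] [Field E] [Algebra F E] : Fˣ →* Eˣ :=
  Units.map (algebraMap F E : F →* E)

/-- The values of a class function on the conjugacy classes of `GL(2, F)`: central elements,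
nonsemisimple elements, split elements and elliptic elements. The functions `D` and `T` giving the
values at split and elliptic elements are extended to the maximal tori, and all four are
proportional to the same character of the centre. -/
structure HasTable (b : Module.Basis (Fin 2) F E) (f : GL (Fin 2) F → ℂ) (ω : Fˣ →* ℂˣ)
    (z u d t : ℂ) (D : Fˣ → Fˣ → ℂ) (T : Eˣ → ℂ) : Prop where
  conj (x g) : f (x * g * x⁻¹) = f g
  scalar (a) : f (upper a a 0) = z * ω a
  unip (a) (x) : x ≠ 0 → f (upper a a x) = u * ω a
  split (a d) : a ≠ d → f (upper a d 0) = D a d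
  elliptic (w : Eˣ) : (w : E) ∉ (algebraMap F E).range → f (torus b w) = T w
  -- `d` and `t` belong to the extensions `D` and `T` at scalars, where `f` itself has the
  -- coefficient `z`; the integration formula corrects for the difference.
  split_self (a) : D a a = d * ω a
  elliptic_incl (a) : T (unitsIncl F E a) = t * ω a

namespace HasTable

variable {b : Module.Basis (Fin 2) F E} {f f' : GL (Fin 2) F → ℂ} {ω ω' : Fˣ →* ℂˣ}
  {z u d t z' u' d' t' : ℂ} {D D' : Fˣ → Fˣ → ℂ} {T T' : Eˣ → ℂ}

theorem apply_eq_of_isConj (h : HasTable b f ω z u d t D T) {g g' : GL (Fin 2) F}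
    (hc : IsConj g g') : f g = f g' := by
  obtain ⟨x, rfl⟩ := isConj_iff.1 hc
  exact (h.conj x g).symm

theorem congr (h : HasTable b f ω z u d t D T) (hω : ω = ω') (hz : z = z') (hu : u = u')
    (hd : d = d') (ht : t = t') (hD : D = D') (hT : T = T') :
    HasTable b f ω' z' u' d' t' D' T' := by
  subst hω hz hu hd ht hD hT
  exact h

theorem mul (h : HasTable b f ω z u d t D T) (h' : HasTable b f' ω' z' u' d' t' D' T') :
    HasTable b (f * f') (ω * ω') (z * z') (u * u') (d * d') (t * t') (D * D') (T * T') where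
  conj x g := by simp only [Pi.mul_apply, h.conj, h'.conj]
  scalar a := by
    simp only [Pi.mul_apply, h.scalar, h'.scalar, MonoidHom.mul_apply, Units.val_mul]; ring
  unip a x hx := by
    simp only [Pi.mul_apply, h.unip a x hx, h'.unip a x hx, MonoidHom.mul_apply, Units.val_mul]
    ring
  split a e hae := by simp only [Pi.mul_apply, h.split a e hae, h'.split a e hae]
  elliptic w hw := by simp only [Pi.mul_apply, h.elliptic w hw, h'.elliptic w hw]
  split_self a := by
    simp only [Pi.mul_apply, h.split_self, h'.split_self, MonoidHom.mul_apply, Units.val_mul]; ring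
  elliptic_incl a := by
    simp only [Pi.mul_apply, h.elliptic_incl, h'.elliptic_incl, MonoidHom.mul_apply,
      Units.val_mul]
    ring

theorem sub (h : HasTable b f ω z u d t D T) (h' : HasTable b f' ω z' u' d' t' D' T') :
    HasTable b (f - f') ω (z - z') (u - u') (d - d') (t - t') (D - D') (T - T') where
  conj x g := by simp only [Pi.sub_apply, h.conj, h'.conj]
  scalar a := by simp only [Pi.sub_apply, h.scalar, h'.scalar]; ring
  unip a x hx := by simp only [Pi.sub_apply, h.unip a x hx, h'.unip a x hx]; ring
  split a e hae := by simp only [Pi.sub_apply, h.split a e hae, h'.split a e hae]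
  elliptic w hw := by simp only [Pi.sub_apply, h.elliptic w hw, h'.elliptic w hw]
  split_self a := by simp only [Pi.sub_apply, h.split_self, h'.split_self]; ring
  elliptic_incl a := by simp only [Pi.sub_apply, h.elliptic_incl, h'.elliptic_incl]; ring

theorem inv (h : HasTable b f ω z u d t D T) :
    HasTable b (fun g => f g⁻¹) ω⁻¹ z u d t (fun a e => D a⁻¹ e⁻¹) (fun w => T w⁻¹) where
  conj x g := by
    rw [← h.conj x g⁻¹]
    congr 1
    group
  scalar a := by
    have := h.scalar a⁻¹
    rw [upper_inv]
    simpa using this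
  unip a x hx := by
    have := h.unip a⁻¹ (-(a⁻¹ * x * a⁻¹ : F)) (by simp [hx])
    rw [upper_inv]
    simpa using this
  split a e hae := by
    have := h.split a⁻¹ e⁻¹ (by simpa using hae)
    rw [upper_inv]
    simpa using this
  elliptic w hw := by
    rw [← map_inv]
    refine h.elliptic w⁻¹ fun ⟨c, hc⟩ => hw ⟨c⁻¹, ?_⟩
    rw [map_inv₀, hc, Units.val_inv_eq_inv_val, inv_inv]
  split_self a := by rw [h.split_self]; simp
  elliptic_incl a := by rw [← map_inv, h.elliptic_incl]; simp

theorem unique [Fintype F] [Fintype E] (h : HasTable b f ω z u d t D T)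
    (h' : HasTable b f' ω z u d' t' D T) : f = f' := by
  ext g
  rcases isConj_classification b g with ⟨a, e⟩ | ⟨a, e⟩ | ⟨a, c, hac, e⟩ | ⟨w, hw, e⟩
  · rw [h.apply_eq_of_isConj e, h'.apply_eq_of_isConj e, h.scalar, h'.scalar]
  · rw [h.apply_eq_of_isConj e, h'.apply_eq_of_isConj e, h.unip _ _ one_ne_zero,
      h'.unip _ _ one_ne_zero]
  · rw [h.apply_eq_of_isConj e, h'.apply_eq_of_isConj e, h.split _ _ hac, h'.split _ _ hac]
  · rw [h.apply_eq_of_isConj e, h'.apply_eq_of_isConj e, h.elliptic _ hw, h'.elliptic _ hw]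

end HasTable

end Table

/-! ### Frobenius reciprocity for the Borel subgroup, `Eˣ` and `ZN`. -/

section Frobenius

variable {F : Type*} [Field F]

theorem det_upper (a d : Fˣ) (x : F) :
    Matrix.GeneralLinearGroup.det (upper a d x) = a * d := by
  ext
  rw [Matrix.GeneralLinearGroup.val_det_apply, coe_upper, Matrix.det_fin_two]
  simp

theorem upper_mem_borel (a d : Fˣ) (x : F) : upper a d x ∈ borel F := rfl

theorem borelFst_upper (a d : Fˣ) (x : F) :
    borelFst ⟨upper a d x, upper_mem_borel a d x⟩ = a := Units.ext rfl

theorem borelSnd_upper (a d : Fˣ) (x : F) :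
    borelSnd ⟨upper a d x, upper_mem_borel a d x⟩ = d := Units.ext rfl

theorem borelChar_upper (μ₁ μ₂ : Fˣ →* ℂˣ) (a d : Fˣ) (x : F) :
    borelChar μ₁ μ₂ ⟨upper a d x, upper_mem_borel a d x⟩ = μ₁ a * μ₂ d := by
  rw [borelChar, MonoidHom.comp_apply, MonoidHom.mul_apply, MonoidHom.comp_apply,
    MonoidHom.comp_apply, borelFst_upper, borelSnd_upper]
  simp

/-- The entries of an upper triangular matrix. -/
def borelEquiv : Fˣ × Fˣ × F ≃ borel F where
  toFun p := ⟨upper p.1 p.2.1 p.2.2, upper_mem_borel _ _ _⟩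
  invFun g := (borelFst g, borelSnd g, (g : GL (Fin 2) F) 0 1)
  left_inv p := by
    refine Prod.ext (borelFst_upper _ _ _) (Prod.ext (borelSnd_upper _ _ _) rfl)
  right_inv g := Subtype.ext (ext_entries rfl rfl g.2.symm rfl)

theorem centerUnipotent_apply (a : Fˣ) (x : F) :
    centerUnipotent F (a, Multiplicative.ofAdd x) = upper a a (a * x) := by
  change Matrix.GeneralLinearGroup.scalar (Fin 2) a *
    Matrix.GeneralLinearGroup.upperRightHom x = _
  rw [scalar_eq_upper]
  refine ext_entries ?_ ?_ ?_ ?_ <;> simp [mul_entries, coe_upper]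

theorem centerUnipotent_injective : Function.Injective (centerUnipotent F) := by
  rintro ⟨a, x⟩ ⟨a', x'⟩ h
  obtain ⟨x, rfl⟩ := Multiplicative.ofAdd.surjective x
  obtain ⟨x', rfl⟩ := Multiplicative.ofAdd.surjective x'
  rw [centerUnipotent_apply, centerUnipotent_apply] at h
  have h00 := congrArg (fun g : GL (Fin 2) F => g 0 0) h
  have h01 := congrArg (fun g : GL (Fin 2) F => g 0 1) h
  simp [coe_upper] at h00 h01
  obtain rfl := Units.ext h00
  simpa using h01

theorem mem_range_centerUnipotent {g : GL (Fin 2) F} :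
    g ∈ (centerUnipotent F).range ↔ ∃ a x, g = upper a a x := by
  constructor
  · rintro ⟨⟨a, x⟩, rfl⟩
    exact ⟨a, _, centerUnipotent_apply a x.toAdd⟩
  · rintro ⟨a, x, rfl⟩
    refine ⟨(a, .ofAdd (a⁻¹ * x)), ?_⟩
    rw [centerUnipotent_apply]
    simp

variable {E : Type*} [Field E] [Algebra F E]

theorem centerUnipotentChar_apply (ψ : AddChar F ℂ) (ν : Eˣ →* ℂˣ) (a : Fˣ) (x : F) :
    centerUnipotentChar ψ ν (a, Multiplicative.ofAdd x) = res F ν a * ψ x := by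
  simp [centerUnipotentChar]

/-- The average of a function over `GL(2, F)`. -/
def avg {G : Type*} [Group G] [Fintype G] (f : G → ℂ) : ℂ := (Fintype.card G : ℂ)⁻¹ * ∑ g, f g

variable [Fintype F] [DecidableEq F]

theorem card_units_cast : (Fintype.card Fˣ : ℂ) = Fintype.card F - 1 := by
  rw [Fintype.card_units, Nat.cast_sub Fintype.card_pos, Nat.cast_one]

/-- The Borel subgroup has order `q (q - 1) ^ 2`. The sums are nested so that Fourier inversion can
be applied to each diagonal variable in turn. -/
theorem avg_principal_mul (μ₁ μ₂ : Fˣ →* ℂˣ) {f : GL (Fin 2) F → ℂ}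
    (hf : ∀ x g, f (x * g * x⁻¹) = f g) :
    avg ((principal μ₁ μ₂).character * f) =
      ((Fintype.card F : ℂ) * (Fintype.card F - 1) ^ 2)⁻¹ *
        ∑ a, (μ₁ a : ℂ) * ∑ d, (μ₂ d : ℂ) * ∑ x, f (upper a d x) := by
  let _ : Fintype (borel F) := Fintype.ofEquiv _ borelEquiv
  have h := sum_character_induced_mul (borel F).subtype (borelChar μ₁ μ₂) f hf
  rw [avg]
  refine h.trans ?_
  rw [Fintype.ofEquiv_card, Fintype.card_prod, Fintype.card_prod,
    ← Fintype.sum_equiv borelEquiv (fun p => (μ₁ p.1 : ℂ) * μ₂ p.2.1 * f (upper p.1 p.2.1 p.2.2)) _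
      fun p => by
        rw [borelEquiv, Equiv.coe_fn_mk, borelChar_upper]; rfl]
  congr 1
  · push_cast
    rw [card_units_cast]
    ring
  · simp only [Fintype.sum_prod_type, Finset.mul_sum, mul_assoc]

theorem avg_torusInd_mul [Fintype E] [DecidableEq E] (b : Module.Basis (Fin 2) F E)
    (ν : Eˣ →* ℂˣ) {f : GL (Fin 2) F → ℂ} (hf : ∀ x g, f (x * g * x⁻¹) = f g) :
    avg ((torusInd b ν).character * f) =
      ((Fintype.card F : ℂ) ^ 2 - 1)⁻¹ * ∑ w, (ν w : ℂ) * f (torus b w) := by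
  refine (sum_character_induced_mul (torus b) _ f hf).trans ?_
  rw [card_units_cast, card_extension b]
  push_cast
  rfl

theorem avg_centerUnipotentInd_mul (ψ : AddChar F ℂ) (ν : Eˣ →* ℂˣ) {f : GL (Fin 2) F → ℂ}
    (hf : ∀ x g, f (x * g * x⁻¹) = f g) :
    avg ((centerUnipotentInd ψ ν).character * f) =
      ((Fintype.card F : ℂ) * (Fintype.card F - 1))⁻¹ *
        ∑ a, (res F ν a : ℂ) * ∑ x, ψ x * f (upper a a (a * x)) := by
  refine (sum_character_induced_mul (centerUnipotent F) _ f hf).trans ?_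
  rw [Fintype.card_prod, Fintype.card_multiplicative]
  congr 1
  · push_cast
    rw [card_units_cast]
    ring
  · rw [Fintype.sum_prod_type]
    refine Finset.sum_congr rfl fun a _ => ?_
    rw [Finset.mul_sum]
    refine Fintype.sum_equiv Multiplicative.toAdd _ _ fun x => ?_
    rw [← centerUnipotent_apply, ← mul_assoc, ← centerUnipotentChar_apply]
    rfl

end Frobenius

/-! ### Tables of the three induced characters. -/

section InducedTables

open Representation

variable {F E : Type*} [Field F] [Fintype F] [DecidableEq F] [Field E] [Fintype E] [Algebra F E]
  (b : Module.Basis (Fin 2) F E)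

theorem card_GL_cast : (Fintype.card (GL (Fin 2) F) : ℂ) =
    ((Fintype.card F : ℂ) ^ 2 - 1) * (Fintype.card F ^ 2 - Fintype.card F) := by
  have h := Matrix.card_GL_field (𝔽 := F) 2
  have h1 : 1 ≤ Fintype.card F ^ 2 := Nat.one_le_pow _ _ Fintype.card_pos
  have h2 : Fintype.card F ≤ Fintype.card F ^ 2 := Nat.le_self_pow two_ne_zero _
  rw [Nat.card_eq_fintype_card, Fin.prod_univ_two] at h
  rw [h]
  simp only [Fin.val_zero, Fin.val_one, pow_zero, pow_one]
  push_cast [h1, h2]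
  ring

omit [DecidableEq F] in
theorem card_cast_ne_zero : (Fintype.card F : ℂ) ≠ 0 := by simp

omit [DecidableEq F] in
theorem card_cast_sub_one_ne_zero : (Fintype.card F : ℂ) - 1 ≠ 0 :=
  sub_ne_zero.2 (by exact_mod_cast Fintype.one_lt_card.ne')

omit [Field F] [DecidableEq F] in
theorem card_cast_add_one_ne_zero : (Fintype.card F : ℂ) + 1 ≠ 0 :=
  Nat.cast_add_one_ne_zero _

omit [DecidableEq F] in
theorem card_cast_sq_sub_one_ne_zero : (Fintype.card F : ℂ) ^ 2 - 1 ≠ 0 := by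
  have : (Fintype.card F : ℂ) ^ 2 - 1 = (Fintype.card F - 1) * (Fintype.card F + 1) := by ring
  rw [this]
  exact mul_ne_zero card_cast_sub_one_ne_zero card_cast_add_one_ne_zero

/-- The function `μ₁ ⊗ μ₂` on the diagonal torus. -/
def mono (μ₁ μ₂ : Fˣ →* ℂˣ) : Fˣ → Fˣ → ℂ := fun a d => μ₁ a * μ₂ d

/-- A character as a complex valued function. -/
def toFun {A : Type*} [CommGroup A] (ν : A →* ℂˣ) : A → ℂ := fun w => ν w

-- A conjugate by `x` is triangular when the original matrix preserves the image under `x⁻¹` of the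
-- first coordinate line. A nonsemisimple triangular matrix preserves only that line itself.
omit [Fintype F] [DecidableEq F] in
theorem lower_eq_zero_of_conj_upper {x : GL (Fin 2) F} {a : Fˣ} {c : F} (hc : c ≠ 0)
    {a' d' : Fˣ} {c' : F} (h : x * upper a a c * x⁻¹ = upper a' d' c') : x 1 0 = 0 := by
  rw [mul_inv_eq_iff_eq_mul] at h
  have e10 := congrArg (fun g : GL (Fin 2) F => g 1 0) h
  have e11 := congrArg (fun g : GL (Fin 2) F => g 1 1) h
  simp only [mul_entries] at e10 e11
  simp [coe_upper] at e10 e11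
  by_contra hx
  have h1 : (a : F) = d' := mul_left_cancel₀ hx (by linear_combination e10)
  have h2 : x 1 0 * c = 0 := by linear_combination e11 - x 1 1 * h1
  exact (mul_eq_zero.1 h2).elim hx hc

-- A diagonal matrix with distinct entries preserves exactly the two coordinate lines.
omit [Fintype F] [DecidableEq F] in
theorem lower_eq_zero_of_conj_diag {x : GL (Fin 2) F} {a d : Fˣ} (had : a ≠ d)
    {a' d' : Fˣ} {c' : F} (h : x * upper a d 0 * x⁻¹ = upper a' d' c') :
    x 1 0 = 0 ∨ x 1 1 = 0 := by
  rw [mul_inv_eq_iff_eq_mul] at h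
  have e10 := congrArg (fun g : GL (Fin 2) F => g 1 0) h
  have e11 := congrArg (fun g : GL (Fin 2) F => g 1 1) h
  simp only [mul_entries] at e10 e11
  simp [coe_upper] at e10 e11
  by_contra! hx
  have h1 : (a : F) = d' := mul_left_cancel₀ hx.1 (by linear_combination e10)
  have h2 : (d : F) = d' := mul_left_cancel₀ hx.2 (by linear_combination e11)
  exact had (Units.ext (h1.trans h2.symm))

variable (F) in
/-- The permutation matrix of order two. -/
def weyl : GL (Fin 2) F := Matrix.GeneralLinearGroup.mkOfDetNeZero !![0, 1; 1, 0] (by simp)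

omit [Fintype F] [DecidableEq F] in
theorem coe_weyl : (weyl F : Matrix (Fin 2) (Fin 2) F) = !![0, 1; 1, 0] := rfl

omit [Fintype F] [DecidableEq F] in
theorem weyl_inv : (weyl F)⁻¹ = weyl F := by
  rw [inv_eq_iff_mul_eq_one]
  refine ext_entries ?_ ?_ ?_ ?_ <;> simp [mul_entries, coe_weyl]

omit [Fintype F] [DecidableEq F] in
theorem weyl_conj (a d : Fˣ) : weyl F * upper a d 0 * (weyl F)⁻¹ = upper d a 0 := by
  rw [mul_inv_eq_iff_eq_mul]
  refine ext_entries ?_ ?_ ?_ ?_ <;> simp [mul_entries, coe_weyl, coe_upper]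

-- The value is a weighted count of fixed points on the projective line: all `q + 1` for a scalar,
-- one for a nonsemisimple element, two for a split one, none for an elliptic one.
omit [Fintype E] in
theorem hasTable_principal (μ₁ μ₂ : Fˣ →* ℂˣ) :
    HasTable b (principal μ₁ μ₂).character (μ₁ * μ₂) (Fintype.card F + 1) 1 2 0
      (mono μ₁ μ₂ + mono μ₂ μ₁) 0 where
  conj x g := char_conj _ _ _
  scalar a := by
    let _ : Fintype (borel F) := Fintype.ofEquiv _ borelEquiv
    rw [character_induced_central (borel F).subtype_injective _
      (fun x => (upper_self_zero_comm a x).symm) (k := ⟨_, upper_mem_borel a a 0⟩) rfl,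
      borelChar_upper, Fintype.ofEquiv_card, Fintype.card_prod, Fintype.card_prod, card_GL_cast]
    push_cast
    rw [card_units_cast]
    have h0 := card_cast_ne_zero (F := F)
    have h1 := card_cast_sub_one_ne_zero (F := F)
    simp only [MonoidHom.mul_apply, Units.val_mul]
    field_simp
    ring
  unip a x hx := by
    let _ : Fintype (borel F) := Fintype.ofEquiv _ borelEquiv
    rw [character_induced_one_coset (borel F).subtype_injective _ (g := upper a a x)
      (k := ⟨_, upper_mem_borel a a x⟩) rfl, borelChar_upper]
    · simp
    · intro y hy
      rw [Subgroup.range_subtype] at hy ⊢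
      obtain ⟨a', d', c', e⟩ := eq_upper hy
      exact lower_eq_zero_of_conj_upper hx e
  split a d had := by
    let _ : Fintype (borel F) := Fintype.ofEquiv _ borelEquiv
    rw [character_induced_two_cosets (borel F).subtype_injective _ (g := upper a d 0)
      (k := ⟨_, upper_mem_borel a d 0⟩) (k' := ⟨_, upper_mem_borel d a 0⟩) (w := weyl F) rfl
      (weyl_conj a d).symm, borelChar_upper, borelChar_upper]
    · simp only [mono, Pi.add_apply]
      ring
    · rw [Subgroup.range_subtype]
      intro h
      have : weyl F 1 0 = 0 := h
      simp [coe_weyl] at this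
    · intro y hy
      rw [Subgroup.range_subtype] at hy ⊢
      obtain ⟨a', d', c', e⟩ := eq_upper hy
      refine (lower_eq_zero_of_conj_diag had e).imp id fun h => ?_
      change (y * (weyl F)⁻¹) 1 0 = 0
      rw [weyl_inv, mul_entries, h]
      simp [coe_weyl]
  elliptic w hw := by
    let _ : Fintype (borel F) := Fintype.ofEquiv _ borelEquiv
    refine character_induced_eq_zero (borel F).subtype_injective _ fun k hk => hw ?_
    obtain ⟨a, d, x, e⟩ := eq_upper k.2
    refine algebraMap_of_isConj_upper b (a := a) (d := d) (x := x) ?_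
    rw [← e]
    exact hk.symm
  split_self a := by
    simp only [mono, Pi.add_apply, MonoidHom.mul_apply, Units.val_mul]; ring
  elliptic_incl a := by simp

/-- Scalars see the full index `q ^ 2 - q`. A nonscalar `w` in the torus has only the conjugates `w`
and `w ^ q` there, and its centraliser is the torus, so two cosets contribute. -/
theorem hasTable_torusInd (ν : Eˣ →* ℂˣ) :
    HasTable b (torusInd b ν).character (res F ν) (Fintype.card F ^ 2 - Fintype.card F) 0 0 2 0
      (toFun ν + toFun (conj F ν)) where
  conj x g := char_conj _ _ _
  scalar a := by
    classical
    rw [character_induced_central (torus_injective b) _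
      (fun x => (upper_self_zero_comm a x).symm) (torus_algebraMap b a), card_GL_cast,
      card_units_cast, card_extension b]
    push_cast
    rw [inv_mul_cancel_left₀ card_cast_sq_sub_one_ne_zero]
    rfl
  unip a x hx := by
    classical
    rw [zero_mul]
    exact character_induced_eq_zero (torus_injective b) _ fun k hk =>
      hx (eq_scalar_of_isConj_torus b hk).2
  split a d had := by
    classical
    exact character_induced_eq_zero (torus_injective b) _ fun k hk =>
      had (eq_scalar_of_isConj_torus b hk).1
  elliptic w hw := by
    classical
    -- `s` carries `w` to `w ^ q` and represents the second coset; if it were in the torus it would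
    -- fix `w`, forcing `w` into `F`.
    obtain ⟨s, hs⟩ := isConj_iff.1 (isConj_torus_conj b hw)
    have hw' : ((w ^ Nat.card F : Eˣ) : E) ∉ (algebraMap F E).range := by
      rw [Nat.card_eq_fintype_card, Units.val_pow_eq_pow_val]
      exact pow_card_notMem_range b hw
    rw [character_induced_two_cosets (torus_injective b) _ (k := w) (k' := w ^ Nat.card F) (w := s)
      rfl hs.symm]
    · rfl
    · rintro ⟨y, rfl⟩
      rw [← map_mul, mul_comm, map_mul, mul_inv_cancel_right] at hs
      have h := congrArg Units.val (torus_injective b hs)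
      rw [Nat.card_eq_fintype_card, Units.val_pow_eq_pow_val] at h
      exact hw (mem_range_of_pow_card h.symm)
    · rintro x ⟨y, hy⟩
      rcases eq_or_eq_of_isConj_torus b hw (isConj_iff.2 ⟨x, hy.symm⟩) with rfl | rfl
      · left
        refine mem_range_torus_of_commute b hw ?_
        rw [eq_mul_inv_iff_mul_eq] at hy
        exact hy.symm
      · right
        refine mem_range_torus_of_commute b hw' ?_
        nth_rw 1 [← hs]
        rw [hy]
        group
  split_self a := by simp
  elliptic_incl a := by
    have : conj F ν (unitsIncl F E a) = ν (unitsIncl F E a) := by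
      change ν (unitsIncl F E a ^ Nat.card F) = _
      congr 1
      ext
      rw [Nat.card_eq_fintype_card, Units.val_pow_eq_pow_val, Units.coe_map]
      change algebraMap F E a ^ _ = algebraMap F E a
      rw [← map_pow, FiniteField.pow_card]
    simp only [toFun, Pi.add_apply, this]
    change (ν (unitsIncl F E a) : ℂ) + ν (unitsIncl F E a) = 2 * (ν (unitsIncl F E a) : ℂ)
    ring

omit [DecidableEq F] in
theorem sum_addChar {ψ : AddChar F ℂ} (hψ : ψ ≠ 1) : ∑ x, ψ x = 0 :=
  AddChar.sum_eq_zero_of_ne_one hψ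

-- Only upper triangular `y` conjugate a nonsemisimple `upper a a x` into `ZN`, and they rescale `x`
-- evenly over all nonzero values. The sum of `ψ` over nonzero elements is `-1`, whence the value
-- `-1`.
omit [Fintype E] in
theorem hasTable_centerUnipotentInd {ψ : AddChar F ℂ} (hψ : ψ ≠ 1) (ν : Eˣ →* ℂˣ) :
    HasTable b (centerUnipotentInd ψ ν).character (res F ν) (Fintype.card F ^ 2 - 1) (-1) 0 0 0
      0 where
  conj x g := char_conj _ _ _
  scalar a := by
    rw [character_induced_central centerUnipotent_injective _
      (fun x => (upper_self_zero_comm a x).symm) (k := (a, .ofAdd 0)) (by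
        rw [centerUnipotent_apply, mul_zero]), card_GL_cast, centerUnipotentChar_apply,
      Fintype.card_prod, Fintype.card_multiplicative]
    push_cast
    rw [card_units_cast]
    have h0 := card_cast_ne_zero (F := F)
    have h1 := card_cast_sub_one_ne_zero (F := F)
    rw [AddChar.map_zero_eq_one]
    field_simp
  unip a x hx := by
    let _ : Fintype (borel F) := Fintype.ofEquiv _ borelEquiv
    have h0 := card_cast_ne_zero (F := F)
    have h1 := card_cast_sub_one_ne_zero (F := F)
    rw [character_induced_extend centerUnipotent_injective,
      sum_eq_sum_range_of_forall (borel F).subtype_injective,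
      ← Fintype.sum_equiv borelEquiv
        (fun p : Fˣ × Fˣ × F => (res F ν a : ℂ) * ψ (a⁻¹ * (p.1 * p.2.1⁻¹ * x) : F))]
    · simp only [Fintype.sum_prod_type_right, Finset.sum_const, Finset.card_univ]
      have hd : ∀ d : Fˣ, ∑ c : Fˣ, ψ (a⁻¹ * (c * d⁻¹ * x) : F) = -1 := by
        intro d
        have hs := sum_addChar hψ
        rw [← Fintype.sum_equiv (Equiv.mulLeft₀ (a⁻¹ * (d⁻¹ * x) : F) (by simp [hx])) _ ψ
          fun c => rfl] at hs
        rw [← Finset.add_sum_erase _ _ (Finset.mem_univ (0 : F))] at hs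
        have hu : ∑ c : Fˣ, ψ (a⁻¹ * (c * d⁻¹ * x) : F) =
            ∑ c ∈ Finset.univ.erase (0 : F), ψ ((Equiv.mulLeft₀ (a⁻¹ * (d⁻¹ * x) : F)
              (by simp [hx])) c) := by
          refine Finset.sum_bij (fun c _ => (c : F)) (by simp) (fun _ _ _ _ e => Units.ext e)
            (fun c hc => ⟨Units.mk0 c (Finset.ne_of_mem_erase hc), Finset.mem_univ _, rfl⟩)
            fun c _ => ?_
          rw [Equiv.mulLeft₀_apply]
          congr 1
          ring
        rw [hu]
        simp only [Equiv.mulLeft₀_apply, mul_zero, AddChar.map_zero_eq_one] at hs ⊢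
        linear_combination hs
      simp only [← Finset.mul_sum, hd, Finset.sum_const, Finset.card_univ, Fintype.card_prod,
        Fintype.card_multiplicative, nsmul_eq_mul]
      push_cast
      rw [card_units_cast]
      field_simp
    · rintro ⟨c, d, y⟩
      have e : upper c d y * upper a a x * (upper c d y)⁻¹ =
          centerUnipotent F (a, .ofAdd (a⁻¹ * (c * d⁻¹ * x) : F)) := by
        rw [mul_inv_eq_iff_eq_mul, centerUnipotent_apply, upper_mul, upper_mul]
        congr 1
        · exact mul_comm _ _
        · exact mul_comm _ _
        · simp only [Units.val_inv_eq_inv_val]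
          field_simp
          ring
      change _ = Function.extend (centerUnipotent F) (centerUnipotentChar ψ ν) 0
        (upper c d y * upper a a x * (upper c d y)⁻¹)
      rw [e, centerUnipotent_injective.extend_apply, centerUnipotentChar_apply]
    · intro y hy
      rw [Function.extend_apply']
      · rfl
      · intro h
        obtain ⟨a', c', e⟩ := mem_range_centerUnipotent.1 h
        rw [Subgroup.range_subtype] at hy
        exact hy (lower_eq_zero_of_conj_upper hx e)
  split a d had := by
    refine character_induced_eq_zero centerUnipotent_injective _ fun k hk => had ?_
    obtain ⟨a', c', e⟩ := mem_range_centerUnipotent.1 ⟨k, rfl⟩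
    rw [e] at hk
    obtain ⟨h1, h2⟩ := trace_det_of_isConj hk
    simp only [coe_upper] at h1 h2
    simp at h1 h2
    have h3 : ((a : F) - a') * (a - a') = 0 := by linear_combination h2 - (a : F) * h1
    have h4 := sub_eq_zero.1 (mul_self_eq_zero.1 h3)
    refine Units.ext ?_
    linear_combination 2 * h4 + h1
  elliptic w hw := by
    refine character_induced_eq_zero centerUnipotent_injective _ fun k hk => hw ?_
    obtain ⟨a', c', e⟩ := mem_range_centerUnipotent.1 ⟨k, rfl⟩
    rw [e] at hk
    exact algebraMap_of_isConj_upper b hk.symm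
  split_self a := by simp
  elliptic_incl a := by simp

end InducedTables

/-! ### The integration formula. -/

section Average

open Representation

variable {F E : Type*} [Field F] [Fintype F] [DecidableEq F] [Field E] [Fintype E] [DecidableEq E]
  [Algebra F E] {b : Module.Basis (Fin 2) F E}

/-- The average of a function over the diagonal torus. -/
def avgSplit (D : Fˣ → Fˣ → ℂ) : ℂ := (((Fintype.card F : ℂ) - 1) ^ 2)⁻¹ * ∑ a, ∑ d, D a d

/-- The average of a function over a finite group of units. -/
def avgUnits {K : Type*} [Field K] [Fintype K] [DecidableEq K] (T : Kˣ → ℂ) : ℂ :=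
  ((Fintype.card K : ℂ) - 1)⁻¹ * ∑ w, T w

theorem avgSplit_add (D D' : Fˣ → Fˣ → ℂ) : avgSplit (D + D') = avgSplit D + avgSplit D' := by
  simp [avgSplit, Finset.sum_add_distrib, mul_add]

theorem avgSplit_zero : avgSplit (0 : Fˣ → Fˣ → ℂ) = 0 := by simp [avgSplit]

theorem avgSplit_mono (μ₁ μ₂ : Fˣ →* ℂˣ) : avgSplit (mono μ₁ μ₂) = delta μ₁ * delta μ₂ := by
  have h1 := card_cast_sub_one_ne_zero (F := F)
  simp only [avgSplit, mono, ← Finset.mul_sum, sum_char, card_units_cast, ← Finset.sum_mul]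
  field_simp

theorem avgUnits_add (T T' : Eˣ → ℂ) : avgUnits (T + T') = avgUnits T + avgUnits T' := by
  simp [avgUnits, Finset.sum_add_distrib, mul_add]

theorem avgUnits_neg (T : Eˣ → ℂ) : avgUnits (-T) = -avgUnits T := by
  simp [avgUnits]

theorem avgUnits_zero : avgUnits (0 : Eˣ → ℂ) = 0 := by simp [avgUnits]

theorem avgUnits_toFun (ν : Eˣ →* ℂˣ) : avgUnits (toFun ν) = delta ν := by
  have h1 := card_cast_sub_one_ne_zero (F := E)
  rw [avgUnits]
  change _ * ∑ w, (ν w : ℂ) = _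
  rw [sum_char, card_units_cast, inv_mul_cancel_left₀ h1]

omit [Fintype F] [DecidableEq F] in
theorem mono_mul_mono (μ₁ μ₂ ν₁ ν₂ : Fˣ →* ℂˣ) :
    mono μ₁ μ₂ * mono ν₁ ν₂ = mono (μ₁ * ν₁) (μ₂ * ν₂) := by
  ext a d
  simp only [mono, Pi.mul_apply, MonoidHom.mul_apply, Units.val_mul]
  ring

omit [Fintype E] [DecidableEq E] in
theorem toFun_mul_toFun (ν ρ : Eˣ →* ℂˣ) : toFun ν * toFun ρ = toFun (ν * ρ) := by
  ext w
  simp [toFun]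

omit [DecidableEq F] in
theorem sum_addChar_mul {ψ : AddChar F ℂ} (hψ : ψ ≠ 1) (f : F → ℂ) (c : ℂ)
    (hf : ∀ x, x ≠ 0 → f x = c) : ∑ x, ψ x * f x = f 0 - c := by
  classical
  have h : ∀ x, ψ x * f x = ψ x * c + if x = 0 then f 0 - c else 0 := by
    intro x
    by_cases hx : x = 0
    · subst hx
      rw [if_pos rfl, AddChar.map_zero_eq_one]
      ring
    · rw [if_neg hx, hf x hx, add_zero]
  simp only [h, Finset.sum_add_distrib, ← Finset.sum_mul, sum_addChar hψ, zero_mul, zero_add]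
  simp

omit [Fintype E] [DecidableEq E] in
theorem HasTable.sum_upper_self {f : GL (Fin 2) F → ℂ} {ω : Fˣ →* ℂˣ} {z u d t : ℂ}
    {D : Fˣ → Fˣ → ℂ} {T : Eˣ → ℂ} (h : HasTable b f ω z u d t D T) (a : Fˣ) :
    ∑ x, f (upper a a x) = (z + (Fintype.card F - 1) * u) * ω a := by
  rw [← Finset.add_sum_erase _ _ (Finset.mem_univ (0 : F)), h.scalar,
    Finset.sum_congr rfl fun x hx => h.unip a x (Finset.ne_of_mem_erase hx), Finset.sum_const,
    Finset.card_erase_of_mem (Finset.mem_univ _), Finset.card_univ, nsmul_eq_mul,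
    Nat.cast_sub Fintype.card_pos]
  push_cast
  ring

-- Off the diagonal `e = a` all the summands are conjugate to the split element; on it the
-- correction to `D` is a multiple of `ω a`, which later sums to a multiple of `delta ω`.
omit [Fintype E] [DecidableEq E] in
theorem HasTable.sum_upper {f : GL (Fin 2) F → ℂ} {ω : Fˣ →* ℂˣ} {z u d t : ℂ}
    {D : Fˣ → Fˣ → ℂ} {T : Eˣ → ℂ} (h : HasTable b f ω z u d t D T) (a e : Fˣ) :
    ∑ x, f (upper a e x) = Fintype.card F * D a e +
      if e = a then (z + (Fintype.card F - 1) * u - Fintype.card F * d) * ω a else 0 := by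
  by_cases hae : e = a
  · subst hae
    rw [h.sum_upper_self, if_pos rfl, h.split_self]
    ring
  · rw [if_neg hae, add_zero]
    have : ∀ x, f (upper a e x) = D a e := fun x => by
      rw [h.apply_eq_of_isConj (isConj_upper_of_ne (Ne.symm hae) x), h.split a e (Ne.symm hae)]
    simp [this]

omit [Fintype F] [DecidableEq F] [Fintype E] [DecidableEq E] in
theorem unitsIncl_injective : Function.Injective (unitsIncl F E) :=
  Units.map_injective (algebraMap F E).injective

theorem HasTable.sum_torus {f : GL (Fin 2) F → ℂ} {ω : Fˣ →* ℂˣ} {z u d t : ℂ}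
    {D : Fˣ → Fˣ → ℂ} {T : Eˣ → ℂ} (h : HasTable b f ω z u d t D T) :
    ∑ w, f (torus b w) = ∑ w, T w + (z - t) * ∑ a, (ω a : ℂ) := by
  have h1 := sum_eq_sum_range_of_forall (unitsIncl_injective (F := F) (E := E))
    (fun w => f (torus b w) - T w) fun w hw => sub_eq_zero.2 (h.elliptic w fun ⟨c, hc⟩ => hw ?_)
  · rw [Finset.sum_sub_distrib] at h1
    have h2 : ∀ a, f (torus b (unitsIncl F E a)) - T (unitsIncl F E a) = (z - t) * ω a :=
        fun a => by
      rw [torus_algebraMap, h.scalar, h.elliptic_incl, sub_mul]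
    simp only [h2, ← Finset.mul_sum] at h1
    linear_combination h1
  · have hc0 : c ≠ 0 := by
      rintro rfl
      rw [map_zero] at hc
      exact w.ne_zero hc.symm
    exact ⟨Units.mk0 c hc0, Units.ext hc⟩

omit [Fintype F] [DecidableEq F] [Fintype E] [DecidableEq E] in
theorem res_one : res F (1 : Eˣ →* ℂˣ) = 1 := rfl

/-- The integration formula on `GL(2, F)`. -/
theorem HasTable.avg_eq {ψ : AddChar F ℂ} (hψ : ψ ≠ 1) {f : GL (Fin 2) F → ℂ} {ω : Fˣ →* ℂˣ}
    {z u d t : ℂ} {D : Fˣ → Fˣ → ℂ} {T : Eˣ → ℂ} (h : HasTable b f ω z u d t D T) :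
    avg f = 2⁻¹ * (avgSplit D + avgUnits T +
      ((z + (Fintype.card F - 1) * u - Fintype.card F * d) /
        (Fintype.card F * (Fintype.card F - 1)) + (z - t) / (Fintype.card F + 1) -
        (z - u) / Fintype.card F) * delta ω) := by
  -- The values on the four types are `(q + 1) + (q ^ 2 - q) - (q ^ 2 - 1)`, `1 + 0 + 1`, `2 + 0 -
  -- 0` and `0 + 2 - 0`.
  have hone : ((principal (1 : Fˣ →* ℂˣ) 1).character + (torusInd b 1).character -
      (centerUnipotentInd ψ (1 : Eˣ →* ℂˣ)).character) = fun _ => 2 := by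
    have h1 := hasTable_principal b (1 : Fˣ →* ℂˣ) 1
    have h2 := hasTable_torusInd b (1 : Eˣ →* ℂˣ)
    have h3 := hasTable_centerUnipotentInd b hψ (1 : Eˣ →* ℂˣ)
    ext g
    simp only [Pi.add_apply, Pi.sub_apply]
    rcases isConj_classification b g with ⟨a, e⟩ | ⟨a, e⟩ | ⟨a, c, hac, e⟩ | ⟨w, hw, e⟩ <;>
      rw [h1.apply_eq_of_isConj e, h2.apply_eq_of_isConj e, h3.apply_eq_of_isConj e]
    · rw [h1.scalar, h2.scalar, h3.scalar, res_one, char_mul_one, MonoidHom.one_apply]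
      push_cast
      ring
    · rw [h1.unip _ _ one_ne_zero, h2.unip _ _ one_ne_zero, h3.unip _ _ one_ne_zero, res_one,
        char_mul_one, MonoidHom.one_apply]
      push_cast
      ring
    · rw [h1.split _ _ hac, h2.split _ _ hac, h3.split _ _ hac]
      simp [mono]
      norm_num
    · rw [h1.elliptic _ hw, h2.elliptic _ hw, h3.elliptic _ hw]
      simp [toFun, GLTwo.conj]
      norm_num
  have hf : avg f = 2⁻¹ * (avg ((principal (1 : Fˣ →* ℂˣ) 1).character * f) +
      avg ((torusInd b 1).character * f) -
      avg ((centerUnipotentInd ψ (1 : Eˣ →* ℂˣ)).character * f)) := by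
    have : f = (2⁻¹ : ℂ) • (((principal (1 : Fˣ →* ℂˣ) 1).character + (torusInd b 1).character -
        (centerUnipotentInd ψ (1 : Eˣ →* ℂˣ)).character) * f) := by
      rw [hone]
      ext g
      simp
    rw [this]
    nth_rw 2 3 4 [← this]
    simp only [avg, Pi.smul_apply, Pi.mul_apply, Pi.add_apply, Pi.sub_apply, smul_eq_mul,
      ← Finset.mul_sum, add_mul, sub_mul, Finset.sum_add_distrib, Finset.sum_sub_distrib]
    ring
  rw [hf, avg_principal_mul _ _ h.conj, avg_torusInd_mul _ _ h.conj,
    avg_centerUnipotentInd_mul _ _ h.conj]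
  simp only [res_one, MonoidHom.one_apply, Units.val_one, one_mul, h.sum_upper, h.sum_torus,
    Finset.sum_add_distrib, Finset.sum_ite_eq', Finset.mem_univ, if_true, ← Finset.mul_sum]
  have hψ' : ∀ a : Fˣ, ∑ x, ψ x * f (upper a a (a * x)) = (z - u) * ω a := fun a => by
    rw [sum_addChar_mul hψ _ (u * ω a) fun x hx => h.unip a _ (mul_ne_zero a.ne_zero hx), mul_zero,
      h.scalar]
    ring
  simp only [hψ', ← Finset.mul_sum, sum_char, card_units_cast, avgSplit, avgUnits,
    card_extension b]
  have h0 := card_cast_ne_zero (F := F)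
  have h1 := card_cast_sub_one_ne_zero (F := F)
  have h2 := card_cast_add_one_ne_zero (F := F)
  have h3 : (Fintype.card F : ℂ) ^ 2 - 1 = (Fintype.card F - 1) * (Fintype.card F + 1) := by ring
  push_cast
  rw [h3]
  field_simp
  ring

end Average

/-! ### Conjugation, restriction and norm for characters of `Eˣ`. -/

section Characters

variable {F E : Type*} [Field F] [Fintype F] [Field E] [Fintype E] [Algebra F E]

omit [Field F] [Fintype F] [Fintype E] [Algebra F E] in
theorem conj_mul (ν ρ : Eˣ →* ℂˣ) : conj F (ν * ρ) = conj F ν * conj F ρ := rfl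

omit [Field F] [Fintype F] [Fintype E] [Algebra F E] in
theorem conj_inv (ν : Eˣ →* ℂˣ) : conj F ν⁻¹ = (conj F ν)⁻¹ := rfl

omit [Field F] [Fintype F] [Fintype E] [Algebra F E] in
theorem conj_one : conj F (1 : Eˣ →* ℂˣ) = 1 := rfl

omit [Fintype F] [Fintype E] in
theorem res_mul (ν ρ : Eˣ →* ℂˣ) : res F (ν * ρ) = res F ν * res F ρ := rfl

omit [Fintype F] [Fintype E] in
theorem compNorm_mul (μ ν : Fˣ →* ℂˣ) : compNorm E (μ * ν) = compNorm E μ * compNorm E ν := rfl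

omit [Fintype F] [Fintype E] in
theorem compNorm_inv (μ : Fˣ →* ℂˣ) : compNorm E μ⁻¹ = (compNorm E μ)⁻¹ := rfl

theorem conj_conj (b : Module.Basis (Fin 2) F E) (ν : Eˣ →* ℂˣ) : conj F (conj F ν) = ν := by
  ext w
  change (ν ((w ^ Nat.card F) ^ Nat.card F) : ℂ) = ν w
  congr 2
  ext
  have h := FiniteField.pow_card (w : E)
  rw [card_extension b, pow_two, pow_mul] at h
  rw [Nat.card_eq_fintype_card, Units.val_pow_eq_pow_val, Units.val_pow_eq_pow_val, h]

theorem delta_conj (b : Module.Basis (Fin 2) F E) (ν : Eˣ →* ℂˣ) :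
    delta (conj F ν) = delta ν := by
  by_cases h : ν = 1
  · subst h
    rw [conj_one]
  · rw [delta_of_ne h, delta_of_ne]
    intro h'
    apply h
    rw [← conj_conj b ν, h', conj_one]

omit [Fintype F] [Fintype E] in
theorem res_compNorm (b : Module.Basis (Fin 2) F E) (μ : Fˣ →* ℂˣ) :
    res F (compNorm E μ) = μ * μ := by
  ext a
  change ((μ (Units.map (Algebra.norm F : E →* F) (unitsIncl F E a)) : ℂˣ) : ℂ) = (μ a * μ a : ℂˣ)
  rw [← map_mul]
  congr 2
  ext
  change Algebra.norm F (algebraMap F E a) = a * a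
  rw [Algebra.norm_algebraMap_of_basis b, Fintype.card_fin, pow_two]

omit [Fintype F] in
theorem unitsNorm_surjective :
    Function.Surjective (Units.map (Algebra.norm F : E →* F)) :=
  FiniteField.unitsMap_norm_surjective F E

omit [Fintype F] in
theorem compNorm_injective {μ ν : Fˣ →* ℂˣ} (h : compNorm E μ = compNorm E ν) : μ = ν :=
  (MonoidHom.cancel_right unitsNorm_surjective).1 h

omit [Fintype F] in
theorem delta_compNorm (μ : Fˣ →* ℂˣ) : delta (compNorm E μ) = delta μ := by
  by_cases h : μ = 1
  · subst h
    rw [delta_one]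
    exact delta_one
  · rw [delta_of_ne h, delta_of_ne]
    exact fun h' => h (compNorm_injective (E := E) h')

omit [Fintype E] in
theorem conj_compNorm (μ : Fˣ →* ℂˣ) : conj F (compNorm E μ) = compNorm E μ := by
  ext w
  change (μ (Units.map (Algebra.norm F : E →* F) (w ^ Nat.card F)) : ℂ) =
    μ (Units.map (Algebra.norm F : E →* F) w)
  congr 2
  ext
  rw [map_pow, Nat.card_eq_fintype_card, Units.val_pow_eq_pow_val, FiniteField.pow_card]

/-- A character of `Eˣ` fixed by conjugation factors through the norm. -/
theorem conj_ne_of_primitive (b : Module.Basis (Fin 2) F E) {ν : Eˣ →* ℂˣ} (h : Primitive F ν) :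
    conj F ν ≠ ν := by
  intro hc
  let N : Eˣ →* Fˣ := Units.map (Algebra.norm F : E →* F)
  -- Hilbert 90 for finite fields: the norm is the power `q + 1` and `Eˣ` is cyclic of order `q ^ 2
  -- - 1`, so a norm one element is `y ^ (q - 1)` for some `y`. There `ν` is trivial because `ν (y ^
  -- q) = ν y`.
  have hk : N.ker ≤ ν.ker := by
    intro w hw
    have hw1 : (w : E) ^ (Fintype.card F + 1) = 1 := by
      have h1 := FiniteField.algebraMap_norm_eq_pow (K := F) (x := (w : E))
      have h2 : Algebra.norm F (w : E) = 1 := congrArg Units.val hw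
      have h3 : (Nat.card E - 1) / (Nat.card F - 1) = Fintype.card F + 1 := by
        rw [Nat.card_eq_fintype_card, Nat.card_eq_fintype_card, card_extension b]
        have := Fintype.one_lt_card (α := F)
        apply Nat.div_eq_of_eq_mul_left (by omega)
        rw [← Nat.sq_sub_sq, one_pow]
      rw [h2, map_one, h3] at h1
      exact h1.symm
    obtain ⟨g, hg⟩ := IsCyclic.exists_generator (α := Eˣ)
    obtain ⟨k, rfl⟩ := Subgroup.mem_zpowers_iff.1 (hg w)
    classical
    have hord : orderOf g = Fintype.card F ^ 2 - 1 := by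
      rw [orderOf_eq_card_of_forall_mem_zpowers hg, Nat.card_eq_fintype_card, Fintype.card_units,
        card_extension b]
    have h1 : (g ^ k) ^ (Fintype.card F + 1) = 1 := Units.ext (by simpa using hw1)
    rw [← zpow_natCast, ← zpow_mul, ← orderOf_dvd_iff_zpow_eq_one, hord] at h1
    have h2 : ((Fintype.card F : ℤ) - 1) ∣ k := by
      rw [Nat.cast_sub (Nat.one_le_pow _ _ Fintype.card_pos)] at h1
      push_cast at h1
      rw [show (Fintype.card F : ℤ) ^ 2 - 1 = (Fintype.card F - 1) * (Fintype.card F + 1) by ring]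
        at h1
      exact Int.dvd_of_mul_dvd_mul_right (by positivity) h1
    obtain ⟨m, rfl⟩ := h2
    have h3 : ν (g ^ m) ^ Fintype.card F = ν (g ^ m) := by
      rw [← map_pow, ← Nat.card_eq_fintype_card]
      exact DFunLike.congr_fun hc (g ^ m)
    rw [MonoidHom.mem_ker, mul_comm, zpow_mul, map_zpow ν (g ^ m), zpow_sub, zpow_natCast, zpow_one,
      h3, mul_inv_cancel]
  refine h (N.liftOfSurjective unitsNorm_surjective ⟨ν, hk⟩) ?_
  exact (N.liftOfRightInverse_comp _ (Function.rightInverse_surjInv unitsNorm_surjective)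
    ⟨ν, hk⟩).symm

omit [Fintype F] [Fintype E] in
theorem Primitive.compNorm_mul {ν : Eˣ →* ℂˣ} (h : Primitive F ν) (μ : Fˣ →* ℂˣ) :
    Primitive F (compNorm E μ * ν) := by
  intro ρ hρ
  apply h (μ⁻¹ * ρ)
  rw [GLTwo.compNorm_mul, ← hρ, compNorm_inv, ← char_mul_assoc, char_inv_mul_cancel]
  exact (one_mul ν).symm

omit [Fintype F] [Fintype E] in
theorem Primitive.inv {ν : Eˣ →* ℂˣ} (h : Primitive F ν) : Primitive F ν⁻¹ := by
  intro ρ hρ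
  apply h ρ⁻¹
  rw [compNorm_inv, ← hρ]
  exact (inv_inv ν).symm

end Characters

/-! ### Tables of the four families and construction of the cuspidal ones. -/

section Families

open Representation

variable {F E : Type*} [Field F] [Fintype F] [DecidableEq F] [Field E] [Algebra F E]
  (b : Module.Basis (Fin 2) F E)

omit [Fintype F] [DecidableEq F] in
theorem character_oneDim (μ : Fˣ →* ℂˣ) (g : GL (Fin 2) F) :
    (oneDim μ).character g = μ (Matrix.GeneralLinearGroup.det g) := by
  rw [Representation.character]
  change LinearMap.trace ℂ ℂ ((μ (Matrix.GeneralLinearGroup.det g) : ℂ) • LinearMap.id) = _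
  simp

omit [Fintype F] [DecidableEq F] in
theorem hasTable_oneDim (μ : Fˣ →* ℂˣ) :
    HasTable b (oneDim μ).character (μ * μ) 1 1 1 1 (mono μ μ) (toFun (compNorm E μ)) where
  conj x g := char_conj _ _ _
  scalar a := by rw [character_oneDim, det_upper]; simp
  unip a x hx := by rw [character_oneDim, det_upper]; simp
  split a d had := by rw [character_oneDim, det_upper]; simp [mono]
  elliptic w hw := by
    rw [character_oneDim]
    change (μ _ : ℂ) = μ (Units.map (Algebra.norm F : E →* F) w)
    congr 2
    ext
    rw [Matrix.GeneralLinearGroup.val_det_apply, coe_torus]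
    exact (Algebra.norm_eq_matrix_det b _).symm
  split_self a := by simp [mono]
  elliptic_incl a := by
    rw [one_mul, ← res_compNorm b]; rfl

omit [DecidableEq F] in
theorem character_steinberg (μ : Fˣ →* ℂˣ) :
    (steinberg μ).character = (principal μ μ).character - (oneDim μ).character := by
  have hT : Function.Injective (oneDimToPrincipal μ) := by
    refine (injective_iff_map_eq_zero (oneDimToPrincipal μ).toLinearMap).2 fun c hc => ?_
    have h : (μ (Matrix.GeneralLinearGroup.det (1 : GL (Fin 2) F)) : ℂ) * c = 0 :=
      congrFun (congrArg Subtype.val hc) 1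
    simpa using h
  have he : Nonempty ((oneDim μ).Equiv (oneDimToPrincipal μ).range.toRepresentation) := by
    let f : (oneDim μ).IntertwiningMap (oneDimToPrincipal μ).range.toRepresentation :=
      { toLinearMap := (oneDimToPrincipal μ).toLinearMap.codRestrict _
          fun x => ((oneDimToPrincipal μ).mem_range _ _ _).2 ⟨x, rfl⟩
        isIntertwining' := fun g =>
          LinearMap.ext fun x => Subtype.ext ((oneDimToPrincipal μ).isIntertwining _ _ g x) }
    refine ⟨f.ofBijective ⟨fun x y h => hT (congrArg Subtype.val h), ?_⟩⟩
    rintro ⟨_, hw⟩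
    obtain ⟨x, rfl⟩ := ((oneDimToPrincipal μ).mem_range _ _ _).1 hw
    exact ⟨x, rfl⟩
  obtain ⟨e⟩ := he
  ext g
  rw [Pi.sub_apply, char_iso e]
  exact character_quotient _ g

theorem hasTable_steinberg (μ : Fˣ →* ℂˣ) :
    HasTable b (steinberg μ).character (μ * μ) (Fintype.card F) 0 1 (-1) (mono μ μ)
      (-toFun (compNorm E μ)) := by
  rw [character_steinberg]
  refine ((hasTable_principal b μ μ).sub (hasTable_oneDim b μ)).congr rfl ?_ ?_ ?_ ?_ ?_ ?_
  · ring
  · ring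
  · ring
  · ring
  · ring
  · ring

variable [Fintype E]

/-- For primitive `ν` this is the cuspidal character; for `ν = μ ∘ N` it is the table of `St_μ -
χ_μ`, which the completeness proof uses. -/
theorem hasTable_sub {ψ : AddChar F ℂ} (hψ : ψ ≠ 1) (ν : Eˣ →* ℂˣ) :
    HasTable b ((centerUnipotentInd ψ ν).character - (torusInd b ν).character) (res F ν)
      (Fintype.card F - 1) (-1) 0 (-2) 0 (-(toFun ν + toFun (conj F ν))) := by
  refine ((hasTable_centerUnipotentInd b hψ ν).sub (hasTable_torusInd b ν)).congr rfl ?_ ?_ ?_ ?_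
    ?_ ?_
  · ring
  · ring
  · ring
  · ring
  · ring
  · ring

omit [Fintype F] [DecidableEq F] [Fintype E] in
theorem toFun_inv (ν : Eˣ →* ℂˣ) : (fun w => toFun ν w⁻¹) = toFun ν⁻¹ := by
  ext w
  simp [toFun]

theorem charInner_eq_avg {G : Type*} [Group G] [Fintype G] (f h : G → ℂ) :
    charInner f h = avg (f * fun g => h g⁻¹) := rfl

/-- The cuspidal character and the decomposition of the induced representation defining it. -/
theorem exists_cuspidal_kernel {ψ : AddChar F ℂ} (hψ : ψ ≠ 1) {ν : Eˣ →* ℂˣ}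
    (hν : Primitive F ν) :
    ∃ T : (centerUnipotentInd ψ ν).IntertwiningMap (torusInd b ν),
      T.ker.toRepresentation.IsIrreducible ∧
      T.ker.toRepresentation.character =
        (centerUnipotentInd ψ ν).character - (torusInd b ν).character ∧
      cuspidalSub b ψ ν = T.ker := by
  classical
  have hs := hasTable_sub b hψ ν
  have hw := hasTable_torusInd b ν
  have hq0 := card_cast_ne_zero (F := F)
  have hq1 := card_cast_sub_one_ne_zero (F := F)
  have hq2 := card_cast_add_one_ne_zero (F := F)
  have hne : delta (ν * (conj F ν)⁻¹) = 0 :=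
    delta_of_ne fun h => conj_ne_of_primitive b hν (char_mul_inv_eq_one.1 h).symm
  have hne' : delta (conj F ν * ν⁻¹) = 0 :=
    delta_of_ne fun h => conj_ne_of_primitive b hν (char_mul_inv_eq_one.1 h)
  have hinv : ∀ T : Eˣ → ℂ, (toFun ν + toFun (conj F ν)) =  T →
      (fun w => T w⁻¹) = toFun ν⁻¹ + toFun (conj F ν)⁻¹ := by
    rintro _ rfl
    rw [← toFun_inv, ← toFun_inv]; rfl
  -- Primitivity enters here: `ν` and its conjugate are distinct, hence orthogonal on `Eˣ`.
  have hmul : avgUnits ((toFun ν + toFun (conj F ν)) * (toFun ν⁻¹ + toFun (conj F ν)⁻¹)) = 2 := by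
    rw [add_mul, mul_add, mul_add]
    simp only [toFun_mul_toFun, avgUnits_add, avgUnits_toFun, char_mul_inv_cancel, delta_one, hne,
      hne']
    norm_num
  have h1 : charInner ((centerUnipotentInd ψ ν).character - (torusInd b ν).character)
      ((centerUnipotentInd ψ ν).character - (torusInd b ν).character) = 1 := by
    rw [charInner_eq_avg, (hs.mul hs.inv).avg_eq hψ, char_mul_inv_cancel, delta_one]
    have : (-(toFun ν + toFun (conj F ν)) * fun w => (-(toFun ν + toFun (conj F ν)) : Eˣ → ℂ) w⁻¹) =
        (toFun ν + toFun (conj F ν)) * (toFun ν⁻¹ + toFun (conj F ν)⁻¹) := by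
      rw [← hinv _ rfl]
      ext w
      simp only [Pi.mul_apply, Pi.neg_apply]
      ring
    rw [this, hmul, zero_mul, avgSplit_zero]
    field_simp
    ring
  -- This orthogonality makes the kernel of a single map the common kernel of all of them.
  have h2 : charInner ((centerUnipotentInd ψ ν).character - (torusInd b ν).character)
      (torusInd b ν).character = 0 := by
    rw [charInner_eq_avg, (hs.mul hw.inv).avg_eq hψ, char_mul_inv_cancel, delta_one, hinv _ rfl,
      neg_mul, avgUnits_neg, hmul, zero_mul, avgSplit_zero]
    field_simp
    ring
  -- The degrees are `q ^ 2 - q` and `q ^ 2 - 1`, with difference `q - 1 > 0`.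
  have hd : Module.finrank ℂ (Induced (torus b) ((Units.coeHom ℂ).comp ν)) <
      Module.finrank ℂ (Induced (centerUnipotent F) (centerUnipotentChar ψ ν)) := by
    have e1 := (hasTable_torusInd b ν).scalar 1
    have e2 := (hasTable_centerUnipotentInd b hψ ν).scalar 1
    rw [upper_one_one_zero, char_one, map_one, Units.val_one, mul_one] at e1 e2
    have e3 : (Module.finrank ℂ (Induced (centerUnipotent F) (centerUnipotentChar ψ ν)) : ℂ) + 1 =
        Module.finrank ℂ (Induced (torus b) ((Units.coeHom ℂ).comp ν)) + Fintype.card F := by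
      rw [e1, e2]; ring
    have e4 := Fintype.one_lt_card (α := F)
    have e5 : Module.finrank ℂ (Induced (centerUnipotent F) (centerUnipotentChar ψ ν)) + 1 =
        Module.finrank ℂ (Induced (torus b) ((Units.coeHom ℂ).comp ν)) + Fintype.card F := by
      exact_mod_cast e3
    omega
  obtain ⟨T, hT, hTc⟩ := exists_irreducible_kernel h1 hd
  refine ⟨T, hT, hTc, Subrepresentation.toSubmodule_injective (iInf_ker_eq T ?_)⟩
  rw [hTc, h2]

theorem character_cuspidal {ψ : AddChar F ℂ} (hψ : ψ ≠ 1) {ν : Eˣ →* ℂˣ} (hν : Primitive F ν) :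
    (cuspidal b ψ ν).character =
      (centerUnipotentInd ψ ν).character - (torusInd b ν).character := by
  obtain ⟨T, -, hT, h⟩ := exists_cuspidal_kernel b hψ hν
  rw [← hT, ← h]

theorem isIrreducible_cuspidal {ψ : AddChar F ℂ} (hψ : ψ ≠ 1) {ν : Eˣ →* ℂˣ}
    (hν : Primitive F ν) : (cuspidal b ψ ν).IsIrreducible := by
  obtain ⟨T, hT, -, h⟩ := exists_cuspidal_kernel b hψ hν
  rw [← h] at hT
  exact hT

theorem hasTable_cuspidal {ψ : AddChar F ℂ} (hψ : ψ ≠ 1) {ν : Eˣ →* ℂˣ} (hν : Primitive F ν) :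
    HasTable b (cuspidal b ψ ν).character (res F ν) (Fintype.card F - 1) (-1) 0 (-2) 0
      (-(toFun ν + toFun (conj F ν))) :=
  character_cuspidal b hψ hν ▸ hasTable_sub b hψ ν

theorem nonempty_equiv_cuspidal_prod {ψ : AddChar F ℂ} (hψ : ψ ≠ 1) {ν : Eˣ →* ℂˣ}
    (hν : Primitive F ν) :
    Nonempty ((centerUnipotentInd ψ ν).Equiv ((cuspidal b ψ ν).prod (torusInd b ν))) := by
  refine nonempty_equiv_of_character_eq (funext fun g => ?_)
  rw [character_prod, character_cuspidal b hψ hν, Pi.sub_apply, sub_add_cancel]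

end Families

/-! ### Triple products and pairings from the integration formula. -/

section Tables

open Representation

variable {F E : Type*} [Field F] [Fintype F] [DecidableEq F] [Field E] [Fintype E] [Algebra F E]
  (b : Module.Basis (Fin 2) F E)

theorem delta_mul_self {A : Type*} [CommGroup A] (χ : A →* ℂˣ) :
    delta χ * delta χ = delta χ := by
  unfold delta; split_ifs <;> norm_num

theorem exists_delta_eq_natCast {A : Type*} [CommGroup A] (χ : A →* ℂˣ) :
    ∃ k : ℕ, k ≤ 1 ∧ delta χ = k := by
  unfold delta
  split_ifs
  · exact ⟨1, le_rfl, Nat.cast_one.symm⟩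
  · exact ⟨0, zero_le_one, Nat.cast_zero.symm⟩

theorem delta_mul_delta_eq_zero {A : Type*} [CommGroup A] (μ : A →* ℂˣ) {ν₁ ν₂ : A →* ℂˣ}
    (h : ν₁ ≠ ν₂) : delta (μ * ν₁) * delta (μ * ν₂) = 0 := by
  by_cases h1 : μ * ν₁ = 1
  · rw [delta_of_ne (χ := μ * ν₂), mul_zero]
    intro h2
    exact h (mul_left_cancel (h1.trans h2.symm))
  · rw [delta_of_ne h1, zero_mul]

include b in
omit [DecidableEq F] in
theorem delta_compNorm_mul_conj (μ : Fˣ →* ℂˣ) (ν : Eˣ →* ℂˣ) :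
    delta (compNorm E μ * conj F ν) = delta (compNorm E μ * ν) := by
  rw [← delta_conj b, conj_mul, conj_conj b, conj_compNorm]

omit [Fintype F] [DecidableEq F] [Fintype E] in
theorem delta_compNorm_mul_primitive {ν : Eˣ →* ℂˣ} (h : Primitive F ν) (μ : Fˣ →* ℂˣ) :
    delta (compNorm E μ * ν) = 0 := by
  refine delta_of_ne fun h' => h μ⁻¹ ?_
  rw [compNorm_inv, ← char_mul_one (compNorm E μ)⁻¹, ← h', ← char_mul_assoc, char_inv_mul_cancel]
  exact (one_mul ν).symm

theorem triple_eq_avg {G : Type*} [Group G] [Fintype G] {V W X : Type*} [AddCommGroup V]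
    [Module ℂ V] [AddCommGroup W] [Module ℂ W] [AddCommGroup X] [Module ℂ X]
    (π : Representation ℂ G V) (π' : Representation ℂ G W) (π'' : Representation ℂ G X) :
    triple π π' π'' = avg (π.character * π'.character * π''.character) := rfl

theorem pairing_eq_avg {G : Type*} [Group G] [Fintype G] {V W : Type*} [AddCommGroup V]
    [Module ℂ V] [AddCommGroup W] [Module ℂ W]
    (π : Representation ℂ G V) (π' : Representation ℂ G W) :
    pairing π π' = avg (π.character * π'.character) := rfl

variable {ψ : AddChar F ℂ} (hψ : ψ ≠ 1)
include b hψ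

/-- The eight monomials on the split torus give each of the four products of deltas twice, which the
factor `1/2` undoes; the central constant is 2. -/
theorem triple_principal_principal_principal (μ₁ μ₂ ν₁ ν₂ ρ₁ ρ₂ : Fˣ →* ℂˣ) :
    triple (principal μ₁ μ₂) (principal ν₁ ν₂) (principal ρ₁ ρ₂) =
      delta (μ₁ * ν₁ * ρ₁ * μ₂ * ν₂ * ρ₂)
      + delta (μ₁ * ν₁ * ρ₁) * delta (μ₂ * ν₂ * ρ₂)
      + delta (μ₂ * ν₁ * ρ₁) * delta (μ₁ * ν₂ * ρ₂)
      + delta (μ₁ * ν₂ * ρ₁) * delta (μ₂ * ν₁ * ρ₂)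
      + delta (μ₁ * ν₁ * ρ₂) * delta (μ₂ * ν₂ * ρ₁) := by
  classical
  have hq0 := card_cast_ne_zero (F := F)
  have hq1 := card_cast_sub_one_ne_zero (F := F)
  have hq2 := card_cast_add_one_ne_zero (F := F)
  rw [triple_eq_avg, (((hasTable_principal b μ₁ μ₂).mul (hasTable_principal b ν₁ ν₂)).mul
    (hasTable_principal b ρ₁ ρ₂)).avg_eq hψ]
  simp only [add_mul, mul_add, mono_mul_mono, avgSplit_add, avgSplit_mono, avgUnits_zero, mul_zero]
  simp only [char_mul_comm, char_mul_left_comm]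
  field_simp
  ring

theorem triple_principal_principal_steinberg (μ₁ μ₂ ν₁ ν₂ ρ : Fˣ →* ℂˣ) :
    triple (principal μ₁ μ₂) (principal ν₁ ν₂) (steinberg ρ) =
      delta (μ₁ * μ₂ * ν₁ * ν₂ * ρ ^ 2)
      + delta (μ₁ * ν₁ * ρ) * delta (μ₂ * ν₂ * ρ)
      + delta (μ₁ * ν₂ * ρ) * delta (μ₂ * ν₁ * ρ) := by
  classical
  have hq0 := card_cast_ne_zero (F := F)
  have hq1 := card_cast_sub_one_ne_zero (F := F)
  have hq2 := card_cast_add_one_ne_zero (F := F)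
  rw [triple_eq_avg, (((hasTable_principal b μ₁ μ₂).mul (hasTable_principal b ν₁ ν₂)).mul
    (hasTable_steinberg b ρ)).avg_eq hψ]
  simp only [add_mul, mul_add, mul_neg, mono_mul_mono, avgSplit_add, avgSplit_mono, avgUnits_zero,
    zero_mul, mul_zero, neg_zero]
  simp only [char_sq, char_mul_comm, char_mul_left_comm]
  field_simp
  ring

/-- Cuspidal characters vanish at split elements and principal ones at elliptic elements, so both
torus averages are zero and only the central term remains. -/
theorem triple_principal_principal_cuspidal (μ₁ μ₂ ν₁ ν₂ : Fˣ →* ℂˣ) {ρ : Eˣ →* ℂˣ}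
    (hρ : Primitive F ρ) :
    triple (principal μ₁ μ₂) (principal ν₁ ν₂) (cuspidal b ψ ρ) =
      delta (μ₁ * μ₂ * ν₁ * ν₂ * res F ρ) := by
  classical
  have hq0 := card_cast_ne_zero (F := F)
  have hq1 := card_cast_sub_one_ne_zero (F := F)
  have hq2 := card_cast_add_one_ne_zero (F := F)
  rw [triple_eq_avg, (((hasTable_principal b μ₁ μ₂).mul (hasTable_principal b ν₁ ν₂)).mul
    (hasTable_cuspidal b hψ hρ)).avg_eq hψ]
  simp only [add_mul, mul_add, mul_neg, mono_mul_mono, avgSplit_zero, avgUnits_add, avgUnits_zero,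
    zero_mul, mul_zero, neg_add, neg_zero]
  simp only [char_mul_comm, char_mul_left_comm]
  field_simp
  ring

theorem triple_principal_steinberg_steinberg (μ₁ μ₂ ν ρ : Fˣ →* ℂˣ) :
    triple (principal μ₁ μ₂) (steinberg ν) (steinberg ρ) =
      delta (μ₁ * μ₂ * ν ^ 2 * ρ ^ 2) + delta (μ₁ * ν * ρ) * delta (μ₂ * ν * ρ) := by
  classical
  have hq0 := card_cast_ne_zero (F := F)
  have hq1 := card_cast_sub_one_ne_zero (F := F)
  have hq2 := card_cast_add_one_ne_zero (F := F)
  rw [triple_eq_avg, (((hasTable_principal b μ₁ μ₂).mul (hasTable_steinberg b ν)).mul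
    (hasTable_steinberg b ρ)).avg_eq hψ]
  simp only [add_mul, mul_add, mul_neg, mono_mul_mono, avgSplit_add, avgSplit_mono, avgUnits_zero,
    zero_mul, mul_zero, neg_zero]
  simp only [char_sq, char_mul_comm, char_mul_left_comm]
  field_simp
  ring

theorem triple_steinberg_steinberg_steinberg (μ ν ρ : Fˣ →* ℂˣ) :
    triple (steinberg μ) (steinberg ν) (steinberg ρ) = delta (μ ^ 2 * ν ^ 2 * ρ ^ 2) := by
  classical
  have hq0 := card_cast_ne_zero (F := F)
  have hq1 := card_cast_sub_one_ne_zero (F := F)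
  have hq2 := card_cast_add_one_ne_zero (F := F)
  rw [triple_eq_avg, (((hasTable_steinberg b μ).mul (hasTable_steinberg b ν)).mul
    (hasTable_steinberg b ρ)).avg_eq hψ]
  simp only [mul_add, neg_mul, mul_neg, neg_neg, mono_mul_mono, toFun_mul_toFun, avgSplit_mono,
    avgUnits_neg, avgUnits_toFun, mul_zero, ← compNorm_mul, delta_compNorm, delta_mul_self]
  simp only [char_sq, char_mul_comm, char_mul_left_comm]
  field_simp
  ring

theorem triple_principal_steinberg_cuspidal (μ₁ μ₂ ν : Fˣ →* ℂˣ) {ρ : Eˣ →* ℂˣ}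
    (hρ : Primitive F ρ) :
    triple (principal μ₁ μ₂) (steinberg ν) (cuspidal b ψ ρ) =
      delta (μ₁ * μ₂ * ν ^ 2 * res F ρ) := by
  classical
  have hq0 := card_cast_ne_zero (F := F)
  have hq1 := card_cast_sub_one_ne_zero (F := F)
  have hq2 := card_cast_add_one_ne_zero (F := F)
  rw [triple_eq_avg, (((hasTable_principal b μ₁ μ₂).mul (hasTable_steinberg b ν)).mul
    (hasTable_cuspidal b hψ hρ)).avg_eq hψ]
  simp only [add_mul, mul_add, mul_neg, mono_mul_mono, avgSplit_zero, avgUnits_add, avgUnits_zero,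
    zero_mul, mul_zero, neg_add, neg_zero]
  simp only [char_sq, char_mul_comm, char_mul_left_comm]
  field_simp
  ring

theorem triple_principal_cuspidal_cuspidal (μ₁ μ₂ : Fˣ →* ℂˣ) {ν ρ : Eˣ →* ℂˣ}
    (hν : Primitive F ν) (hρ : Primitive F ρ) :
    triple (principal μ₁ μ₂) (cuspidal b ψ ν) (cuspidal b ψ ρ) =
      delta (μ₁ * μ₂ * res F ν * res F ρ) := by
  classical
  have hq0 := card_cast_ne_zero (F := F)
  have hq1 := card_cast_sub_one_ne_zero (F := F)
  have hq2 := card_cast_add_one_ne_zero (F := F)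
  rw [triple_eq_avg, (((hasTable_principal b μ₁ μ₂).mul (hasTable_cuspidal b hψ hν)).mul
    (hasTable_cuspidal b hψ hρ)).avg_eq hψ]
  simp only [add_mul, mul_add, neg_mul, mul_neg, neg_neg, avgSplit_zero, avgUnits_add,
    avgUnits_zero, zero_mul, mul_zero, neg_add, neg_zero]
  simp only [char_mul_comm, char_mul_left_comm]
  field_simp
  ring

theorem triple_steinberg_steinberg_cuspidal (μ ν : Fˣ →* ℂˣ) {ρ : Eˣ →* ℂˣ} (hρ : Primitive F ρ) :
    triple (steinberg μ) (steinberg ν) (cuspidal b ψ ρ) =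
      delta (μ ^ 2 * ν ^ 2 * res F ρ) := by
  classical
  have hq0 := card_cast_ne_zero (F := F)
  have hq1 := card_cast_sub_one_ne_zero (F := F)
  have hq2 := card_cast_add_one_ne_zero (F := F)
  rw [triple_eq_avg, (((hasTable_steinberg b μ).mul (hasTable_steinberg b ν)).mul
    (hasTable_cuspidal b hψ hρ)).avg_eq hψ]
  simp only [mul_add, neg_mul, mul_neg, neg_neg, mono_mul_mono, toFun_mul_toFun, avgSplit_zero,
    avgUnits_add, avgUnits_neg, avgUnits_toFun, zero_mul, mul_zero, neg_add, neg_zero,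
    ← compNorm_mul, delta_compNorm_mul_conj b, delta_compNorm_mul_primitive hρ]
  simp only [char_sq, char_mul_comm, char_mul_left_comm]
  field_simp
  ring

theorem triple_steinberg_cuspidal_cuspidal (μ : Fˣ →* ℂˣ) {ν ρ : Eˣ →* ℂˣ}
    (hν : Primitive F ν) (hρ : Primitive F ρ) :
    triple (steinberg μ) (cuspidal b ψ ν) (cuspidal b ψ ρ) =
      delta (μ ^ 2 * res F ν * res F ρ)
        - delta (compNorm E μ * ν * ρ) - delta (compNorm E μ * ν * conj F ρ) := by
  classical
  have hq0 := card_cast_ne_zero (F := F)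
  have hq1 := card_cast_sub_one_ne_zero (F := F)
  have hq2 := card_cast_add_one_ne_zero (F := F)
  -- Conjugation fixes `μ ∘ N` and pairs the four elliptic terms into two equal pairs.
  have h1 : delta (compNorm E μ * (conj F ν * conj F ρ)) = delta (compNorm E μ * (ν * ρ)) := by
    rw [← conj_mul, delta_compNorm_mul_conj b]
  have h2 : delta (compNorm E μ * (conj F ν * ρ)) = delta (compNorm E μ * (ν * conj F ρ)) := by
    rw [← delta_compNorm_mul_conj b, conj_mul, conj_conj b]
  rw [triple_eq_avg, (((hasTable_steinberg b μ).mul (hasTable_cuspidal b hψ hν)).mul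
    (hasTable_cuspidal b hψ hρ)).avg_eq hψ]
  simp only [add_mul, mul_add, neg_mul, mul_neg, neg_neg, toFun_mul_toFun, avgSplit_zero,
    avgUnits_add, avgUnits_neg, avgUnits_toFun, zero_mul, mul_zero, neg_add, neg_zero]
  simp only [char_sq, char_mul_comm, char_mul_left_comm] at h1 h2 ⊢
  rw [h1, h2]
  field_simp
  ring

theorem triple_cuspidal_cuspidal_cuspidal {μ ν ρ : Eˣ →* ℂˣ}
    (hμ : Primitive F μ) (hν : Primitive F ν) (hρ : Primitive F ρ) :
    triple (cuspidal b ψ μ) (cuspidal b ψ ν) (cuspidal b ψ ρ) =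
      delta (res F μ * res F ν * res F ρ)
        - (delta (μ * ν * ρ) + delta (conj F μ * ν * ρ) + delta (μ * conj F ν * ρ)
          + delta (μ * ν * conj F ρ)) := by
  classical
  have hq0 := card_cast_ne_zero (F := F)
  have hq1 := card_cast_sub_one_ne_zero (F := F)
  have hq2 := card_cast_add_one_ne_zero (F := F)
  -- Simultaneous conjugation pairs the eight elliptic terms into four equal pairs, cancelling the
  -- factor `1/2`.
  have h1 : delta (conj F μ * conj F ν * conj F ρ) = delta (μ * ν * ρ) := by
    rw [← conj_mul, ← conj_mul, delta_conj b]
  have h2 : delta (μ * conj F ν * conj F ρ) = delta (conj F μ * ν * ρ) := by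
    rw [← delta_conj b, conj_mul, conj_mul, conj_conj b, conj_conj b]
  have h3 : delta (conj F μ * ν * conj F ρ) = delta (μ * conj F ν * ρ) := by
    rw [← delta_conj b, conj_mul, conj_mul, conj_conj b, conj_conj b]
  have h4 : delta (conj F μ * conj F ν * ρ) = delta (μ * ν * conj F ρ) := by
    rw [← delta_conj b, conj_mul, conj_mul, conj_conj b, conj_conj b]
  rw [triple_eq_avg, (((hasTable_cuspidal b hψ hμ).mul (hasTable_cuspidal b hψ hν)).mul
    (hasTable_cuspidal b hψ hρ)).avg_eq hψ]
  simp only [add_mul, mul_add, neg_mul, mul_neg, neg_neg, toFun_mul_toFun, avgSplit_zero,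
    avgUnits_add, avgUnits_neg, avgUnits_toFun, mul_zero, neg_add]
  simp only [char_mul_comm, char_mul_left_comm] at h1 h2 h3 h4 ⊢
  rw [h1, h2, h3, h4]
  field_simp
  ring

theorem pairing_oneDim_oneDim (μ ν : Fˣ →* ℂˣ) :
    pairing (oneDim μ) (oneDim ν) = delta (μ * ν) := by
  classical
  have hq0 := card_cast_ne_zero (F := F)
  have hq1 := card_cast_sub_one_ne_zero (F := F)
  have hq2 := card_cast_add_one_ne_zero (F := F)
  rw [pairing_eq_avg, ((hasTable_oneDim b μ).mul (hasTable_oneDim b ν)).avg_eq hψ]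
  simp only [mul_add, mono_mul_mono, toFun_mul_toFun, avgSplit_mono, avgUnits_toFun,
    ← compNorm_mul, delta_compNorm, delta_mul_self]
  simp only [char_mul_comm, char_mul_left_comm]
  field_simp
  ring

theorem pairing_principal_principal (μ₁ μ₂ ν₁ ν₂ : Fˣ →* ℂˣ) :
    pairing (principal μ₁ μ₂) (principal ν₁ ν₂) =
      delta (μ₁ * ν₁) * delta (μ₂ * ν₂) + delta (μ₁ * ν₂) * delta (μ₂ * ν₁) := by
  classical
  have hq0 := card_cast_ne_zero (F := F)
  have hq1 := card_cast_sub_one_ne_zero (F := F)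
  have hq2 := card_cast_add_one_ne_zero (F := F)
  rw [pairing_eq_avg, ((hasTable_principal b μ₁ μ₂).mul (hasTable_principal b ν₁ ν₂)).avg_eq hψ]
  simp only [add_mul, mul_add, mono_mul_mono, avgSplit_add, avgSplit_mono, avgUnits_zero, mul_zero]
  simp only [char_mul_comm, char_mul_left_comm]
  field_simp
  ring

theorem pairing_steinberg_steinberg (μ ν : Fˣ →* ℂˣ) :
    pairing (steinberg μ) (steinberg ν) = delta (μ * ν) := by
  classical
  have hq0 := card_cast_ne_zero (F := F)
  have hq1 := card_cast_sub_one_ne_zero (F := F)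
  have hq2 := card_cast_add_one_ne_zero (F := F)
  rw [pairing_eq_avg, ((hasTable_steinberg b μ).mul (hasTable_steinberg b ν)).avg_eq hψ]
  simp only [mul_add, neg_mul, mul_neg, neg_neg, mono_mul_mono, toFun_mul_toFun, avgSplit_mono,
    avgUnits_toFun, mul_zero, ← compNorm_mul, delta_compNorm, delta_mul_self]
  simp only [char_mul_comm, char_mul_left_comm]
  field_simp
  ring

theorem pairing_cuspidal_cuspidal {ν ρ : Eˣ →* ℂˣ} (hν : Primitive F ν) (hρ : Primitive F ρ) :
    pairing (cuspidal b ψ ν) (cuspidal b ψ ρ) =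
      delta (ν * ρ) + delta (ν * conj F ρ) := by
  classical
  have hq0 := card_cast_ne_zero (F := F)
  have hq1 := card_cast_sub_one_ne_zero (F := F)
  have hq2 := card_cast_add_one_ne_zero (F := F)
  have h1 : delta (conj F ν * conj F ρ) = delta (ν * ρ) := by
    rw [← conj_mul, delta_conj b]
  have h2 : delta (conj F ν * ρ) = delta (ν * conj F ρ) := by
    rw [← delta_conj b, conj_mul, conj_conj b]
  rw [pairing_eq_avg, ((hasTable_cuspidal b hψ hν).mul (hasTable_cuspidal b hψ hρ)).avg_eq hψ]
  simp only [add_mul, mul_add, neg_mul, mul_neg, neg_neg, toFun_mul_toFun, avgSplit_zero,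
    avgUnits_add, avgUnits_toFun, mul_zero, neg_add]
  simp only [char_mul_comm] at h1 h2 ⊢
  rw [h1, h2]
  field_simp
  ring

theorem pairing_oneDim_principal (μ ν₁ ν₂ : Fˣ →* ℂˣ) (h : ν₁ ≠ ν₂) :
    pairing (oneDim μ) (principal ν₁ ν₂) = 0 := by
  classical
  have hq0 := card_cast_ne_zero (F := F)
  have hq1 := card_cast_sub_one_ne_zero (F := F)
  have hq2 := card_cast_add_one_ne_zero (F := F)
  rw [pairing_eq_avg, ((hasTable_oneDim b μ).mul (hasTable_principal b ν₁ ν₂)).avg_eq hψ]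
  simp only [mul_add, mono_mul_mono, avgSplit_add, avgSplit_mono, avgUnits_zero, mul_zero,
    delta_mul_delta_eq_zero μ h, delta_mul_delta_eq_zero μ h.symm]
  simp only [char_mul_comm, char_mul_left_comm]
  field_simp
  ring

theorem pairing_oneDim_steinberg (μ ν : Fˣ →* ℂˣ) :
    pairing (oneDim μ) (steinberg ν) = 0 := by
  classical
  have hq0 := card_cast_ne_zero (F := F)
  have hq1 := card_cast_sub_one_ne_zero (F := F)
  have hq2 := card_cast_add_one_ne_zero (F := F)
  rw [pairing_eq_avg, ((hasTable_oneDim b μ).mul (hasTable_steinberg b ν)).avg_eq hψ]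
  simp only [mul_add, mul_neg, mono_mul_mono, toFun_mul_toFun, avgSplit_mono, avgUnits_neg,
    avgUnits_toFun, mul_zero, ← compNorm_mul, delta_compNorm, delta_mul_self]
  simp only [char_mul_comm, char_mul_left_comm]
  field_simp
  ring

theorem pairing_oneDim_cuspidal (μ : Fˣ →* ℂˣ) {ρ : Eˣ →* ℂˣ} (hρ : Primitive F ρ) :
    pairing (oneDim μ) (cuspidal b ψ ρ) = 0 := by
  classical
  have hq0 := card_cast_ne_zero (F := F)
  have hq1 := card_cast_sub_one_ne_zero (F := F)
  have hq2 := card_cast_add_one_ne_zero (F := F)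
  rw [pairing_eq_avg, ((hasTable_oneDim b μ).mul (hasTable_cuspidal b hψ hρ)).avg_eq hψ]
  simp only [mul_add, mul_neg, toFun_mul_toFun, avgSplit_zero, avgUnits_add, avgUnits_neg,
    avgUnits_toFun, mul_zero, neg_add, neg_zero, delta_compNorm_mul_conj b,
    delta_compNorm_mul_primitive hρ]
  simp only [char_mul_comm, char_mul_left_comm]
  field_simp
  ring

theorem pairing_principal_steinberg (μ₁ μ₂ ν : Fˣ →* ℂˣ) (h : μ₁ ≠ μ₂) :
    pairing (principal μ₁ μ₂) (steinberg ν) = 0 := by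
  classical
  have hq0 := card_cast_ne_zero (F := F)
  have hq1 := card_cast_sub_one_ne_zero (F := F)
  have hq2 := card_cast_add_one_ne_zero (F := F)
  rw [pairing_eq_avg, ((hasTable_principal b μ₁ μ₂).mul (hasTable_steinberg b ν)).avg_eq hψ]
  simp only [add_mul, mul_add, mul_neg, mono_mul_mono, avgSplit_add, avgSplit_mono, avgUnits_zero,
    zero_mul, mul_zero, neg_zero, char_mul_comm _ ν, delta_mul_delta_eq_zero ν h,
    delta_mul_delta_eq_zero ν h.symm]
  simp only [char_mul_comm, char_mul_left_comm]
  field_simp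
  ring

theorem pairing_principal_cuspidal (μ₁ μ₂ : Fˣ →* ℂˣ) {ρ : Eˣ →* ℂˣ} (hρ : Primitive F ρ) :
    pairing (principal μ₁ μ₂) (cuspidal b ψ ρ) = 0 := by
  classical
  have hq0 := card_cast_ne_zero (F := F)
  have hq1 := card_cast_sub_one_ne_zero (F := F)
  have hq2 := card_cast_add_one_ne_zero (F := F)
  rw [pairing_eq_avg, ((hasTable_principal b μ₁ μ₂).mul (hasTable_cuspidal b hψ hρ)).avg_eq hψ]
  simp only [add_mul, mul_add, mul_neg, avgSplit_zero, avgUnits_add, avgUnits_zero, zero_mul,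
    mul_zero, neg_add, neg_zero]
  simp only [char_mul_comm, char_mul_left_comm]
  field_simp
  ring

theorem pairing_steinberg_cuspidal (μ : Fˣ →* ℂˣ) {ρ : Eˣ →* ℂˣ} (hρ : Primitive F ρ) :
    pairing (steinberg μ) (cuspidal b ψ ρ) = 0 := by
  classical
  have hq0 := card_cast_ne_zero (F := F)
  have hq1 := card_cast_sub_one_ne_zero (F := F)
  have hq2 := card_cast_add_one_ne_zero (F := F)
  rw [pairing_eq_avg, ((hasTable_steinberg b μ).mul (hasTable_cuspidal b hψ hρ)).avg_eq hψ]
  simp only [mul_add, neg_mul, mul_neg, neg_neg, toFun_mul_toFun, avgSplit_zero, avgUnits_add,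
    avgUnits_toFun, zero_mul, mul_zero, neg_add, neg_zero, delta_compNorm_mul_conj b,
    delta_compNorm_mul_primitive hρ]
  simp only [char_mul_comm, char_mul_left_comm]
  field_simp
  ring

/-- The number is a multiplicity, hence a natural number, and it is at most the leading delta. -/
theorem triple_steinberg_cuspidal_cuspidal_mem (μ : Fˣ →* ℂˣ) {ν ρ : Eˣ →* ℂˣ}
    (hν : Primitive F ν) (hρ : Primitive F ρ) :
    triple (steinberg μ) (cuspidal b ψ ν) (cuspidal b ψ ρ) = 0 ∨
      triple (steinberg μ) (cuspidal b ψ ν) (cuspidal b ψ ρ) = 1 := by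
  have h := triple_steinberg_cuspidal_cuspidal b hψ μ hν hρ
  rw [triple_eq_finrank] at h ⊢
  obtain ⟨k₁, h₁, e₁⟩ := exists_delta_eq_natCast (μ ^ 2 * res F ν * res F ρ)
  obtain ⟨k₂, -, e₂⟩ := exists_delta_eq_natCast (compNorm E μ * ν * ρ)
  obtain ⟨k₃, -, e₃⟩ := exists_delta_eq_natCast (compNorm E μ * ν * conj F ρ)
  rw [e₁, e₂, e₃, sub_sub, eq_sub_iff_add_eq] at h
  norm_cast at h ⊢
  omega

theorem triple_cuspidal_cuspidal_cuspidal_mem {μ ν ρ : Eˣ →* ℂˣ} (hμ : Primitive F μ)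
    (hν : Primitive F ν) (hρ : Primitive F ρ) :
    triple (cuspidal b ψ μ) (cuspidal b ψ ν) (cuspidal b ψ ρ) = 0 ∨
      triple (cuspidal b ψ μ) (cuspidal b ψ ν) (cuspidal b ψ ρ) = 1 := by
  have h := triple_cuspidal_cuspidal_cuspidal b hψ hμ hν hρ
  rw [triple_eq_finrank] at h ⊢
  obtain ⟨k₁, h₁, e₁⟩ := exists_delta_eq_natCast (res F μ * res F ν * res F ρ)
  obtain ⟨k₂, -, e₂⟩ := exists_delta_eq_natCast (μ * ν * ρ)
  obtain ⟨k₃, -, e₃⟩ := exists_delta_eq_natCast (conj F μ * ν * ρ)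
  obtain ⟨k₄, -, e₄⟩ := exists_delta_eq_natCast (μ * conj F ν * ρ)
  obtain ⟨k₅, -, e₅⟩ := exists_delta_eq_natCast (μ * ν * conj F ρ)
  rw [e₁, e₂, e₃, e₄, e₅, eq_sub_iff_add_eq] at h
  norm_cast at h ⊢
  omega

end Tables

/-! ### Twists, contragredients and irreducibility. -/

section Isomorphisms

open Representation

variable {F E : Type*} [Field F] [Fintype F] [DecidableEq F] [Field E] [Fintype E] [Algebra F E]
  (b : Module.Basis (Fin 2) F E)

theorem charInner_self_eq_pairing {G : Type*} [Group G] [Fintype G] {V W : Type*} [AddCommGroup V]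
    [Module ℂ V] [FiniteDimensional ℂ V] [AddCommGroup W] [Module ℂ W]
    {π : Representation ℂ G V} {π' : Representation ℂ G W}
    (h : π.dual.character = π'.character) :
    charInner π.character π.character = pairing π π' := by
  rw [← pairing_dual, pairing_eq_avg, pairing_eq_avg, h]

omit [Fintype F] [DecidableEq F] in
theorem character_dual_eq {V : Type*} [AddCommGroup V] [Module ℂ V] [FiniteDimensional ℂ V]
    (π : Representation ℂ (GL (Fin 2) F) V) : π.dual.character = fun g => π.character g⁻¹ :=
  funext fun _ => char_dual _ _

omit [Fintype F] [DecidableEq F] in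
theorem oneDim_mul_character (μ ν : Fˣ →* ℂˣ) :
    (oneDim μ).character * (oneDim ν).character = (oneDim (μ * ν)).character := by
  ext g
  simp [character_oneDim]

omit [Fintype F] [DecidableEq F] in
theorem oneDim_dual_character (μ : Fˣ →* ℂˣ) :
    (oneDim μ).dual.character = (oneDim μ⁻¹).character := by
  ext g
  simp [character_oneDim]

omit [Fintype F] [DecidableEq F] in
theorem mono_inv (μ₁ μ₂ : Fˣ →* ℂˣ) : (fun a e => mono μ₁ μ₂ a⁻¹ e⁻¹) = mono μ₁⁻¹ μ₂⁻¹ := by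
  ext a e
  simp [mono]

include b in
theorem oneDim_mul_principal_character (μ ν ρ : Fˣ →* ℂˣ) :
    (oneDim μ).character * (principal ν ρ).character =
      (principal (μ * ν) (μ * ρ)).character := by
  refine ((hasTable_oneDim b μ).mul (hasTable_principal b ν ρ)).unique
    ((hasTable_principal b (μ * ν) (μ * ρ)).congr ?_ ?_ ?_ rfl rfl ?_ ?_)
  · simp only [char_mul_comm, char_mul_left_comm]
  · ring
  · ring
  · rw [mul_add, mono_mul_mono, mono_mul_mono]
  · ring

include b in
theorem principal_dual_character (μ₁ μ₂ : Fˣ →* ℂˣ) :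
    (principal μ₁ μ₂).dual.character = (principal μ₁⁻¹ μ₂⁻¹).character := by
  rw [character_dual_eq]
  refine (hasTable_principal b μ₁ μ₂).inv.unique
    ((hasTable_principal b μ₁⁻¹ μ₂⁻¹).congr (char_mul_inv _ _).symm rfl rfl rfl rfl ?_ rfl)
  rw [← mono_inv, ← mono_inv]
  rfl

include b in
theorem oneDim_mul_steinberg_character (μ ν : Fˣ →* ℂˣ) :
    (oneDim μ).character * (steinberg ν).character = (steinberg (μ * ν)).character := by
  rw [character_steinberg, character_steinberg, mul_sub, oneDim_mul_character,
    oneDim_mul_principal_character b]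

include b in
theorem steinberg_dual_character (μ : Fˣ →* ℂˣ) :
    (steinberg μ).dual.character = (steinberg μ⁻¹).character := by
  rw [character_dual_eq, character_steinberg, character_steinberg, ← oneDim_dual_character,
    ← principal_dual_character b, character_dual_eq, character_dual_eq]
  rfl

theorem oneDim_mul_cuspidal_character {ψ : AddChar F ℂ} (hψ : ψ ≠ 1) (μ : Fˣ →* ℂˣ)
    {ν : Eˣ →* ℂˣ} (hν : Primitive F ν) :
    (oneDim μ).character * (cuspidal b ψ ν).character =
      (cuspidal b ψ (compNorm E μ * ν)).character := by
  refine ((hasTable_oneDim b μ).mul (hasTable_cuspidal b hψ hν)).unique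
    ((hasTable_cuspidal b hψ (hν.compNorm_mul μ)).congr ?_ ?_ ?_ rfl rfl ?_ ?_)
  · rw [res_mul, res_compNorm b]
  · ring
  · ring
  · ring
  · rw [mul_neg, mul_add, toFun_mul_toFun, toFun_mul_toFun, conj_mul, conj_compNorm]

theorem cuspidal_dual_character {ψ : AddChar F ℂ} (hψ : ψ ≠ 1) {ν : Eˣ →* ℂˣ}
    (hν : Primitive F ν) : (cuspidal b ψ ν).dual.character = (cuspidal b ψ ν⁻¹).character := by
  rw [character_dual_eq]
  refine (hasTable_cuspidal b hψ hν).inv.unique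
    ((hasTable_cuspidal b hψ hν.inv).congr rfl rfl rfl rfl rfl rfl ?_)
  rw [conj_inv, ← toFun_inv, ← toFun_inv]
  rfl

theorem nonempty_equiv_tprod {V W X : Type*} [AddCommGroup V] [Module ℂ V]
    [FiniteDimensional ℂ V] [AddCommGroup W] [Module ℂ W] [FiniteDimensional ℂ W]
    [AddCommGroup X] [Module ℂ X] [FiniteDimensional ℂ X]
    {π : Representation ℂ (GL (Fin 2) F) V} {π' : Representation ℂ (GL (Fin 2) F) W}
    {π'' : Representation ℂ (GL (Fin 2) F) X}
    (h : π.character * π'.character = π''.character) : Nonempty ((π.tprod π').Equiv π'') :=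
  nonempty_equiv_of_character_eq ((char_tensor π π').trans h)

theorem triple_oneDim {V W : Type*} [AddCommGroup V] [Module ℂ V] [FiniteDimensional ℂ V]
    [AddCommGroup W] [Module ℂ W] [FiniteDimensional ℂ W]
    (π : Representation ℂ (GL (Fin 2) F) V) (π' : Representation ℂ (GL (Fin 2) F) W)
    (μ : Fˣ →* ℂˣ) : triple π π' (oneDim μ) = pairing π ((oneDim μ).tprod π') := by
  rw [triple_eq_avg, pairing_eq_avg, char_tensor, mul_assoc, mul_comm (oneDim μ).character]

variable {ψ : AddChar F ℂ} (hψ : ψ ≠ 1)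
include b hψ

theorem isIrreducible_oneDim (μ : Fˣ →* ℂˣ) : (oneDim μ).IsIrreducible := by
  apply isIrreducible_of_charInner_self
  rw [charInner_self_eq_pairing (oneDim_dual_character μ), pairing_oneDim_oneDim b hψ,
    char_mul_inv_cancel, delta_one]

theorem isIrreducible_steinberg (μ : Fˣ →* ℂˣ) : (steinberg μ).IsIrreducible := by
  apply isIrreducible_of_charInner_self
  rw [charInner_self_eq_pairing (steinberg_dual_character b μ), pairing_steinberg_steinberg b hψ,
    char_mul_inv_cancel, delta_one]

theorem isIrreducible_principal_iff (μ₁ μ₂ : Fˣ →* ℂˣ) :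
    (principal μ₁ μ₂).IsIrreducible ↔ μ₁ ≠ μ₂ := by
  rw [isIrreducible_iff_charInner_self,
    charInner_self_eq_pairing (principal_dual_character b μ₁ μ₂),
    pairing_principal_principal b hψ, char_mul_inv_cancel, char_mul_inv_cancel, delta_one]
  constructor
  · rintro h rfl
    rw [char_mul_inv_cancel, delta_one] at h
    norm_num at h
  · intro h
    rw [delta_of_ne fun h' => h (char_mul_inv_eq_one.1 h')]
    norm_num

end Isomorphisms

/-! ### Completeness of the list of irreducible representations. -/

section Completeness

open Representation

variable {F E : Type*} [Field F] [Fintype F] [DecidableEq F] [Field E] [Fintype E] [Algebra F E]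
  (b : Module.Basis (Fin 2) F E) {ψ : AddChar F ℂ} (hψ : ψ ≠ 1)
include b hψ

/-- A class function orthogonal to the principal series and to the differences
`Ind_{ZN} ν_ψ - Ind_{Eˣ} ν` vanishes at `1`. -/
theorem apply_one_eq_zero_of_avg {f : GL (Fin 2) F → ℂ} (hf : ∀ x g, f (x * g * x⁻¹) = f g)
    (h₁ : ∀ μ₁ μ₂ : Fˣ →* ℂˣ, avg ((principal μ₁ μ₂).character * f) = 0)
    (h₂ : ∀ ν : Eˣ →* ℂˣ, avg (((centerUnipotentInd ψ ν).character -
      (torusInd b ν).character) * f) = 0) : f 1 = 0 := by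
  classical
  have hq0 := card_cast_ne_zero (F := F)
  have hq1 := card_cast_sub_one_ne_zero (F := F)
  have hq2 := card_cast_add_one_ne_zero (F := F)
  have hu : ∀ x : F, x ≠ 0 → f (upper 1 1 x) = f (upper 1 1 1) := fun x hx => by
    obtain ⟨y, hy⟩ := isConj_iff.1 (isConj_upper_self (F := F) 1 hx one_ne_zero)
    rw [← hy, hf]
  -- Fourier inversion in both diagonal variables shows that the sum of `f` over each coset of the
  -- unipotent group vanishes; this is the coset of 1.
  have e₁ : f 1 + (Fintype.card F - 1) * f (upper 1 1 1) = 0 := by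
    have h : ∑ x, f (upper 1 1 x) = 0 :=
      eq_zero_of_fourier (fun d => ∑ x, f (upper 1 d x)) (fun μ₂ =>
        eq_zero_of_fourier (fun a => ∑ d, (μ₂ d : ℂ) * ∑ x, f (upper a d x)) (fun μ₁ => by
          have := h₁ μ₁ μ₂
          rw [avg_principal_mul _ _ hf, mul_eq_zero] at this
          exact this.resolve_left (inv_ne_zero (mul_ne_zero hq0 (pow_ne_zero 2 hq1)))) 1) 1
    rw [← Finset.add_sum_erase _ _ (Finset.mem_univ (0 : F)), upper_one_one_zero,
      Finset.sum_congr rfl fun x hx => hu x (Finset.ne_of_mem_erase hx), Finset.sum_const,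
      Finset.card_erase_of_mem (Finset.mem_univ _), Finset.card_univ, nsmul_eq_mul,
      Nat.cast_sub Fintype.card_pos, Nat.cast_one] at h
    exact h
  have e₂ : ((Fintype.card F : ℂ) * (Fintype.card F - 1))⁻¹ * (f 1 - f (upper 1 1 1)) -
      ((Fintype.card F : ℂ) ^ 2 - 1)⁻¹ * f 1 = 0 := by
    let k : Fˣ → ℂ := fun a => ∑ x, ψ x * f (upper a a (a * x))
    have hk : k 1 = f 1 - f (upper 1 1 1) := by
      have := sum_addChar_mul hψ (fun x => f (upper 1 1 x)) _ hu
      rw [upper_one_one_zero] at this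
      simpa only [k, Units.val_one, one_mul] using this
    -- Extending by zero rewrites the sum over the centre as a sum over `Eˣ`, so that one Fourier
    -- inversion on `Eˣ` handles both terms.
    let K : Eˣ → ℂ := Function.extend (unitsIncl F E) k 0
    have hK : ∀ a, K (unitsIncl F E a) = k a := unitsIncl_injective.extend_apply _ _
    have h := eq_zero_of_fourier (fun w => ((Fintype.card F : ℂ) * (Fintype.card F - 1))⁻¹ * K w -
      ((Fintype.card F : ℂ) ^ 2 - 1)⁻¹ * f (torus b w)) (fun ν => by
        have h := h₂ ν
        rw [sub_mul, avg, Finset.sum_congr rfl fun g _ => Pi.sub_apply _ _ g,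
          Finset.sum_sub_distrib, mul_sub, ← avg, ← avg, avg_centerUnipotentInd_mul _ _ hf,
          avg_torusInd_mul _ _ hf] at h
        rw [← h]
        have hs : ∑ a, (res F ν a : ℂ) * k a = ∑ w, (ν w : ℂ) * K w := by
          rw [sum_eq_sum_range_of_forall (unitsIncl_injective (F := F) (E := E))
            fun w => (ν w : ℂ) * K w]
          · simp only [hK]
            rfl
          · intro w hw
            rw [show K w = 0 from Function.extend_apply' _ _ _ hw, mul_zero]
        change _ = _ * ∑ a, (res F ν a : ℂ) * k a - _
        rw [hs, Finset.mul_sum, Finset.mul_sum, ← Finset.sum_sub_distrib]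
        refine Finset.sum_congr rfl fun w _ => ?_
        ring) 1
    simp only [map_one] at h
    rw [← hk, ← h, ← hK, map_one]
  have h3 : (Fintype.card F : ℂ) ^ 2 - 1 = (Fintype.card F - 1) * (Fintype.card F + 1) := by ring
  rw [h3] at e₂
  field_simp at e₂
  -- `e₁` and `e₂` are independent linear equations in `f 1` and `f (upper 1 1 1)`; this combination
  -- eliminates the latter.
  have e₃ : 2 * (Fintype.card F : ℂ) * f 1 = 0 := by
    linear_combination (Fintype.card F - 1) * e₂ + (Fintype.card F + 1) * e₁
  simpa [hq0] using e₃

theorem exists_equiv_of_isIrreducible {V : Type*} [AddCommGroup V] [Module ℂ V]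
    [FiniteDimensional ℂ V] (π : Representation ℂ (GL (Fin 2) F) V) (hπ : π.IsIrreducible) :
    (∃ μ : Fˣ →* ℂˣ, Nonempty (π.Equiv (oneDim μ))) ∨
      (∃ μ₁ μ₂ : Fˣ →* ℂˣ, μ₁ ≠ μ₂ ∧ Nonempty (π.Equiv (principal μ₁ μ₂))) ∨
      (∃ μ : Fˣ →* ℂˣ, Nonempty (π.Equiv (steinberg μ))) ∨
      (∃ ν : Eˣ →* ℂˣ, Primitive F ν ∧ Nonempty (π.Equiv (cuspidal b ψ ν))) := by
  by_contra hne
  push Not at hne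
  obtain ⟨h₁, h₂, h₃, h₄⟩ := hne
  have hone : ∀ μ, charInner (oneDim μ).character π.character = 0 := fun μ => by
    rw [charInner_comm]
    exact charInner_eq_zero_of_isEmpty hπ (isIrreducible_oneDim b hψ μ)
      (not_nonempty_iff.2 (h₁ μ))
  have hst : ∀ μ, charInner (steinberg μ).character π.character = 0 := fun μ => by
    rw [charInner_comm]
    exact charInner_eq_zero_of_isEmpty hπ (isIrreducible_steinberg b hψ μ)
      (not_nonempty_iff.2 (h₃ μ))
  have hpr : ∀ μ₁ μ₂, charInner (principal μ₁ μ₂).character π.character = 0 := fun μ₁ μ₂ => by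
    by_cases h : μ₁ = μ₂
    · subst h
      -- The reducible `I(μ, μ)` has the character of `St_μ` plus `χ_μ`, both already orthogonal to
      -- `π`.
      rw [← sub_add_cancel (principal μ₁ μ₁).character (oneDim μ₁).character,
        ← character_steinberg, charInner_add_left, hone, hst, add_zero]
    · rw [charInner_comm]
      exact charInner_eq_zero_of_isEmpty hπ ((isIrreducible_principal_iff b hψ _ _).2 h)
        (not_nonempty_iff.2 (h₂ _ _ h))
  have hcu : ∀ ν, charInner ((centerUnipotentInd ψ ν).character - (torusInd b ν).character)
      π.character = 0 := fun ν => by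
    by_cases h : Primitive F ν
    · rw [← character_cuspidal b hψ h, charInner_comm]
      exact charInner_eq_zero_of_isEmpty hπ (isIrreducible_cuspidal b hψ h)
        (not_nonempty_iff.2 (h₄ _ h))
    · unfold Primitive at h
      push Not at h
      obtain ⟨μ, rfl⟩ := h
      -- For a character that is not primitive the difference involves nothing new: the tables
      -- coincide.
      have e : (centerUnipotentInd ψ (compNorm E μ)).character -
          (torusInd b (compNorm E μ)).character =
          (steinberg μ).character - (oneDim μ).character := by
        refine (hasTable_sub b hψ (compNorm E μ)).unique
          (((hasTable_steinberg b μ).sub (hasTable_oneDim b μ)).congr (res_compNorm b μ).symm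
            rfl ?_ rfl rfl ?_ ?_)
        · ring
        · ring
        · rw [conj_compNorm]
          ring
      rw [e, charInner_sub_left, hst, hone, sub_zero]
  have h := apply_one_eq_zero_of_avg b hψ (f := fun g => π.character g⁻¹)
    (fun x g => by rw [mul_inv_rev, mul_inv_rev, inv_inv, ← mul_assoc]; exact char_conj _ _ _)
    hpr hcu
  simp only [inv_one, char_one, Nat.cast_eq_zero] at h
  have := Module.finrank_zero_iff.1 h
  exact bot_ne_top (α := Subrepresentation π)
    (Subrepresentation.toSubmodule_injective (Subsingleton.elim _ _))

end Completeness

/-! ### Representations of `PGL(2, F)` and central characters. -/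

section Inflation

open Representation

/-- All fibres of a surjective homomorphism have the size of its kernel. -/
theorem avg_comp {G H : Type*} [Group G] [Group H] [Fintype G] [Fintype H] (φ : G →* H)
    (hφ : Function.Surjective φ) (f : H → ℂ) : avg (f ∘ φ) = avg f := by
  classical
  have key : ∀ k : H → ℂ, ∑ g, k (φ g) =
      ((Finset.univ.filter fun g => φ g = 1).card : ℂ) * ∑ h, k h := by
    intro k
    rw [← Finset.sum_fiberwise Finset.univ φ, Finset.mul_sum]
    refine Finset.sum_congr rfl fun h _ => ?_
    rw [Finset.sum_congr rfl fun g hg => by rw [(Finset.mem_filter.1 hg).2], Finset.sum_const,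
      nsmul_eq_mul, MonoidHom.card_fiber_eq_of_mem_range φ (hφ h) ⟨1, map_one φ⟩]
  have h1 := key fun _ => 1
  simp only [Finset.sum_const, Finset.card_univ, nsmul_eq_mul, mul_one] at h1
  have hG : (Fintype.card G : ℂ) ≠ 0 := by simp
  rw [h1] at hG
  rw [avg, avg, h1, mul_inv]
  simp only [Function.comp_apply, key]
  rw [mul_comm _ (Fintype.card H : ℂ)⁻¹, mul_assoc, inv_mul_cancel_left₀ (left_ne_zero_of_mul hG)]

variable {F : Type*} [Field F]

theorem triple_inflate [Fintype F] [DecidableEq F] [Fintype PGL(2, F)] {V W X : Type*}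
    [AddCommGroup V] [Module ℂ V] [AddCommGroup W] [Module ℂ W] [AddCommGroup X] [Module ℂ X]
    (π : Representation ℂ PGL(2, F) V) (π' : Representation ℂ PGL(2, F) W)
    (π'' : Representation ℂ PGL(2, F) X) :
    triple π π' π'' = triple (inflate π) (inflate π') (inflate π'') :=
  (avg_comp Matrix.ProjGenLinGroup.mk Matrix.ProjGenLinGroup.mk_surjective
    (π.character * π'.character * π''.character)).symm

theorem isIrreducible_inflate_iff [Fintype F] [DecidableEq F] [Fintype PGL(2, F)] {V : Type*}
    [AddCommGroup V] [Module ℂ V] [FiniteDimensional ℂ V] (π : Representation ℂ PGL(2, F) V) :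
    (inflate π).IsIrreducible ↔ π.IsIrreducible := by
  rw [isIrreducible_iff_charInner_self, isIrreducible_iff_charInner_self, charInner_eq_avg,
    charInner_eq_avg, ← avg_comp Matrix.ProjGenLinGroup.mk Matrix.ProjGenLinGroup.mk_surjective
    (π.character * fun g => π.character g⁻¹)]
  rfl

/-- A representation with central character `ω` is inflated from `PGL(2, F)` if and only if `ω` is
trivial. -/
theorem exists_inflate_eq_iff {V : Type*} [AddCommGroup V] [Module ℂ V] [Nontrivial V]
    {π : Representation ℂ (GL (Fin 2) F) V} {ω : Fˣ →* ℂˣ}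
    (h : ∀ a, π (Matrix.GeneralLinearGroup.scalar (Fin 2) a) = (ω a : ℂ) • LinearMap.id) :
    (∃ σ, inflate σ = π) ↔ ω = 1 := by
  constructor
  · rintro ⟨σ, rfl⟩
    ext a
    obtain ⟨v, hv⟩ := exists_ne (0 : V)
    have h1 := LinearMap.congr_fun (h a) v
    rw [MonoidHom.comp_apply, Matrix.ProjGenLinGroup.mk_scalar, map_one] at h1
    have h2 : (1 - (ω a : ℂ)) • v = 0 := by
      rw [sub_smul, one_smul, sub_eq_zero]
      exact h1
    exact (sub_eq_zero.1 ((smul_eq_zero.1 h2).resolve_right hv)).symm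
  · rintro rfl
    refine ⟨Matrix.ProjGenLinGroup.lift π (MonoidHom.ext fun a => ?_),
      Matrix.ProjGenLinGroup.lift_comp_mk _⟩
    rw [MonoidHom.comp_apply, h a, MonoidHom.one_apply, Units.val_one, one_smul]
    rfl

theorem induced_apply_of_central {G K : Type*} [Group G] [Group K] (φ : K →* G) (χ : K →* ℂ)
    (k : K) (hk : ∀ g, g * φ k = φ k * g) :
    induced φ χ (φ k) = χ k • LinearMap.id := by
  refine LinearMap.ext fun f => Subtype.ext (funext fun g => ?_)
  change f.1 (g * φ k) = χ k * f.1 g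
  rw [hk]
  exact f.2 k g

theorem scalar_comm (a : Fˣ) (g : GL (Fin 2) F) :
    g * upper a a 0 = upper a a 0 * g := by
  rw [upper_self_zero_comm]

theorem oneDim_scalar (μ : Fˣ →* ℂˣ) (a : Fˣ) :
    oneDim μ (Matrix.GeneralLinearGroup.scalar (Fin 2) a) =
      (((μ * μ) a : ℂˣ) : ℂ) • LinearMap.id := by
  rw [scalar_eq_upper]
  change (μ (Matrix.GeneralLinearGroup.det (upper a a 0)) : ℂ) • (LinearMap.id : ℂ →ₗ[ℂ] ℂ) = _
  rw [det_upper, map_mul]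
  rfl

theorem principal_scalar (μ₁ μ₂ : Fˣ →* ℂˣ) (a : Fˣ) :
    principal μ₁ μ₂ (Matrix.GeneralLinearGroup.scalar (Fin 2) a) =
      (((μ₁ * μ₂) a : ℂˣ) : ℂ) • LinearMap.id := by
  rw [scalar_eq_upper]
  refine (induced_apply_of_central (borel F).subtype (borelChar μ₁ μ₂)
    ⟨upper a a 0, upper_mem_borel _ _ _⟩ (scalar_comm a)).trans ?_
  rw [borelChar_upper]
  rfl

theorem steinberg_scalar (μ : Fˣ →* ℂˣ) (a : Fˣ) :
    steinberg μ (Matrix.GeneralLinearGroup.scalar (Fin 2) a) =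
      (((μ * μ) a : ℂˣ) : ℂ) • LinearMap.id := by
  refine Submodule.linearMap_qext _ (LinearMap.ext fun f => ?_)
  exact congrArg (Submodule.Quotient.mk)
    (LinearMap.congr_fun (principal_scalar μ μ a) f)

variable {E : Type*} [Field E] [Algebra F E]

theorem centerUnipotentInd_scalar (ψ : AddChar F ℂ) (ν : Eˣ →* ℂˣ) (a : Fˣ) :
    centerUnipotentInd ψ ν (Matrix.GeneralLinearGroup.scalar (Fin 2) a) =
      ((res F ν a : ℂˣ) : ℂ) • LinearMap.id := by
  have h := centerUnipotent_apply a (0 : F)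
  rw [mul_zero] at h
  have h1 := induced_apply_of_central (centerUnipotent F) (centerUnipotentChar ψ ν)
    (a, Multiplicative.ofAdd 0) fun g => by rw [h, scalar_comm]
  rw [h, centerUnipotentChar_apply, AddChar.map_zero_eq_one, mul_one] at h1
  rw [scalar_eq_upper]
  exact h1

theorem cuspidal_scalar (b : Module.Basis (Fin 2) F E) (ψ : AddChar F ℂ) (ν : Eˣ →* ℂˣ) (a : Fˣ) :
    cuspidal b ψ ν (Matrix.GeneralLinearGroup.scalar (Fin 2) a) =
      ((res F ν a : ℂˣ) : ℂ) • LinearMap.id :=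
  LinearMap.ext fun f => Subtype.ext (LinearMap.congr_fun (centerUnipotentInd_scalar ψ ν a) f.1)

/-- At the identity the table gives `z` as the dimension. A nonzero space is what allows the central
character to be recovered in `exists_inflate_eq_iff`. -/
theorem HasTable.nontrivial {b : Module.Basis (Fin 2) F E} {V : Type*} [AddCommGroup V]
    [Module ℂ V] [FiniteDimensional ℂ V] {π : Representation ℂ (GL (Fin 2) F) V} {ω : Fˣ →* ℂˣ}
    {z u d t : ℂ} {D : Fˣ → Fˣ → ℂ} {T : Eˣ → ℂ} (h : HasTable b π.character ω z u d t D T)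
    (hz : z ≠ 0) : Nontrivial V := by
  have h1 := h.scalar 1
  rw [upper_one_one_zero, char_one, map_one, Units.val_one, mul_one] at h1
  refine Module.nontrivial_of_finrank_pos (R := ℂ) (Nat.pos_of_ne_zero fun h0 => hz ?_)
  rw [← h1, h0, Nat.cast_zero]

end Inflation

end GLTwo

end

/-! ### The proposition. -/

open GLTwo in
theorem mainTheorem10 {F E : Type*} [Field F] [Fintype F] [DecidableEq F] [Field E] [Algebra F E]
    [Fintype PGL(2, F)] (b : Module.Basis (Fin 2) F E) (ψ : AddChar F ℂ) (hψ : ψ ≠ 1) :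
    -- the complete table of triple products without one-dimensional representations
    (∀ μ₁ μ₂ ν₁ ν₂ ρ₁ ρ₂ : Fˣ →* ℂˣ,
      triple (principal μ₁ μ₂) (principal ν₁ ν₂) (principal ρ₁ ρ₂) =
        delta (μ₁ * ν₁ * ρ₁ * μ₂ * ν₂ * ρ₂)
        + delta (μ₁ * ν₁ * ρ₁) * delta (μ₂ * ν₂ * ρ₂)
        + delta (μ₂ * ν₁ * ρ₁) * delta (μ₁ * ν₂ * ρ₂)
        + delta (μ₁ * ν₂ * ρ₁) * delta (μ₂ * ν₁ * ρ₂)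
        + delta (μ₁ * ν₁ * ρ₂) * delta (μ₂ * ν₂ * ρ₁)) ∧
    (∀ μ₁ μ₂ ν₁ ν₂ ρ : Fˣ →* ℂˣ,
      triple (principal μ₁ μ₂) (principal ν₁ ν₂) (steinberg ρ) =
        delta (μ₁ * μ₂ * ν₁ * ν₂ * ρ ^ 2)
        + delta (μ₁ * ν₁ * ρ) * delta (μ₂ * ν₂ * ρ)
        + delta (μ₁ * ν₂ * ρ) * delta (μ₂ * ν₁ * ρ)) ∧
    (∀ (μ₁ μ₂ ν₁ ν₂ : Fˣ →* ℂˣ) (ρ : Eˣ →* ℂˣ), Primitive F ρ →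
      triple (principal μ₁ μ₂) (principal ν₁ ν₂) (cuspidal b ψ ρ) =
        delta (μ₁ * μ₂ * ν₁ * ν₂ * res F ρ)) ∧
    (∀ μ₁ μ₂ ν ρ : Fˣ →* ℂˣ,
      triple (principal μ₁ μ₂) (steinberg ν) (steinberg ρ) =
        delta (μ₁ * μ₂ * ν ^ 2 * ρ ^ 2) + delta (μ₁ * ν * ρ) * delta (μ₂ * ν * ρ)) ∧
    (∀ μ ν ρ : Fˣ →* ℂˣ,
      triple (steinberg μ) (steinberg ν) (steinberg ρ) = delta (μ ^ 2 * ν ^ 2 * ρ ^ 2)) ∧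
    (∀ (μ₁ μ₂ ν : Fˣ →* ℂˣ) (ρ : Eˣ →* ℂˣ), Primitive F ρ →
      triple (principal μ₁ μ₂) (steinberg ν) (cuspidal b ψ ρ) =
        delta (μ₁ * μ₂ * ν ^ 2 * res F ρ)) ∧
    (∀ (μ₁ μ₂ : Fˣ →* ℂˣ) (ν ρ : Eˣ →* ℂˣ), Primitive F ν → Primitive F ρ →
      triple (principal μ₁ μ₂) (cuspidal b ψ ν) (cuspidal b ψ ρ) =
        delta (μ₁ * μ₂ * res F ν * res F ρ)) ∧
    (∀ (μ ν : Fˣ →* ℂˣ) (ρ : Eˣ →* ℂˣ), Primitive F ρ →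
      triple (steinberg μ) (steinberg ν) (cuspidal b ψ ρ) =
        delta (μ ^ 2 * ν ^ 2 * res F ρ)) ∧
    (∀ (μ : Fˣ →* ℂˣ) (ν ρ : Eˣ →* ℂˣ), Primitive F ν → Primitive F ρ →
      triple (steinberg μ) (cuspidal b ψ ν) (cuspidal b ψ ρ) =
        delta (μ ^ 2 * res F ν * res F ρ)
        - delta (compNorm E μ * ν * ρ) - delta (compNorm E μ * ν * conj F ρ) ∧
      (triple (steinberg μ) (cuspidal b ψ ν) (cuspidal b ψ ρ) = 0 ∨
        triple (steinberg μ) (cuspidal b ψ ν) (cuspidal b ψ ρ) = 1)) ∧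
    (∀ μ ν ρ : Eˣ →* ℂˣ, Primitive F μ → Primitive F ν → Primitive F ρ →
      triple (cuspidal b ψ μ) (cuspidal b ψ ν) (cuspidal b ψ ρ) =
        delta (res F μ * res F ν * res F ρ)
        - (delta (μ * ν * ρ) + delta (conj F μ * ν * ρ) + delta (μ * conj F ν * ρ)
          + delta (μ * ν * conj F ρ)) ∧
      (triple (cuspidal b ψ μ) (cuspidal b ψ ν) (cuspidal b ψ ρ) = 0 ∨
        triple (cuspidal b ψ μ) (cuspidal b ψ ν) (cuspidal b ψ ρ) = 1)) ∧
    -- twisting by one-dimensional representations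
    (∀ μ ν : Fˣ →* ℂˣ, Nonempty (((oneDim μ).tprod (oneDim ν)).Equiv (oneDim (μ * ν)))) ∧
    (∀ μ ν ρ : Fˣ →* ℂˣ,
      Nonempty (((oneDim μ).tprod (principal ν ρ)).Equiv (principal (μ * ν) (μ * ρ)))) ∧
    (∀ μ ν : Fˣ →* ℂˣ,
      Nonempty (((oneDim μ).tprod (steinberg ν)).Equiv (steinberg (μ * ν)))) ∧
    (∀ (μ : Fˣ →* ℂˣ) (ν : Eˣ →* ℂˣ), Primitive F ν → Primitive F (compNorm E μ * ν) ∧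
      Nonempty (((oneDim μ).tprod (cuspidal b ψ ν)).Equiv
        (cuspidal b ψ (compNorm E μ * ν)))) ∧
    -- triples with a one-dimensional representation reduce to pairs
    (∀ (V W : Type*) [AddCommGroup V] [Module ℂ V] [FiniteDimensional ℂ V]
      [AddCommGroup W] [Module ℂ W] [FiniteDimensional ℂ W]
      (π : Representation ℂ (GL (Fin 2) F) V) (π' : Representation ℂ (GL (Fin 2) F) W)
      (μ : Fˣ →* ℂˣ), triple π π' (oneDim μ) = pairing π ((oneDim μ).tprod π')) ∧
    -- the table of pairs
    (∀ μ ν : Fˣ →* ℂˣ, pairing (oneDim μ) (oneDim ν) = delta (μ * ν)) ∧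
    (∀ μ₁ μ₂ ν₁ ν₂ : Fˣ →* ℂˣ, pairing (principal μ₁ μ₂) (principal ν₁ ν₂) =
      delta (μ₁ * ν₁) * delta (μ₂ * ν₂) + delta (μ₁ * ν₂) * delta (μ₂ * ν₁)) ∧
    (∀ μ ν : Fˣ →* ℂˣ, pairing (steinberg μ) (steinberg ν) = delta (μ * ν)) ∧
    (∀ ν ρ : Eˣ →* ℂˣ, Primitive F ν → Primitive F ρ →
      pairing (cuspidal b ψ ν) (cuspidal b ψ ρ) = delta (ν * ρ) + delta (ν * conj F ρ)) ∧
    (∀ μ ν₁ ν₂ : Fˣ →* ℂˣ, ν₁ ≠ ν₂ → pairing (oneDim μ) (principal ν₁ ν₂) = 0) ∧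
    (∀ μ ν : Fˣ →* ℂˣ, pairing (oneDim μ) (steinberg ν) = 0) ∧
    (∀ (μ : Fˣ →* ℂˣ) (ρ : Eˣ →* ℂˣ), Primitive F ρ →
      pairing (oneDim μ) (cuspidal b ψ ρ) = 0) ∧
    (∀ μ₁ μ₂ ν : Fˣ →* ℂˣ, μ₁ ≠ μ₂ → pairing (principal μ₁ μ₂) (steinberg ν) = 0) ∧
    (∀ (μ₁ μ₂ : Fˣ →* ℂˣ) (ρ : Eˣ →* ℂˣ), Primitive F ρ →
      pairing (principal μ₁ μ₂) (cuspidal b ψ ρ) = 0) ∧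
    (∀ (μ : Fˣ →* ℂˣ) (ρ : Eˣ →* ℂˣ), Primitive F ρ →
      pairing (steinberg μ) (cuspidal b ψ ρ) = 0) ∧
    -- contragredients, and the triple products as multiplicities in tensor products
    (∀ μ : Fˣ →* ℂˣ, Nonempty ((oneDim μ).dual.Equiv (oneDim μ⁻¹))) ∧
    (∀ μ₁ μ₂ : Fˣ →* ℂˣ, Nonempty ((principal μ₁ μ₂).dual.Equiv (principal μ₁⁻¹ μ₂⁻¹))) ∧
    (∀ μ : Fˣ →* ℂˣ, Nonempty ((steinberg μ).dual.Equiv (steinberg μ⁻¹))) ∧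
    (∀ ν : Eˣ →* ℂˣ, Primitive F ν → Primitive F ν⁻¹ ∧
      Nonempty ((cuspidal b ψ ν).dual.Equiv (cuspidal b ψ ν⁻¹))) ∧
    (∀ (V W X : Type*) [AddCommGroup V] [Module ℂ V] [FiniteDimensional ℂ V]
      [AddCommGroup W] [Module ℂ W] [FiniteDimensional ℂ W]
      [AddCommGroup X] [Module ℂ X] [FiniteDimensional ℂ X]
      (π : Representation ℂ (GL (Fin 2) F) V) (π' : Representation ℂ (GL (Fin 2) F) W)
      (π'' : Representation ℂ (GL (Fin 2) F) X),
      triple π π' π'' =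
        (Module.finrank ℂ (π''.dual.IntertwiningMap (π.tprod π')) : ℂ) ∧
      triple π π' π''.dual =
        (Module.finrank ℂ (π''.IntertwiningMap (π.tprod π')) : ℂ)) ∧
    -- the decomposition which characterizes the cuspidal representations
    (∀ ν : Eˣ →* ℂˣ, Primitive F ν → Nonempty ((centerUnipotentInd ψ ν).Equiv
      ((cuspidal b ψ ν).prod (torusInd b ν)))) ∧
    -- the list of the irreducible representations of `GL(2, F)`
    (∀ μ : Fˣ →* ℂˣ, (oneDim μ).IsIrreducible) ∧
    (∀ μ₁ μ₂ : Fˣ →* ℂˣ, (principal μ₁ μ₂).IsIrreducible ↔ μ₁ ≠ μ₂) ∧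
    (∀ μ : Fˣ →* ℂˣ, (steinberg μ).IsIrreducible) ∧
    (∀ ν : Eˣ →* ℂˣ, Primitive F ν → (cuspidal b ψ ν).IsIrreducible) ∧
    (∀ (V : Type*) [AddCommGroup V] [Module ℂ V] [FiniteDimensional ℂ V]
      (π : Representation ℂ (GL (Fin 2) F) V), π.IsIrreducible →
      (∃ μ : Fˣ →* ℂˣ, Nonempty (π.Equiv (oneDim μ))) ∨
      (∃ μ₁ μ₂ : Fˣ →* ℂˣ, μ₁ ≠ μ₂ ∧ Nonempty (π.Equiv (principal μ₁ μ₂))) ∨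
      (∃ μ : Fˣ →* ℂˣ, Nonempty (π.Equiv (steinberg μ))) ∨
      (∃ ν : Eˣ →* ℂˣ, Primitive F ν ∧ Nonempty (π.Equiv (cuspidal b ψ ν)))) ∧
    -- `PGL(2, F)`: its representations are those of `GL(2, F)` with trivial central character,
    -- with the same irreducibility and the same triple products
    (∀ (V : Type*) [AddCommGroup V] [Module ℂ V] [FiniteDimensional ℂ V]
      (π : Representation ℂ PGL(2, F) V), (inflate π).IsIrreducible ↔ π.IsIrreducible) ∧
    (∀ (V W X : Type*) [AddCommGroup V] [Module ℂ V] [FiniteDimensional ℂ V]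
      [AddCommGroup W] [Module ℂ W] [FiniteDimensional ℂ W]
      [AddCommGroup X] [Module ℂ X] [FiniteDimensional ℂ X]
      (π : Representation ℂ PGL(2, F) V) (π' : Representation ℂ PGL(2, F) W)
      (π'' : Representation ℂ PGL(2, F) X),
      triple π π' π'' = triple (inflate π) (inflate π') (inflate π'') ∧
      triple π π' π''.dual =
        (Module.finrank ℂ (π''.IntertwiningMap (π.tprod π')) : ℂ)) ∧
    (∀ μ : Fˣ →* ℂˣ, (∃ π, inflate π = oneDim μ) ↔ μ ^ 2 = 1) ∧
    (∀ μ₁ μ₂ : Fˣ →* ℂˣ, (∃ π, inflate π = principal μ₁ μ₂) ↔ μ₁ * μ₂ = 1) ∧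
    (∀ μ : Fˣ →* ℂˣ, (∃ π, inflate π = steinberg μ) ↔ μ ^ 2 = 1) ∧
    (∀ ν : Eˣ →* ℂˣ, Primitive F ν →
      ((∃ π, inflate π = cuspidal b ψ ν) ↔ res F ν = 1)) := by
  have := Module.Finite.of_basis b
  have : Finite E := Module.finite_of_finite F
  let _ : Fintype E := Fintype.ofFinite E
  have hq := card_cast_ne_zero (F := F)
  refine ⟨triple_principal_principal_principal b hψ, triple_principal_principal_steinberg b hψ,
    fun μ₁ μ₂ ν₁ ν₂ ρ hρ => triple_principal_principal_cuspidal b hψ μ₁ μ₂ ν₁ ν₂ hρ,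
    triple_principal_steinberg_steinberg b hψ, triple_steinberg_steinberg_steinberg b hψ,
    fun μ₁ μ₂ ν ρ hρ => triple_principal_steinberg_cuspidal b hψ μ₁ μ₂ ν hρ,
    fun μ₁ μ₂ ν ρ hν hρ => triple_principal_cuspidal_cuspidal b hψ μ₁ μ₂ hν hρ,
    fun μ ν ρ hρ => triple_steinberg_steinberg_cuspidal b hψ μ ν hρ,
    fun μ ν ρ hν hρ => ⟨triple_steinberg_cuspidal_cuspidal b hψ μ hν hρ,
      triple_steinberg_cuspidal_cuspidal_mem b hψ μ hν hρ⟩,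
    fun μ ν ρ hμ hν hρ => ⟨triple_cuspidal_cuspidal_cuspidal b hψ hμ hν hρ,
      triple_cuspidal_cuspidal_cuspidal_mem b hψ hμ hν hρ⟩,
    fun μ ν => nonempty_equiv_tprod (oneDim_mul_character μ ν),
    fun μ ν ρ => nonempty_equiv_tprod (oneDim_mul_principal_character b μ ν ρ),
    fun μ ν => nonempty_equiv_tprod (oneDim_mul_steinberg_character b μ ν),
    fun μ ν hν => ⟨hν.compNorm_mul μ,
      nonempty_equiv_tprod (oneDim_mul_cuspidal_character b hψ μ hν)⟩,
    fun V W _ _ _ _ _ _ π π' μ => triple_oneDim π π' μ,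
    pairing_oneDim_oneDim b hψ, pairing_principal_principal b hψ, pairing_steinberg_steinberg b hψ,
    fun ν ρ hν hρ => pairing_cuspidal_cuspidal b hψ hν hρ,
    fun μ ν₁ ν₂ h => pairing_oneDim_principal b hψ μ ν₁ ν₂ h,
    pairing_oneDim_steinberg b hψ,
    fun μ ρ hρ => pairing_oneDim_cuspidal b hψ μ hρ,
    fun μ₁ μ₂ ν h => pairing_principal_steinberg b hψ μ₁ μ₂ ν h,
    fun μ₁ μ₂ ρ hρ => pairing_principal_cuspidal b hψ μ₁ μ₂ hρ,
    fun μ ρ hρ => pairing_steinberg_cuspidal b hψ μ hρ,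
    fun μ => nonempty_equiv_of_character_eq (oneDim_dual_character μ),
    fun μ₁ μ₂ => nonempty_equiv_of_character_eq (principal_dual_character b μ₁ μ₂),
    fun μ => nonempty_equiv_of_character_eq (steinberg_dual_character b μ),
    fun ν hν => ⟨hν.inv, nonempty_equiv_of_character_eq (cuspidal_dual_character b hψ hν)⟩,
    fun V W X _ _ _ _ _ _ _ _ _ π π' π'' =>
      ⟨triple_eq_finrank π π' π'', triple_dual_eq_finrank π π' π''⟩,
    fun ν hν => nonempty_equiv_cuspidal_prod b hψ hν,
    isIrreducible_oneDim b hψ, isIrreducible_principal_iff b hψ, isIrreducible_steinberg b hψ,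
    fun ν hν => isIrreducible_cuspidal b hψ hν,
    fun V _ _ _ π hπ => exists_equiv_of_isIrreducible b hψ π hπ,
    fun V _ _ _ π => isIrreducible_inflate_iff π,
    fun V W X _ _ _ _ _ _ _ _ _ π π' π'' =>
      ⟨triple_inflate π π' π'', triple_dual_eq_finrank π π' π''⟩,
    fun μ => ?_, fun μ₁ μ₂ => ?_, fun μ => ?_, fun ν hν => ?_⟩
  · rw [char_sq]
    exact exists_inflate_eq_iff (oneDim_scalar μ)
  · have := (hasTable_principal b μ₁ μ₂).nontrivial card_cast_add_one_ne_zero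
    exact exists_inflate_eq_iff (principal_scalar μ₁ μ₂)
  · have := (hasTable_steinberg b μ).nontrivial hq
    rw [char_sq]
    exact exists_inflate_eq_iff (steinberg_scalar μ)
  · have := (hasTable_cuspidal b hψ hν).nontrivial card_cast_sub_one_ne_zero
    exact exists_inflate_eq_iff (cuspidal_scalar b ψ ν)
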